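/- Let $\Sigma,\Gamma$ be finite alphabets and let $\phi:\Sigma^*\to\Gamma^*$ be a morphism that is injective on $\Sigma^*$. The words $\phi(c)$, $c\in\Sigma$, are the *images* of $\phi$; write $\mathrm{Img}(\phi)=\{\phi(c): c\in\Sigma\}$. A word $w\in\Gamma^*$ admits an *interfered image factorization* if $w=xyz$, where $x$ is a (possibly empty) proper suffix of some image, $y$ is a (possibly empty) concatenation of images, $z$ is a (possibly empty) proper prefix of some image, and $xz\neq\varepsilon$. The word $w$ is an *inner image factor* if it is a proper factor of some image $\phi(c)$ but neither a prefix nor a suffix of $\phi(c)$. The morphism $\phi$ is *interference-free* on $\{u\}$ if $u=\varepsilon$, or $\phi(u)$ neither admits an interfered image factorization nor is an inner image factor. For $u\in\Sigma^*$ put $m=\sum_{x\in \mathrm{Img}(\phi)}|x|$, $w=\phi(u)$, $n=|w|$, and $\mathit{occ}=\sum_{x\in \mathrm{Img}(\phi)}\mathrm{occ}_x(w)$, where $\mathrm{occ}_x(w)$ is the number of occurrences of $x$ in $w$. **Theorem.** Given $\phi$ and $u$, whether $\phi$ is interference-free on $\{u\}$ can be decided in $O(m+n+\mathit{occ})$ expected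 time by a randomized word-RAM algorithm that never errs. Precisely: there are one program $P$ for the randomized word RAM (unit-cost arithmetic, bitwise operations, comparisons, indirect addressing and draws of independent uniform random words) and absolute constants $C,K$ such that the following holds for every word length $b$ with $2^{b}\ge K(m+n+1)$, every numbering of $\Sigma$ by $0,\dots,|\Sigma|-1$ and every representation of the letters of $\Gamma$ by distinct $b$-bit words. The input consists of $|\Sigma|$, $|u|$, the concatenation of the images, the list of their lengths, and $u$, and all other memory is initially zero. Whenever $P$ halts, its answer is correct, and its expected running time is at most $C(m+n+\mathit{occ}+1)$. -/

import Mathlib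

open scoped ENNReal

/-! ### Morphisms of free monoids and interference -/

namespace WordMorphism

variable {A B : Type*}

/-- The set of images `φ(c)`, for `c` a letter. -/
def images (φ : FreeMonoid A →* FreeMonoid B) : Set (FreeMonoid B) :=
  Set.range fun c : A => φ (FreeMonoid.of c)

/-- `x` is a prefix of `v` and `x ≠ v`. The empty word is allowed. -/
def IsProperPrefix (x v : FreeMonoid B) : Prop :=
  x.toList <+: v.toList ∧ x ≠ v

/-- `x` is a suffix of `v` and `x ≠ v`. The empty word is allowed. -/
def IsProperSuffix (x v : FreeMonoid B) : Prop :=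
  x.toList <:+ v.toList ∧ x ≠ v

/-- `w = X₁ ⋯ Xₖ` with every `Xᵢ` an image of `φ`; `k = 0` (so `w = ε`) is allowed. -/
def HasImageFactorization (φ : FreeMonoid A →* FreeMonoid B) (w : FreeMonoid B) : Prop :=
  ∃ X : List (FreeMonoid B), (∀ x ∈ X, x ∈ images φ) ∧ w = X.prod

/-- `w = x y z` with `x` a proper suffix of an image, `y` a product of images, `z` a proper prefix
of an image, and `x z ≠ ε`. -/
def HasInterferedImageFactorization (φ : FreeMonoid A →* FreeMonoid B) (w : FreeMonoid B) : Prop :=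
  ∃ x y z : FreeMonoid B, w = x * y * z ∧
    (∃ v ∈ images φ, IsProperSuffix x v) ∧
    HasImageFactorization φ y ∧
    (∃ v ∈ images φ, IsProperPrefix z v) ∧
    x * z ≠ 1

/-- `w` is a proper factor of some image, but neither a prefix nor a suffix of that image. -/
def IsInnerImageFactor (φ : FreeMonoid A →* FreeMonoid B) (w : FreeMonoid B) : Prop :=
  ∃ v ∈ images φ, (w.toList <:+: v.toList ∧ w ≠ v) ∧
    ¬ w.toList <+: v.toList ∧ ¬ w.toList <:+ v.toList

/-- The morphism `φ` is interference-free on the language `L`. -/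
def InterferenceFreeOn (φ : FreeMonoid A →* FreeMonoid B) (L : Set (FreeMonoid A)) : Prop :=
  ∀ u ∈ L, u ≠ 1 →
    ¬ HasInterferedImageFactorization φ (φ u) ∧ ¬ IsInnerImageFactor φ (φ u)

/-- The set of (zero-based) starting positions of occurrences of `x` in `w`. The empty word
occurs `|w| + 1` times. -/
def occurrences (x w : FreeMonoid B) : Set ℕ :=
  {i | i ≤ w.length ∧ x.toList <+: w.toList.drop i}

/-- The number of occurrences of `x` in `w`. -/
noncomputable def occ (x w : FreeMonoid B) : ℕ := (occurrences x w).ncard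

/-- The total length of the images (a sum over the set of images). -/
noncomputable def totalLength (φ : FreeMonoid A →* FreeMonoid B) : ℕ :=
  ∑ᶠ x ∈ images φ, x.length

/-- The total number of occurrences in `w` of the images (a sum over the set of images). -/
noncomputable def totalOcc (φ : FreeMonoid A →* FreeMonoid B) (w : FreeMonoid B) : ℕ :=
  ∑ᶠ x ∈ images φ, occ x w

end WordMorphism

/-! ### The randomized word RAM

Words have `w` bits. The memory consists of registers and of arrays, every array being addressed by
words and holding words; a program is a finite piece of syntax, independent of `w`, so it uses only
finitely many of them. Every operation, memory access, test and random draw costs one step. -/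

namespace WordRAM

/-- The arithmetical and logical word operations. -/
inductive Op
  | add | sub | mul | div | mod | and | or | xor | shl | shr | eq | lt

/-- Operations act on `w`-bit words, seen as unsigned integers modulo `2 ^ w`; a comparison
returns `1` or `0`. -/
def Op.eval {w : ℕ} (o : Op) (x y : BitVec w) : BitVec w :=
  match o with
  | .add => x + y
  | .sub => x - y
  | .mul => x * y
  | .div => x / y
  | .mod => x % y
  | .and => x &&& y
  | .or => x ||| y
  | .xor => x ^^^ y
  | .shl => x <<< y.toNat
  | .shr => x >>> y.toNat
  | .eq => if x = y then 1 else 0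
  | .lt => if x < y then 1 else 0

/-- Expressions: numerals, registers, array cells, and operations. -/
inductive Expr
  | lit (n : ℕ)
  | reg (i : ℕ)
  | cell (a : ℕ) (addr : Expr)
  | bin (o : Op) (e₁ e₂ : Expr)

/-- Programs: assignment to a register, assignment to an array cell, drawing a uniformly random
word into a register, sequencing, branching and looping (a test succeeds when it is not `0`). -/
inductive Program
  | assign (i : ℕ) (e : Expr)
  | store (a : ℕ) (addr e : Expr)
  | random (i : ℕ)
  | seq (P Q : Program)
  | cond (e : Expr) (P Q : Program)
  | loop (e : Expr) (P : Program)

/-- A memory state: registers, arrays, and the number of random words drawn so far. -/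
@[ext]
structure State (w : ℕ) where
  reg : ℕ → BitVec w
  cell : ℕ → BitVec w → BitVec w
  drawn : ℕ

/-- The value of an expression. -/
def Expr.eval {w : ℕ} (s : State w) : Expr → BitVec w
  | .lit n => BitVec.ofNat w n
  | .reg i => s.reg i
  | .cell a addr => s.cell a (addr.eval s)
  | .bin o e₁ e₂ => o.eval (e₁.eval s) (e₂.eval s)

/-- The number of steps needed to evaluate an expression. -/
def Expr.cost : Expr → ℕ
  | .lit _ => 1
  | .reg _ => 1
  | .cell _ addr => addr.cost + 1
  | .bin _ e₁ e₂ => e₁.cost + e₂.cost + 1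

/-- Write the word `v` into register `i`. -/
def State.setReg {w : ℕ} (s : State w) (i : ℕ) (v : BitVec w) : State w :=
  { s with reg := Function.update s.reg i v }

/-- Write the word `v` into the cell of array `a` at address `addr`. -/
def State.setCell {w : ℕ} (s : State w) (a : ℕ) (addr v : BitVec w) : State w :=
  { s with cell := Function.update s.cell a (Function.update (s.cell a) addr v) }

/-- Write the next word of the random tape `ω` into register `i`. -/
def State.draw {w : ℕ} (s : State w) (ω : ℕ → BitVec w) (i : ℕ) : State w :=
  { s.setReg i (ω s.drawn) with drawn := s.drawn + 1 }

/-- `Exec ω P s t s'`: with random words taken from the tape `ω`, the program `P` started in `s`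
halts in `s'` after exactly `t` steps. -/
inductive Exec {w : ℕ} (ω : ℕ → BitVec w) : Program → State w → ℕ → State w → Prop
  | assign (i : ℕ) (e : Expr) (s : State w) :
      Exec ω (.assign i e) s (e.cost + 1) (s.setReg i (e.eval s))
  | store (a : ℕ) (addr e : Expr) (s : State w) :
      Exec ω (.store a addr e) s (addr.cost + e.cost + 1) (s.setCell a (addr.eval s) (e.eval s))
  | random (i : ℕ) (s : State w) :
      Exec ω (.random i) s 1 (s.draw ω i)
  | seq {P Q : Program} {s s₁ s₂ : State w} {t₁ t₂ : ℕ} :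
      Exec ω P s t₁ s₁ → Exec ω Q s₁ t₂ s₂ → Exec ω (.seq P Q) s (t₁ + t₂) s₂
  | cond_true {e : Expr} {P Q : Program} {s s₁ : State w} {t : ℕ} :
      e.eval s ≠ 0 → Exec ω P s t s₁ → Exec ω (.cond e P Q) s (e.cost + 1 + t) s₁
  | cond_false {e : Expr} {P Q : Program} {s s₁ : State w} {t : ℕ} :
      e.eval s = 0 → Exec ω Q s t s₁ → Exec ω (.cond e P Q) s (e.cost + 1 + t) s₁
  | loop_true {e : Expr} {P : Program} {s s₁ s₂ : State w} {t₁ t₂ : ℕ} :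
      e.eval s ≠ 0 → Exec ω P s t₁ s₁ → Exec ω (.loop e P) s₁ t₂ s₂ →
        Exec ω (.loop e P) s (e.cost + 1 + t₁ + t₂) s₂
  | loop_false {e : Expr} {P : Program} {s : State w} :
      e.eval s = 0 → Exec ω (.loop e P) s (e.cost + 1) s

/-- For a fixed random tape, the running time and the final state are unique. -/
theorem Exec.unique {w : ℕ} {ω : ℕ → BitVec w} {P : Program} {s s₁ s₂ : State w} {t₁ t₂ : ℕ}
    (h₁ : Exec ω P s t₁ s₁) (h₂ : Exec ω P s t₂ s₂) : t₁ = t₂ ∧ s₁ = s₂ := by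
  induction h₁ generalizing t₂ s₂ with
  | assign => cases h₂; simp
  | store => cases h₂; simp
  | random => cases h₂; simp
  | seq _ _ ihP ihQ =>
    cases h₂ with
    | seq hP hQ =>
      obtain ⟨rfl, rfl⟩ := ihP hP
      obtain ⟨rfl, rfl⟩ := ihQ hQ
      simp
  | cond_true he _ ih =>
    cases h₂ with
    | cond_true _ h => obtain ⟨rfl, rfl⟩ := ih h; simp
    | cond_false he' _ => exact absurd he' he
  | cond_false he _ ih =>
    cases h₂ with
    | cond_true he' _ => exact absurd he he'
    | cond_false _ h => obtain ⟨rfl, rfl⟩ := ih h; simp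
  | loop_true he _ _ ihP ihL =>
    cases h₂ with
    | loop_true _ hP hL =>
      obtain ⟨rfl, rfl⟩ := ihP hP
      obtain ⟨rfl, rfl⟩ := ihL hL
      simp
    | loop_false he' => exact absurd he' he
  | loop_false he =>
    cases h₂ with
    | loop_true he' _ _ => exact absurd he he'
    | loop_false _ => simp

/-- Every set of words is measurable. -/
instance instMeasurableSpaceWord (w : ℕ) : MeasurableSpace (BitVec w) := ⊤

/-- The law of the random tape: independent uniformly distributed words. -/
noncomputable def tapeLaw (w : ℕ) : MeasureTheory.Measure (ℕ → BitVec w) :=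
  MeasureTheory.Measure.infinitePi fun _ : ℕ => (PMF.uniformOfFintype (BitVec w)).toMeasure

/-- The running time of `P` from `s` on the tape `ω`; it is `∞` if the run does not halt. -/
noncomputable def runTime {w : ℕ} (P : Program) (s : State w) (ω : ℕ → BitVec w) : ℝ≥0∞ :=
  ⨅ (t : ℕ) (s' : State w) (_ : Exec ω P s t s'), (t : ℝ≥0∞)

/-- The expected running time of `P` from `s`. -/
noncomputable def expectedTime {w : ℕ} (P : Program) (s : State w) : ℝ≥0∞ :=
  ∫⁻ ω, runTime P s ω ∂(tapeLaw w)

/-- The answer of `P` from `s`, left in register `0`, is never wrong: whenever a run halts, it is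
`1` if `p` holds and `0` if `p` fails. -/
def AnswersCorrectly {w : ℕ} (P : Program) (s : State w) (p : Prop) : Prop :=
  ∀ (ω : ℕ → BitVec w) (t : ℕ) (s' : State w), Exec ω P s t s' →
    (p → s'.reg 0 = 1) ∧ (¬ p → s'.reg 0 = 0)

/-- The array whose first cells hold the words in `l`, all other cells being `0`. -/
def arrayOf {w : ℕ} (l : List (BitVec w)) : BitVec w → BitVec w :=
  fun addr => l.getD addr.toNat 0

/-- The initial memory for the input `(φ, u)`. The letters of the source alphabet are numbered
`0, …, σ - 1` by `num`, those of the target alphabet are represented by distinct words through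
`code`. Register `0` holds `σ`, register `1` holds `|u|`; array `0` holds the concatenation of
the images `φ(0), …, φ(σ - 1)`, array `1` holds their lengths, and array `2` holds `u`. Everything
else is `0`. -/
def inputState {A B : Type*} {w σ : ℕ} (num : A ≃ Fin σ) (code : B ↪ BitVec w)
    (φ : FreeMonoid A →* FreeMonoid B) (u : FreeMonoid A) : State w where
  reg := fun i =>
    match i with
    | 0 => BitVec.ofNat w σ
    | 1 => BitVec.ofNat w u.length
    | _ => 0
  cell := fun a =>
    match a with
    | 0 => arrayOf ((List.ofFn fun k : Fin σ =>
        (φ (FreeMonoid.of (num.symm k))).toList.map code).flatten)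
    | 1 => arrayOf (List.ofFn fun k : Fin σ =>
        BitVec.ofNat w (φ (FreeMonoid.of (num.symm k))).length)
    | 2 => arrayOf (u.toList.map fun c => BitVec.ofNat w (num c : ℕ))
    | _ => fun _ => 0
  drawn := 0

end WordRAM

/-! ### Reasoning about word RAM programs -/

namespace WordRAM

/-! The program builds the Aho–Corasick automaton of the images together with the text `T = φ(u)`,
keeps its edges in a randomized hash table, and decides the question by dynamic programming over the
prefixes of `T`.

Splitting an interfered factorization `x y z` according to which of `x` and `z` are empty
(`interfered_iff`) shows that two facts about each prefix of `T` suffice: whether it is a product of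
images, and whether it is such a product preceded by a nonempty proper suffix of an image. Both obey
the recurrence `extends_iff`, which removes the last image. The images ending at a given position
are listed along failure links. The possible `x` are the prefixes of `T` met on the failure chains
of the images, and the possible nonempty `z` are the proper prefixes of images met on the failure
chain of `T`. Whether `T` is a prefix, suffix or factor of a word of the trie is inherited from its
parent and its failure word, which settles inner factors.

An edge from node `x` along letter `c` is hashed to the exclusive or of `c` with a random mask of
`x`. Equal masks cancel, so a lookup is exact on every tape (`Table.runs_lookup`); randomness
affects only the time. Two different nodes have independent masks, so a given lookup meets at most
one collision on average (`lintegral_coll_le`). The searches for failure links make linearly many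
lookups in total, with the length of the failure word as potential (`sum_card_searches_le`). The
dynamic programme makes one round per occurrence of an image (`sum_suffixCount_le`), and the rest is
linear in the layout.

Injectivity makes the images nonempty and pairwise distinct. Hence there are at most `m` letters,
`|u| ≤ n`, the sums over the set of images are sums over letters, and removing an image always
shortens a prefix.

Running times are proved for a fixed tape: memory is read as natural numbers, straight-line code is
executed symbolically by `wp`, and loops are handled by invariants that carry a time credit
(`Runs.loop`). Only the resulting bound is integrated over the tape. -/

/-- A memory state whose words are read as natural numbers. -/
@[ext]
structure Mem where
  reg : ℕ → ℕ
  cell : ℕ → ℕ → ℕ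
  drawn : ℕ

/-- The natural-number view of a memory state; addresses that are not words hold `0`. -/
def State.mem {w : ℕ} (s : State w) : Mem where
  reg i := (s.reg i).toNat
  cell a n := if n < 2 ^ w then (s.cell a (BitVec.ofNat w n)).toNat else 0
  drawn := s.drawn

/-- Write `v` into register `i`. -/
def Mem.setReg (m : Mem) (i v : ℕ) : Mem :=
  { m with reg := Function.update m.reg i v }

/-- Write `v` into the cell of array `a` at address `n`. -/
def Mem.setCell (m : Mem) (a n v : ℕ) : Mem :=
  { m with cell := Function.update m.cell a (Function.update (m.cell a) n v) }

/-- Put the random number `v` into register `i`. -/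
def Mem.draw (m : Mem) (i v : ℕ) : Mem :=
  { m.setReg i v with drawn := m.drawn + 1 }

@[simp] theorem Mem.setReg_reg (m : Mem) (i v j : ℕ) :
    (m.setReg i v).reg j = if j = i then v else m.reg j := by
  simp [Mem.setReg, Function.update_apply]

@[simp] theorem Mem.setReg_cell (m : Mem) (i v : ℕ) : (m.setReg i v).cell = m.cell := rfl

@[simp] theorem Mem.setReg_drawn (m : Mem) (i v : ℕ) : (m.setReg i v).drawn = m.drawn := rfl

@[simp] theorem Mem.setCell_reg (m : Mem) (a n v : ℕ) : (m.setCell a n v).reg = m.reg := rfl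

@[simp] theorem Mem.setCell_drawn (m : Mem) (a n v : ℕ) : (m.setCell a n v).drawn = m.drawn := rfl

@[simp] theorem Mem.setCell_cell (m : Mem) (a n v b : ℕ) :
    (m.setCell a n v).cell b =
      if b = a then Function.update (m.cell a) n v else m.cell b := by
  simp only [Mem.setCell, Function.update_apply]

@[simp] theorem Mem.draw_reg (m : Mem) (i v j : ℕ) :
    (m.draw i v).reg j = if j = i then v else m.reg j := by
  simp [Mem.draw]

@[simp] theorem Mem.draw_cell (m : Mem) (i v : ℕ) : (m.draw i v).cell = m.cell := rfl

@[simp] theorem Mem.draw_drawn (m : Mem) (i v : ℕ) : (m.draw i v).drawn = m.drawn + 1 := rfl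

/-- The operations on natural numbers, without wrapping around. -/
def Op.nat (o : Op) (x y : ℕ) : ℕ :=
  match o with
  | .add => x + y
  | .sub => x - y
  | .mul => x * y
  | .xor => x ^^^ y
  | .eq => if x = y then 1 else 0
  | .lt => if x < y then 1 else 0
  | _ => 0

/-- The operation does not wrap around on words below `W`. -/
def Op.Safe (o : Op) (W x y : ℕ) : Prop :=
  match o with
  | .add => x + y < W
  | .sub => y ≤ x
  | .mul => x * y < W
  | .xor => True
  | .eq => True
  | .lt => True
  | _ => False

/-- The value of an expression, without wrapping around. -/
def Expr.val (m : Mem) : Expr → ℕ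
  | .lit n => n
  | .reg i => m.reg i
  | .cell a e => m.cell a (e.val m)
  | .bin o e₁ e₂ => o.nat (e₁.val m) (e₂.val m)

/-- The evaluation of the expression does not wrap around on words below `W`. -/
def Expr.Safe (W : ℕ) (m : Mem) : Expr → Prop
  | .lit n => n < W
  | .reg _ => True
  | .cell _ e => e.Safe W m
  | .bin o e₁ e₂ => e₁.Safe W m ∧ e₂.Safe W m ∧ o.Safe W (e₁.val m) (e₂.val m)

/-! ### From words to natural numbers. -/

section Transfer

variable {w : ℕ}

/-- With `w = 0` the words `0` and `1` coincide, so the comparisons need `0 < w`. -/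
theorem Op.toNat_eval (hw : 0 < w) (o : Op) (x y : BitVec w)
    (h : o.Safe (2 ^ w) x.toNat y.toNat) : (o.eval x y).toNat = o.nat x.toNat y.toNat := by
  cases o <;> simp only [Op.Safe] at h <;> simp only [Op.eval, Op.nat]
  · rw [BitVec.toNat_add, Nat.mod_eq_of_lt h]
  · exact BitVec.toNat_sub_of_le (by simpa [BitVec.le_def] using h)
  · rw [BitVec.toNat_mul, Nat.mod_eq_of_lt h]
  · exact BitVec.toNat_xor x y
  · by_cases hxy : x = y
    · simp [hxy, hw]
    · have : x.toNat ≠ y.toNat := fun h' => hxy (BitVec.eq_of_toNat_eq h')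
      simp [hxy, this]
  · by_cases hxy : x < y
    · have : x.toNat < y.toNat := BitVec.lt_def.1 hxy
      simp [hxy, this, hw]
    · have : ¬ x.toNat < y.toNat := fun h' => hxy (BitVec.lt_def.2 h')
      simp [hxy, this]

theorem Expr.toNat_eval (hw : 0 < w) (s : State w) (e : Expr) (h : e.Safe (2 ^ w) s.mem) :
    (e.eval s).toNat = e.val s.mem := by
  induction e with
  | lit n => simpa [Expr.eval, Expr.val] using Nat.mod_eq_of_lt h
  | reg i => rfl
  | cell a e ih =>
    have := ih h
    simp only [Expr.eval, Expr.val, State.mem]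
    simp only [State.mem] at this
    rw [← this]
    simp [(e.eval s).isLt]
  | bin o e₁ e₂ ih₁ ih₂ =>
    obtain ⟨h₁, h₂, h₃⟩ := h
    simp only [Expr.eval, Expr.val]
    rw [← ih₁ h₁, ← ih₂ h₂] at h₃ ⊢
    exact Op.toNat_eval hw o _ _ h₃

theorem State.mem_setReg (s : State w) (i : ℕ) (v : BitVec w) :
    (s.setReg i v).mem = s.mem.setReg i v.toNat := by
  ext j
  · simp only [State.mem, State.setReg, Mem.setReg, Function.update_apply]
    split_ifs <;> rfl
  · rfl
  · rfl

theorem State.mem_setCell (s : State w) (a : ℕ) (x v : BitVec w) :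
    (s.setCell a x v).mem = s.mem.setCell a x.toNat v.toNat := by
  ext b n
  · rfl
  · simp only [State.mem, State.setCell, Mem.setCell, Function.update_apply]
    by_cases hb : b = a
    · subst hb
      by_cases hn : n < 2 ^ w
      · have : BitVec.ofNat w n = x ↔ n = x.toNat := by
          constructor
          · rintro rfl
            simp [Nat.mod_eq_of_lt hn]
          · rintro rfl
            simp
        by_cases h : n = x.toNat
        · simp [h, x.isLt]
        · simp [this, h, hn]
      · have : n ≠ x.toNat := by have := x.isLt; omega
        simp [hn, this]
    · simp [hb]
  · rfl

theorem State.mem_draw (s : State w) (ω : ℕ → BitVec w) (i : ℕ) :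
    (s.draw ω i).mem = s.mem.draw i (ω s.drawn).toNat := by
  have := State.mem_setReg s i (ω s.drawn)
  simp only [Mem.ext_iff] at this
  ext j
  · exact congrFun this.1 j
  · rfl
  · rfl

end Transfer

/-- Every run of `P` from a state with contents `m` halts, and its running time and the final
contents satisfy `Q`. -/
def Runs {w : ℕ} (ω : ℕ → BitVec w) (P : Program) (m : Mem) (Q : ℕ → Mem → Prop) : Prop :=
  ∀ s : State w, s.mem = m → ∃ t s', Exec ω P s t s' ∧ Q t s'.mem

/-- The programs of the list, one after the other. -/
def Program.block : List Program → Program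
  -- The syntax has no empty program; register `99` is used nowhere else, so this assignment serves
  -- as one.
  | [] => .assign 99 (.lit 0)
  | [P] => P
  | P :: Q :: l => .seq P (Program.block (Q :: l))

/-- The registers that the program may change. -/
def Program.regs : Program → List ℕ
  | .assign i _ => [i]
  | .store _ _ _ => []
  | .random i => [i]
  | .seq P Q => P.regs ++ Q.regs
  | .cond _ P Q => P.regs ++ Q.regs
  | .loop _ P => P.regs

/-- The arrays that the program may change. -/
def Program.arrays : Program → List ℕ
  | .assign _ _ => []
  | .store a _ _ => [a]
  | .random _ => []
  | .seq P Q => P.arrays ++ Q.arrays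
  | .cond _ P Q => P.arrays ++ Q.arrays
  | .loop _ P => P.arrays

/-- The contents agree outside what the program may change. -/
structure Frame (P : Program) (m m' : Mem) : Prop where
  reg : ∀ i, i ∉ P.regs → m'.reg i = m.reg i
  cell : ∀ a, a ∉ P.arrays → m'.cell a = m.cell a

theorem Frame.refl (P : Program) (m : Mem) : Frame P m m := ⟨fun _ _ => rfl, fun _ _ => rfl⟩

theorem Frame.trans {P : Program} {m₁ m₂ m₃ : Mem} (h₁ : Frame P m₁ m₂) (h₂ : Frame P m₂ m₃) :
    Frame P m₁ m₃ :=
  ⟨fun i hi => (h₂.reg i hi).trans (h₁.reg i hi),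
    fun a ha => (h₂.cell a ha).trans (h₁.cell a ha)⟩

/-! ### Proof rules for programs and their running times. -/

section Rules

variable {w : ℕ} {ω : ℕ → BitVec w}

theorem Exec.frame {P : Program} {s s' : State w} {t : ℕ} (h : Exec ω P s t s') :
    Frame P s.mem s'.mem := by
  induction h with
  | assign i e s =>
    rw [State.mem_setReg]
    exact ⟨fun j hj => by simp [Program.regs] at hj; simp [hj], fun _ _ => rfl⟩
  | store a x e s =>
    rw [State.mem_setCell]
    exact ⟨fun _ _ => rfl, fun j hj => by simp [Program.arrays] at hj; simp [hj]⟩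
  | random i s =>
    rw [State.mem_draw]
    exact ⟨fun j hj => by simp [Program.regs] at hj; simp [hj], fun _ _ => rfl⟩
  | seq _ _ ih₁ ih₂ =>
    exact Frame.trans
      ⟨fun i hi => ih₁.reg i (by simp [Program.regs] at hi; exact hi.1),
        fun a ha => ih₁.cell a (by simp [Program.arrays] at ha; exact ha.1)⟩
      ⟨fun i hi => ih₂.reg i (by simp [Program.regs] at hi; exact hi.2),
        fun a ha => ih₂.cell a (by simp [Program.arrays] at ha; exact ha.2)⟩
  | cond_true _ _ ih =>
    exact ⟨fun i hi => ih.reg i (by simp [Program.regs] at hi; exact hi.1),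
        fun a ha => ih.cell a (by simp [Program.arrays] at ha; exact ha.1)⟩
  | cond_false _ _ ih =>
    exact ⟨fun i hi => ih.reg i (by simp [Program.regs] at hi; exact hi.2),
        fun a ha => ih.cell a (by simp [Program.arrays] at ha; exact ha.2)⟩
  | loop_true _ _ _ ih₁ ih₂ =>
    exact Frame.trans ⟨fun i hi => ih₁.reg i hi, fun a ha => ih₁.cell a ha⟩ ih₂
  | loop_false _ => exact Frame.refl _ _

/-- The program draws no random words. -/
def Program.Deterministic : Program → Prop
  | .assign _ _ => True
  | .store _ _ _ => True
  | .random _ => False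
  | .seq P Q => P.Deterministic ∧ Q.Deterministic
  | .cond _ P Q => P.Deterministic ∧ Q.Deterministic
  | .loop _ P => P.Deterministic

theorem Exec.drawn_eq {P : Program} {s s' : State w} {t : ℕ} (h : Exec ω P s t s')
    (hP : P.Deterministic) : s'.drawn = s.drawn := by
  induction h with
  | assign | store | loop_false => rfl
  | random => exact hP.elim
  | seq _ _ ih₁ ih₂ => exact (ih₂ hP.2).trans (ih₁ hP.1)
  | cond_true _ _ ih => exact ih hP.1
  | cond_false _ _ ih => exact ih hP.2
  | loop_true _ _ _ ih₁ ih₂ => exact (ih₂ hP).trans (ih₁ hP)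

variable {P R : Program} {m : Mem} {Q Q' : ℕ → Mem → Prop} {e : Expr}

theorem Runs.mono (h : Runs ω P m Q) (hQ : ∀ t m', Q t m' → Q' t m') : Runs ω P m Q' := by
  intro s hs
  obtain ⟨t, s', h₁, h₂⟩ := h s hs
  exact ⟨t, s', h₁, hQ _ _ h₂⟩

/-- The specification may be strengthened by what the program cannot change. -/
theorem Runs.frame (h : Runs ω P m Q) :
    Runs ω P m fun t m' => Q t m' ∧ Frame P m m' := by
  intro s hs
  obtain ⟨t, s', h₁, h₂⟩ := h s hs
  exact ⟨t, s', h₁, h₂, hs ▸ h₁.frame⟩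

theorem Runs.drawn (h : Runs ω P m Q) (hP : P.Deterministic) :
    Runs ω P m fun t m' => Q t m' ∧ m'.drawn = m.drawn := by
  intro s hs
  obtain ⟨t, s', h₁, h₂⟩ := h s hs
  exact ⟨t, s', h₁, h₂, hs ▸ h₁.drawn_eq hP⟩

/-- The weakest precondition of a program, symbolically executed up to its loops. -/
def Program.wp {w : ℕ} (ω : ℕ → BitVec w) : Program → (ℕ → Mem → Prop) → Mem → Prop
  | .assign i e, Q, m => e.Safe (2 ^ w) m ∧ Q (e.cost + 1) (m.setReg i (e.val m))
  | .store a x e, Q, m => x.Safe (2 ^ w) m ∧ e.Safe (2 ^ w) m ∧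
      Q (x.cost + e.cost + 1) (m.setCell a (x.val m) (e.val m))
  | .random i, Q, m => Q 1 (m.draw i (ω m.drawn).toNat)
  | .seq P R, Q, m => P.wp ω (fun t m' => R.wp ω (fun t' m'' => Q (t + t') m'') m') m
  | .cond e P R, Q, m => e.Safe (2 ^ w) m ∧
      (e.val m ≠ 0 → P.wp ω (fun t m' => Q (e.cost + 1 + t) m') m) ∧
      (e.val m = 0 → R.wp ω (fun t m' => Q (e.cost + 1 + t) m') m)
  | .loop e P, Q, m => Runs ω (.loop e P) m Q

attribute [simp] Op.nat Op.Safe Expr.val Expr.Safe Expr.cost Program.wp Program.block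

/-- This turns code without loops into a computation for `simp`. For a loop, `wp` is `Runs` itself,
so that `Runs.loop` or a lemma about the loop has to take over there. -/
theorem Runs.of_wp (hw : 0 < w) : P.wp ω Q m → Runs ω P m Q := by
  induction P generalizing Q m with
  | assign i e =>
    rintro ⟨h₁, h₂⟩ s rfl
    refine ⟨_, _, Exec.assign i e s, ?_⟩
    rwa [State.mem_setReg, Expr.toNat_eval hw _ _ h₁]
  | store a x e =>
    rintro ⟨h₁, h₂, h₃⟩ s rfl
    refine ⟨_, _, Exec.store a x e s, ?_⟩
    rwa [State.mem_setCell, Expr.toNat_eval hw _ _ h₁, Expr.toNat_eval hw _ _ h₂]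
  | random i =>
    rintro h s rfl
    refine ⟨_, _, Exec.random i s, ?_⟩
    rwa [State.mem_draw]
  | seq P R ihP ihR =>
    intro h s hs
    obtain ⟨t, s', h₁, h₂⟩ := ihP h s hs
    obtain ⟨t', s'', h₃, h₄⟩ := ihR h₂ s' rfl
    exact ⟨_, _, h₁.seq h₃, h₄⟩
  | cond e P R ihP ihR =>
    rintro ⟨h₁, h₂, h₃⟩ s rfl
    have hv := Expr.toNat_eval hw _ _ h₁
    by_cases he : e.val s.mem = 0
    · obtain ⟨t, s', h₄, h₅⟩ := ihR (h₃ he) s rfl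
      refine ⟨_, _, Exec.cond_false ?_ h₄, h₅⟩
      exact BitVec.eq_of_toNat_eq (by simpa [he] using hv)
    · obtain ⟨t, s', h₄, h₅⟩ := ihP (h₂ he) s rfl
      refine ⟨_, _, Exec.cond_true ?_ h₄, h₅⟩
      intro h0
      exact he (by rw [← hv, h0]; simp)
  | loop e P => exact id

theorem Runs.seq (h : Runs ω P m fun t m' => Runs ω R m' fun t' m'' => Q (t + t') m'') :
    Runs ω (.seq P R) m Q := by
  intro s hs
  obtain ⟨t, s', h₁, h₂⟩ := h s hs
  obtain ⟨t', s'', h₃, h₄⟩ := h₂ s' rfl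
  exact ⟨_, _, h₁.seq h₃, h₄⟩

theorem Runs.cond (hw : 0 < w) (h : e.Safe (2 ^ w) m)
    (h₁ : e.val m ≠ 0 → Runs ω P m fun t m' => Q (e.cost + 1 + t) m')
    (h₂ : e.val m = 0 → Runs ω R m fun t m' => Q (e.cost + 1 + t) m') :
    Runs ω (.cond e P R) m Q := by
  rintro s rfl
  have hv := Expr.toNat_eval hw _ _ h
  by_cases he : e.val s.mem = 0
  · obtain ⟨t, s', h₄, h₅⟩ := h₂ he s rfl
    refine ⟨_, _, Exec.cond_false ?_ h₄, h₅⟩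
    exact BitVec.eq_of_toNat_eq (by simpa [he] using hv)
  · obtain ⟨t, s', h₄, h₅⟩ := h₁ he s rfl
    refine ⟨_, _, Exec.cond_true ?_ h₄, h₅⟩
    intro h0
    exact he (by rw [← hv, h0]; simp)

/-- The rule for loops. The invariant `I k` carries a credit `k`, from which the running time of
every round is paid. -/
theorem Runs.loop (hw : 0 < w) (I : ℕ → Mem → Prop) {k : ℕ} (h : I k m)
    (hs : ∀ k m', Frame (.loop e P) m m' → I k m' → e.Safe (2 ^ w) m' ∧
      (e.val m' ≠ 0 → Runs ω P m' fun t m'' => ∃ k', I k' m'' ∧ e.cost + 1 + t + k' ≤ k)) :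
    Runs ω (.loop e P) m fun t m' => ∃ k', I k' m' ∧ e.val m' = 0 ∧ t + k' ≤ k + e.cost + 1 := by
  suffices H : ∀ k m', Frame (.loop e P) m m' → I k m' → Runs ω (.loop e P) m' fun t m'' =>
      ∃ k', I k' m'' ∧ e.val m'' = 0 ∧ t + k' ≤ k + e.cost + 1 from H k m (Frame.refl _ _) h
  intro k
  -- Each round pays at least `e.cost + 1 > 0`, so the credit strictly decreases; induction on it
  -- gives termination and the time bound at once.
  induction k using Nat.strong_induction_on with
  | _ k ih =>
    rintro m₁ hf hI s rfl
    obtain ⟨h₁, h₂⟩ := hs k _ hf hI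
    have hv := Expr.toNat_eval hw _ _ h₁
    by_cases he : e.val s.mem = 0
    · refine ⟨_, _, Exec.loop_false (BitVec.eq_of_toNat_eq (by simpa [he] using hv)), k, hI, he, ?_⟩
      omega
    · obtain ⟨t, s', h₃, ⟨k', hI', hk⟩, hf'⟩ := (h₂ he).frame s rfl
      obtain ⟨t', s'', h₄, k'', hI'', he'', hk''⟩ := ih k' (by omega) s'.mem
        (hf.trans ⟨hf'.reg, hf'.cell⟩) hI' s' rfl
      refine ⟨_, _, Exec.loop_true ?_ h₃ h₄, k'', hI'', he'', by omega⟩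
      intro h0
      exact he (by rw [← hv, h0]; simp)

end Rules

end WordRAM

/-! ### Tries of words laid out in an array -/

namespace WordTrie

/-! ### The last earlier number with a property: heads and links of chains. -/

section LastBelow

open Classical in
/-- The last number below `b` with the property `p`, or `0` if there is none. -/
noncomputable def lastBelow (p : ℕ → Prop) : ℕ → ℕ
  | 0 => 0
  | b + 1 => if p b then b else lastBelow p b

variable {p q : ℕ → Prop} {b v : ℕ}

theorem lastBelow_succ_of_pos (h : p b) : lastBelow p (b + 1) = b := by
  simp [lastBelow, h]

theorem lastBelow_succ_of_neg (h : ¬ p b) : lastBelow p (b + 1) = lastBelow p b := by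
  simp [lastBelow, h]

theorem le_lastBelow (hv : v < b) (h : p v) : v ≤ lastBelow p b := by
  induction b with
  | zero => omega
  | succ b ih =>
    rw [lastBelow]
    split_ifs with hb
    · omega
    · exact ih (by rcases Nat.lt_succ_iff_lt_or_eq.1 hv with h' | rfl
                   · exact h'
                   · exact absurd h hb)

theorem lastBelow_spec (h : lastBelow p b ≠ 0) : lastBelow p b < b ∧ p (lastBelow p b) := by
  induction b with
  | zero => exact absurd rfl h
  | succ b ih =>
    rw [lastBelow] at h ⊢
    split_ifs at h ⊢ with hb
    · exact ⟨by omega, hb⟩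
    · exact ⟨by have := ih h; omega, (ih h).2⟩

theorem lastBelow_eq_zero (h : ∀ v < b, v ≠ 0 → ¬ p v) : lastBelow p b = 0 := by
  by_contra h'
  obtain ⟨h₁, h₂⟩ := lastBelow_spec h'
  exact h _ h₁ h' h₂

end LastBelow

/-! ### Longest suffixes with a property. -/

section LongestSuffix

variable {α : Type*}

open Classical in
/-- The longest suffix with the property `p`, or the empty word. -/
noncomputable def longestSuffix (p : List α → Prop) : List α → List α
  | [] => []
  | c :: g => if p (c :: g) then c :: g else longestSuffix p g

variable {p : List α → Prop} {g h : List α}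

theorem longestSuffix_isSuffix : longestSuffix p g <:+ g := by
  induction g with
  | nil => exact List.suffix_rfl
  | cons c g ih =>
    rw [longestSuffix]
    split_ifs
    · exact List.suffix_rfl
    · exact ih.trans (List.suffix_cons c g)

theorem longestSuffix_spec (h : longestSuffix p g ≠ []) : p (longestSuffix p g) := by
  induction g with
  | nil => exact absurd rfl h
  | cons c g ih =>
    rw [longestSuffix] at h ⊢
    split_ifs at h ⊢ with hc
    · exact hc
    · exact ih h

theorem length_le_longestSuffix (hs : h <:+ g) (hp : p h) :
    h.length ≤ (longestSuffix p g).length := by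
  induction g with
  | nil => simp [List.suffix_nil.1 hs]
  | cons c g ih =>
    rw [longestSuffix]
    split_ifs with hc
    · exact hs.length_le
    · rcases List.suffix_cons_iff.1 hs with rfl | hs'
      · exact absurd hp hc
      · exact ih hs'

theorem longestSuffix_eq (hs : h <:+ g) (hp : h ≠ [] → p h)
    (hmax : ∀ h', h' <:+ g → p h' → h'.length ≤ h.length) : longestSuffix p g = h := by
  have hl : h.length ≤ (longestSuffix p g).length := by
    by_cases h0 : h = []
    · simp [h0]
    · exact length_le_longestSuffix hs (hp h0)
  have hl' : (longestSuffix p g).length ≤ h.length := by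
    by_cases h0 : longestSuffix p g = []
    · simp [h0]
    · exact hmax _ longestSuffix_isSuffix (longestSuffix_spec h0)
  exact (List.suffix_of_suffix_length_le longestSuffix_isSuffix hs hl').eq_of_length (by omega)

/-- The suffixes of the tail are the proper suffixes, except that the empty word is its own tail. -/
theorem isSuffix_tail_iff : h <:+ g.tail ↔ h <:+ g ∧ (h ≠ g ∨ g = []) := by
  cases g with
  | nil => simp
  | cons c g =>
    simp only [List.tail_cons, List.suffix_cons_iff, reduceCtorEq, or_false]
    constructor
    · intro hs
      refine ⟨Or.inr hs, ?_⟩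
      rintro rfl
      have := hs.length_le
      simp at this
    · rintro ⟨rfl | hs, hne⟩
      · exact absurd rfl hne
      · exact hs

end LongestSuffix

/-! ### The trie of the words read in a sequence of positions. -/

variable (a kind : ℕ → ℕ)

/-- The word read from the last blank (a position of kind `0`) up to position `i`. -/
def word : ℕ → List ℕ
  | 0 => []
  | i + 1 => if kind (i + 1) = 0 then [] else word i ++ [a (i + 1)]

/-- The first position at which the word `g` is read, or `0`. -/
noncomputable def node (g : List ℕ) : ℕ := sInf {j | word a kind j = g}

/-- The first position with the same word as position `i`. -/
noncomputable def rep (i : ℕ) : ℕ := node a kind (word a kind i)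

/-- The word is read somewhere. -/
def InTrie (g : List ℕ) : Prop := ∃ j, word a kind j = g

/-- The longest proper suffix that is read somewhere. -/
noncomputable def fail (g : List ℕ) : List ℕ := longestSuffix (InTrie a kind) g.tail

/-- The first positions with their words. -/
def IsRep (i : ℕ) : Prop := i ≠ 0 ∧ rep a kind i = i

/-- The words that are read up to the end of a block of kind `1`. -/
def imageWords : Set (List ℕ) := {g | ∃ i, kind i = 1 ∧ kind (i + 1) = 0 ∧ word a kind i = g}

/-- The words that are read before a position of kind `1`. -/
def imagePrefixes : Set (List ℕ) := {g | ∃ i, kind i = 1 ∧ word a kind (i - 1) = g}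

/-- The words that are read up to a position of kind neither `0` nor `1`. -/
def textPrefixes : Set (List ℕ) := {g | ∃ i, kind i ≠ 0 ∧ kind i ≠ 1 ∧ word a kind i = g}

section Basic

variable {a kind} {g h : List ℕ} {c i j : ℕ}

theorem word_of_kind_eq_zero (h : kind i = 0) : word a kind i = [] := by
  cases i with
  | zero => rfl
  | succ i => simp [word, h]

theorem word_of_kind_ne_zero (h0 : i ≠ 0) (h : kind i ≠ 0) :
    word a kind i = word a kind (i - 1) ++ [a i] := by
  cases i with
  | zero => exact absurd rfl h0
  | succ i => simp [word, h]

theorem length_word_le : (word a kind i).length ≤ i := by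
  induction i with
  | zero => simp [word]
  | succ i ih =>
    rw [word]
    split_ifs
    · simp
    · simpa using ih

theorem ne_zero_of_word_ne_nil (h : word a kind i ≠ []) : i ≠ 0 ∧ kind i ≠ 0 := by
  refine ⟨?_, fun h' => h (word_of_kind_eq_zero h')⟩
  rintro rfl
  exact h rfl

theorem inTrie_word : InTrie a kind (word a kind i) := ⟨i, rfl⟩

theorem inTrie_nil : InTrie a kind [] := ⟨0, rfl⟩

theorem word_node (h : InTrie a kind g) : word a kind (node a kind g) = g :=
  Nat.sInf_mem (s := {j | word a kind j = g}) h

theorem node_le (h : word a kind j = g) : node a kind g ≤ j := Nat.sInf_le h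

theorem node_nil : node a kind [] = 0 := Nat.le_zero.1 (node_le rfl)

theorem node_of_not_inTrie (h : ¬ InTrie a kind g) : node a kind g = 0 := by
  have : {j | word a kind j = g} = ∅ := by
    ext j
    simp only [Set.mem_ofPred_eq, Set.mem_empty_iff_false, iff_false]
    exact fun hj => h ⟨j, hj⟩
  rw [node, this, Nat.sInf_empty]

theorem node_eq_zero_iff (h : InTrie a kind g) : node a kind g = 0 ↔ g = [] := by
  constructor
  · intro h0
    rw [← word_node h, h0, word]
  · rintro rfl
    exact node_nil

theorem node_inj (hg : InTrie a kind g) (hh : InTrie a kind h)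
    (h' : node a kind g = node a kind h) : g = h := by
  rw [← word_node hg, h', word_node hh]

theorem word_rep : word a kind (rep a kind i) = word a kind i := word_node inTrie_word

theorem rep_le : rep a kind i ≤ i := node_le rfl

theorem rep_rep : rep a kind (rep a kind i) = rep a kind i := by rw [rep, word_rep, rep]

theorem rep_zero : rep a kind 0 = 0 := node_nil

theorem rep_node (h : InTrie a kind g) : rep a kind (node a kind g) = node a kind g := by
  rw [rep, word_node h]

theorem rep_of_kind_eq_zero (h : kind i = 0) : rep a kind i = 0 := by
  rw [rep, word_of_kind_eq_zero h, node_nil]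

/-- A first position beyond `z` would be blank and hence carry the empty word, whose first position
is `0`. -/
theorem rep_le_of_kind {z : ℕ} (hz : ∀ i, z < i → kind i = 0) : rep a kind i ≤ z := by
  by_contra h
  have := rep_of_kind_eq_zero (a := a) (i := rep a kind i) (hz _ (by omega))
  rw [rep, word_rep, ← rep] at this
  omega

theorem node_le_of_kind {z : ℕ} (hz : ∀ i, z < i → kind i = 0) : node a kind g ≤ z := by
  by_cases hT : InTrie a kind g
  · obtain ⟨j, rfl⟩ := hT
    exact rep_le_of_kind hz
  · simp [node_of_not_inTrie hT]

theorem isRep_node (h : InTrie a kind g) (hg : g ≠ []) : IsRep a kind (node a kind g) :=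
  ⟨fun h' => hg ((node_eq_zero_iff h).1 h'), rep_node h⟩

theorem IsRep.word_ne_nil (h : IsRep a kind i) : word a kind i ≠ [] := by
  intro h'
  apply h.1
  rw [← h.2, rep, h', node_nil]

theorem IsRep.word_eq (h : IsRep a kind i) :
    word a kind i = word a kind (i - 1) ++ [a i] :=
  have := ne_zero_of_word_ne_nil h.word_ne_nil
  word_of_kind_ne_zero this.1 this.2

/-- The position before the one reading `g ++ [c]` reads `g`; thus the words read are closed under
prefixes. -/
theorem InTrie.of_append (h : InTrie a kind (g ++ [c])) : InTrie a kind g := by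
  obtain ⟨j, hj⟩ := h
  have h0 := ne_zero_of_word_ne_nil (a := a) (kind := kind) (i := j) (by simp [hj])
  refine ⟨j - 1, ?_⟩
  rw [word_of_kind_ne_zero h0.1 h0.2] at hj
  exact (List.append_inj' hj rfl).1

theorem InTrie.of_isPrefix (h : InTrie a kind g) : ∀ {f : List ℕ}, f <+: g → InTrie a kind f := by
  induction g using List.reverseRecOn with
  | nil =>
    intro f hf
    rwa [List.prefix_nil.1 hf]
  | append_singleton g c ih =>
    intro f hf
    rcases List.prefix_concat_iff.1 hf with rfl | hf
    · exact h
    · exact ih h.of_append hf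

/-- The position is the child of `x` along the letter `c` in the trie of first positions. -/
theorem isRep_child_iff {x v : ℕ} (hv : IsRep a kind v) :
    (rep a kind (v - 1) = rep a kind x ∧ a v = c) ↔ v = node a kind (word a kind x ++ [c]) := by
  constructor
  · rintro ⟨h₁, rfl⟩
    have h₂ : word a kind (v - 1) = word a kind x := by
      rw [← word_rep, h₁, word_rep]
    rw [← h₂, ← hv.word_eq]
    exact hv.2.symm
  · intro h
    have hT : InTrie a kind (word a kind x ++ [c]) := by
      by_contra h'
      exact hv.1 (h.trans (node_of_not_inTrie h'))
    have h₁ := word_node hT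
    rw [← h, hv.word_eq] at h₁
    obtain ⟨h₂, h₃⟩ := List.append_inj' h₁ rfl
    exact ⟨by rw [rep, h₂, rep], by simpa using h₃⟩

end Basic

/-! ### Failure words. -/

section Fail

variable {a kind} {f g h : List ℕ} {c : ℕ}

theorem fail_isSuffix_tail : fail a kind g <:+ g.tail := longestSuffix_isSuffix

theorem fail_isSuffix : fail a kind g <:+ g :=
  fail_isSuffix_tail.trans (List.tail_suffix g)

theorem length_fail_lt (hg : g ≠ []) : (fail a kind g).length < g.length := by
  have := (fail_isSuffix_tail (a := a) (kind := kind) (g := g)).length_le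
  have := List.length_pos_iff.2 hg
  simp at *
  omega

theorem inTrie_fail : InTrie a kind (fail a kind g) := by
  by_cases h : fail a kind g = []
  · rw [h]
    exact inTrie_nil
  · exact longestSuffix_spec h

theorem fail_nil : fail a kind [] = [] := rfl

theorem length_le_fail (hs : h <:+ g) (hne : h ≠ g) (hT : InTrie a kind h) :
    h.length ≤ (fail a kind g).length :=
  length_le_longestSuffix (isSuffix_tail_iff.2 ⟨hs, Or.inl hne⟩) hT

theorem isSuffix_fail (hs : h <:+ g) (hne : h ≠ g) (hT : InTrie a kind h) :
    h <:+ fail a kind g :=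
  List.suffix_of_suffix_length_le hs fail_isSuffix (length_le_fail hs hne hT)

/-- The Aho–Corasick step: the nonempty proper suffixes of `g ++ [c]` are the words `h ++ [c]` with
`h` a proper suffix of `g`, so the longest such `h` with a child along `c` gives the failure word.
-/
theorem fail_append_of_inTrie (hs : f <:+ g) (hne : f ≠ g) (hT : InTrie a kind (f ++ [c]))
    (hmax : ∀ h, h <:+ g → h ≠ g → InTrie a kind (h ++ [c]) → h.length ≤ f.length) :
    fail a kind (g ++ [c]) = f ++ [c] := by
  refine longestSuffix_eq (isSuffix_tail_iff.2 ⟨?_, Or.inl ?_⟩) (fun _ => hT) ?_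
  · obtain ⟨t, rfl⟩ := hs
    exact ⟨t, by simp⟩
  · simpa using hne
  · intro h' hh' hT'
    rcases List.eq_nil_or_concat h' with rfl | ⟨h, d, rfl⟩
    · simp
    · rw [isSuffix_tail_iff] at hh'
      obtain ⟨⟨t, ht⟩, hne'⟩ := hh'
      rw [List.concat_eq_append, ← List.append_assoc] at ht
      obtain ⟨h₁, h₂⟩ := List.append_inj' ht rfl
      simp only [List.cons.injEq, and_true] at h₂
      subst h₂
      simp only [List.concat_eq_append, List.length_append, List.length_cons, List.length_nil] at *
      refine Nat.succ_le_succ (hmax h ⟨t, h₁⟩ ?_ hT')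
      rintro rfl
      simp at hne'

theorem fail_append_cases (hg : g ≠ []) : fail a kind (g ++ [c]) = [] ∨
    ∃ h, fail a kind (g ++ [c]) = h ++ [c] ∧ h <:+ g ∧ h ≠ g := by
  have hs := fail_isSuffix_tail (a := a) (kind := kind) (g := g ++ [c])
  rw [isSuffix_tail_iff] at hs
  obtain ⟨⟨t, ht⟩, hne'⟩ := hs
  rcases List.eq_nil_or_concat (fail a kind (g ++ [c])) with h1 | ⟨f, d, h1⟩
  · exact Or.inl h1
  · rw [List.concat_eq_append] at h1
    rw [h1, ← List.append_assoc] at ht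
    obtain ⟨h₁, h₂⟩ := List.append_inj' ht rfl
    simp only [List.cons.injEq, and_true] at h₂
    subst h₂
    refine Or.inr ⟨f, h1, ⟨t, h₁⟩, ?_⟩
    rintro rfl
    simp [h1] at hne'

theorem fail_append_of_forall_not (hg : g ≠ [])
    (h : ∀ h, h <:+ g → h ≠ g → ¬ InTrie a kind (h ++ [c])) :
    fail a kind (g ++ [c]) = [] := by
  rcases fail_append_cases (a := a) (kind := kind) (c := c) hg with h₀ | ⟨f, h₁, h₂, h₃⟩
  · exact h₀
  · exact absurd (h₁ ▸ inTrie_fail) (h f h₂ h₃)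

theorem fail_singleton : fail a kind [c] = [] := rfl

/-- A nonempty failure word of `g ++ [c]`, deprived of its last letter, is a proper suffix of `g` in
the trie when `g` is not empty. This bound drives the amortization in `sum_card_searches_le`. -/
theorem length_fail_append_le (g : List ℕ) (c : ℕ) :
    (fail a kind (g ++ [c])).length ≤ (fail a kind g).length + 1 := by
  by_cases hg : g = []
  · subst hg
    simp [fail_singleton]
  rcases fail_append_cases (a := a) (kind := kind) (c := c) hg with h₀ | ⟨f, h₁, h₂, h₃⟩
  · simp [h₀]
  · have hT : InTrie a kind (f ++ [c]) := h₁ ▸ inTrie_fail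
    simpa [h₁] using length_le_fail h₂ h₃ hT.of_append

/-- The longest suffix of `g`, possibly `g` itself, in `V`. -/
noncomputable def longestIn (V : Set (List ℕ)) (g : List ℕ) : List ℕ := longestSuffix (· ∈ V) g

theorem longestIn_of_mem {V : Set (List ℕ)} (h : g ∈ V) : longestIn V g = g :=
  longestSuffix_eq List.suffix_rfl (fun _ => h) fun _ hs _ => hs.length_le

/-- A proper suffix of `g` that lies in the trie is a suffix of the failure word. Links to longest
image suffixes can therefore be inherited along failure links. -/
theorem longestIn_of_notMem {V : Set (List ℕ)} (hV : ∀ v ∈ V, InTrie a kind v) (h : g ∉ V) :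
    longestIn V g = longestIn V (fail a kind g) := by
  refine longestSuffix_eq (longestSuffix_isSuffix.trans fail_isSuffix) longestSuffix_spec ?_
  intro h' hs hh'
  refine length_le_longestSuffix (isSuffix_fail hs ?_ (hV _ hh')) hh'
  rintro rfl
  exact h hh'

end Fail

end WordTrie

/-! ### Building the trie -/

namespace WordRAM

open WordTrie Program WordRAM.Expr

/-- Look up the child of the node in register `9` along the letter in register `10`; the result, or
`0`, goes to register `11`. Array `8` holds the random masks of the nodes, arrays `9` and `10` the
chains of the hash table and array `11` the parents. -/
def lookup : Program := block
  [assign 12 (bin .xor (cell 8 (reg 9)) (reg 10)),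
   assign 11 (cell 9 (reg 12)),
   -- Comparing truth values by `lt` expresses "not the first, but the second": the walk goes on
   -- while the chain has not ended and the entry has a parent other than the node in register `9`.
   loop (bin .lt (bin .eq (cell 11 (reg 11)) (reg 9)) (bin .lt (lit 0) (reg 11)))
     (assign 11 (cell 10 (reg 11)))]

section Lookup

variable (a kind rnd : ℕ → ℕ)

/-- The hash value of a node. -/
noncomputable def hash (v : ℕ) : ℕ := rnd (rep a kind (v - 1)) ^^^ a v

/-- The hash table holds the nodes below `b`. -/
structure Table (b : ℕ) (m : Mem) : Prop where
  mask : ∀ x < b, m.cell 8 x = rnd x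
  head : ∀ h, m.cell 9 h = lastBelow (fun v => IsRep a kind v ∧ hash a kind rnd v = h) b
  next : ∀ v < b, IsRep a kind v → m.cell 10 v =
    lastBelow (fun u => IsRep a kind u ∧ hash a kind rnd u = hash a kind rnd v) v
  parent : ∀ v < b, IsRep a kind v → m.cell 11 v = rep a kind (v - 1)

open Classical in
/-- The number of positions below `b` that collide with the letter `c` at the node `x`. -/
noncomputable def coll (b x c : ℕ) : ℕ :=
  ((Finset.range b).filter fun v =>
    rep a kind (v - 1) ≠ x ∧ hash a kind rnd v = rnd x ^^^ c).card

variable {a kind rnd} {w : ℕ} {ω : ℕ → BitVec w} {b : ℕ} {m : Mem}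

theorem coll_mono {b b' x c : ℕ} (h : b ≤ b') :
    coll a kind rnd b x c ≤ coll a kind rnd b' x c :=
  Finset.card_le_card (Finset.filter_subset_filter _ (Finset.range_mono h))

theorem coll_lt {b b' v x c : ℕ} (hv : b ≤ v) (hv' : v < b') (h : rep a kind (v - 1) ≠ x)
    (h' : hash a kind rnd v = rnd x ^^^ c) :
    coll a kind rnd b x c < coll a kind rnd b' x c := by
  refine Finset.card_lt_card (Finset.ssubset_iff_of_subset
    (Finset.filter_subset_filter _ (Finset.range_mono (by omega))) |>.2 ⟨v, ?_, ?_⟩)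
  · simp [hv', h, h']
  · simp only [Finset.mem_filter, Finset.mem_range]
    omega

/-- The chain of one hash value is walked by decreasing position up to an entry with parent `x`. Its
letter is then `c`, because the mask of `x` cancels, so the result is exact whatever the masks are.
Every entry passed over has a different parent and is counted by `coll`. -/
theorem Table.runs_lookup (hw : 0 < w) (hm : Table a kind rnd b m) {x c : ℕ} (hb : 0 < b)
    (hx : rep a kind x = x) (hxb : x < b) (h9 : m.reg 9 = x) (h10 : m.reg 10 = c) :
    Runs ω lookup m fun t m' => t ≤ 20 + 12 * coll a kind rnd b x c ∧
      m'.reg 12 = rnd x ^^^ c ∧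
      m'.reg 11 = if node a kind (word a kind x ++ [c]) < b
        then node a kind (word a kind x ++ [c]) else 0 := by
  have hlt : ∀ p, lastBelow p b < b := fun p => by
    by_cases h : lastBelow p b = 0
    · omega
    · exact (lastBelow_spec h).1
  set g := word a kind x ++ [c] with hg
  simp only [lookup, block]
  refine Runs.seq (Runs.of_wp hw ?_)
  simp only [wp, Expr.Safe, Op.Safe, Expr.val, Op.nat, and_self, true_and]
  refine Runs.seq (Runs.of_wp hw ?_)
  simp only [wp, Expr.Safe, Expr.val, true_and]
  simp only [Mem.setReg_reg, Mem.setReg_cell, if_true, h9, h10, hm.mask x hxb, hm.head]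
  have hstart : ∀ u < b, IsRep a kind u → rep a kind (u - 1) = x → a u = c →
      u ≤ lastBelow (fun v => IsRep a kind v ∧ hash a kind rnd v = rnd x ^^^ c) b := by
    intro u hu h₁ h₂ h₃
    exact le_lastBelow hu ⟨h₁, by rw [hash, h₂, h₃]⟩
  -- The sought node, if present, is never above the current entry, and the credit covers every
  -- colliding position up to that entry. A round costs 12 steps: 9 for the test and 3 for the
  -- assignment.
  refine (Runs.loop hw (fun k m' => m'.reg 12 = rnd x ^^^ c ∧
      (m'.reg 11 ≠ 0 → IsRep a kind (m'.reg 11) ∧ hash a kind rnd (m'.reg 11) = rnd x ^^^ c) ∧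
      m'.reg 11 < b ∧
      (∀ u < b, IsRep a kind u → rep a kind (u - 1) = x → a u = c → u ≤ m'.reg 11) ∧
      12 * coll a kind rnd (m'.reg 11 + 1) x c ≤ k)
    (k := 12 * coll a kind rnd b x c) ?_ ?_).frame.mono ?_
  · simp only [Mem.setReg_reg, if_true]
    refine ⟨by simp, fun h => (lastBelow_spec h).2, hlt _, hstart, ?_⟩
    exact Nat.mul_le_mul_left _ (coll_mono (hlt _))
  · rintro k m' hf ⟨h12, hrep, hlt', hmax, hk⟩
    have h9' : m'.reg 9 = x := by
      rw [hf.reg 9 (by simp [Program.regs])]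
      simp [h9]
    have hc10 : m'.cell 10 = m.cell 10 := hf.cell 10 (by simp [Program.arrays])
    have hc11 : m'.cell 11 = m.cell 11 := hf.cell 11 (by simp [Program.arrays])
    have h1W : 0 < 2 ^ w := by positivity
    refine ⟨by simp [Expr.Safe, Op.Safe], fun he => Runs.of_wp hw ?_⟩
    simp only [Expr.val, Op.nat, h9', hc11] at he
    have hv0 : m'.reg 11 ≠ 0 := by
      intro h0
      simp [h0] at he
    obtain ⟨hr, hh⟩ := hrep hv0
    have hpar : rep a kind (m'.reg 11 - 1) ≠ x := by
      intro h0
      rw [hm.parent _ hlt' hr, h0] at he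
      simp [Nat.pos_of_ne_zero hv0] at he
    simp only [wp, Expr.Safe, Expr.val, true_and, hc10, hm.next _ hlt' hr]
    set p := fun u => IsRep a kind u ∧ hash a kind rnd u = hash a kind rnd (m'.reg 11) with hp
    have hnext : lastBelow p (m'.reg 11) < m'.reg 11 := by
      by_cases h : lastBelow p (m'.reg 11) = 0
      · omega
      · exact (lastBelow_spec h).1
    refine ⟨12 * coll a kind rnd (lastBelow p (m'.reg 11) + 1) x c,
      ⟨by simp [h12], ?_, ?_, ?_, ?_⟩, ?_⟩
    · simp only [Mem.setReg_reg, if_true]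
      intro h
      have := (lastBelow_spec h).2
      exact ⟨this.1, this.2.trans hh⟩
    · simp only [Mem.setReg_reg, if_true]
      omega
    · simp only [Mem.setReg_reg, if_true]
      intro u hu h₁ h₂ h₃
      refine le_lastBelow ?_ ⟨h₁, by rw [hh, hash, h₂, h₃]⟩
      refine lt_of_le_of_ne (hmax u hu h₁ h₂ h₃) ?_
      rintro rfl
      exact hpar h₂
    · simp
    · have := coll_lt (b := lastBelow p (m'.reg 11) + 1) (b' := m'.reg 11 + 1) (by omega)
        (by omega) hpar hh
      simp only [Expr.cost]
      omega
  · rintro t m' ⟨⟨k', ⟨h12, hrep, hlt', hmax, hk⟩, he, ht⟩, hf⟩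
    have h9' : m'.reg 9 = x := by
      rw [hf.reg 9 (by simp [Program.regs])]
      simp [h9]
    have hc11 : m'.cell 11 = m.cell 11 := hf.cell 11 (by simp [Program.arrays])
    simp only [Expr.cost] at ht ⊢
    refine ⟨by omega, h12, ?_⟩
    by_cases hv0 : m'.reg 11 = 0
    · rw [hv0]
      split_ifs with hn
      -- The chain has ended at `0`, yet a sought node below `b` would have to be at most `0`, which
      -- no node other than the root is.
      · by_contra h0
        have hT : InTrie a kind g := by
          by_contra h'
          exact h0 (node_of_not_inTrie h').symm
        have hr := isRep_node hT (by simp [hg])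
        obtain ⟨h₁, h₂⟩ := (isRep_child_iff (x := x) (c := c) hr).2 rfl
        have := hmax _ hn hr (by rw [h₁, hx]) h₂
        omega
      · rfl
    · obtain ⟨hr, hh⟩ := hrep hv0
      have hpar : rep a kind (m'.reg 11 - 1) = x := by
        by_contra h0
        simp only [Expr.val, Op.nat, hc11, h9', hm.parent _ hlt' hr, h0] at he
        simp [Nat.pos_of_ne_zero hv0] at he
      have hc : a (m'.reg 11) = c := by
        rw [hash, hpar] at hh
        exact Nat.xor_right_inj.1 hh
      have := (isRep_child_iff (x := x) (c := c) hr).1 ⟨by rw [hpar, hx], hc⟩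
      rw [← hg] at this
      rw [← this, if_pos hlt']
end Lookup

end WordRAM

/-! ### Insertion of nodes and the loop over all positions. -/

namespace WordRAM

open WordTrie Program WordRAM.Expr

/-- Make position `i` (register `8`) a node: its parent is in register `9`, its hash value in
register `12` and its depth in register `13`. Array `7` holds the depths and arrays `24` and `25`
the chains of the nodes of equal depth. -/
def insertNode : Program := block
  [store 11 (reg 8) (reg 9),
   store 10 (reg 8) (cell 9 (reg 12)),
   store 9 (reg 12) (reg 8),
   store 7 (reg 8) (reg 13),
   store 25 (reg 8) (cell 24 (reg 13)),
   store 24 (reg 13) (reg 8),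
   assign 11 (reg 8)]

/-- Process the letter at position `i` (register `8`): arrays `4` and `6` hold the letters and the
nodes. -/
def addLetter : Program := block
  [assign 13 (bin .add (reg 13) (lit 1)),
   assign 9 (cell 6 (bin .sub (reg 8) (lit 1))),
   assign 10 (cell 4 (reg 8)),
   lookup,
   cond (bin .eq (reg 11) (lit 0)) insertNode (block []),
   store 6 (reg 8) (reg 11)]

/-- Build the trie from the letters at the positions up to the value of register `4`; array `5`
holds the kinds of the positions. -/
def buildTrie : Program := block
  [random 14,
   store 8 (lit 0) (reg 14),
   assign 8 (lit 1),
   assign 13 (lit 0),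
   loop (bin .lt (reg 8) (bin .add (reg 4) (lit 1))) (block
     [random 14,
      store 8 (reg 8) (reg 14),
      cond (cell 5 (reg 8)) addLetter (block [assign 13 (lit 0), store 6 (reg 8) (lit 0)]),
      assign 8 (bin .add (reg 8) (lit 1))])]

section Build

variable (a kind rnd : ℕ → ℕ)

/-- The arrays for the trie with the nodes below `b`. -/
structure Trie (b : ℕ) (m : Mem) : Prop extends Table a kind rnd b m where
  rep : ∀ j < b, m.cell 6 j = rep a kind j
  depth : ∀ j < b, IsRep a kind j → m.cell 7 j = (word a kind j).length
  first : ∀ d, m.cell 24 d = lastBelow (fun v => IsRep a kind v ∧ (word a kind v).length = d) b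
  next' : ∀ j < b, IsRep a kind j → m.cell 25 j =
    lastBelow (fun v => IsRep a kind v ∧ (word a kind v).length = (word a kind j).length) j

variable {a kind rnd} {w : ℕ} {ω : ℕ → BitVec w} {b : ℕ} {m m' : Mem}

theorem Table.congr (h : Table a kind rnd b m) (hc : ∀ i ∈ [8, 9, 10, 11], m'.cell i = m.cell i) :
    Table a kind rnd b m' := by
  have h8 := hc 8 (by simp)
  have h9 := hc 9 (by simp)
  have h10 := hc 10 (by simp)
  have h11 := hc 11 (by simp)
  constructor
  · rw [h8]; exact h.mask
  · rw [h9]; exact h.head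
  · rw [h10]; exact h.next
  · rw [h11]; exact h.parent

theorem Trie.congr (h : Trie a kind rnd b m)
    (hc : ∀ i ∈ [6, 7, 8, 9, 10, 11, 24, 25], m'.cell i = m.cell i) :
    Trie a kind rnd b m' := by
  have h6 := hc 6 (by simp)
  have h7 := hc 7 (by simp)
  have h24 := hc 24 (by simp)
  have h25 := hc 25 (by simp)
  refine ⟨h.toTable.congr fun i hi => hc i ?_, ?_, ?_, ?_, ?_⟩
  · simp at hi ⊢
    omega
  · rw [h6]; exact h.rep
  · rw [h7]; exact h.depth
  · rw [h24]; exact h.first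
  · rw [h25]; exact h.next'

theorem Trie.succ_of_not_isRep (h : Trie a kind rnd b m) (hb : ¬ IsRep a kind b)
    (h8b : m.cell 8 b = rnd b)
    (h6 : m'.cell 6 = Function.update (m.cell 6) b (WordTrie.rep a kind b))
    (hc : ∀ i, i ≠ 6 → m'.cell i = m.cell i) :
    Trie a kind rnd (b + 1) m' where
  mask x hx := by
    rw [hc 8 (by decide)]
    rcases Nat.lt_succ_iff_lt_or_eq.1 hx with hx | rfl
    · exact h.mask x hx
    · exact h8b
  head d := by
    rw [hc 9 (by decide), h.head, lastBelow_succ_of_neg fun h' => hb h'.1]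
  next v hv hr := by
    rw [hc 10 (by decide)]
    rcases Nat.lt_succ_iff_lt_or_eq.1 hv with hv | rfl
    · exact h.next v hv hr
    · exact absurd hr hb
  parent v hv hr := by
    rw [hc 11 (by decide)]
    rcases Nat.lt_succ_iff_lt_or_eq.1 hv with hv | rfl
    · exact h.parent v hv hr
    · exact absurd hr hb
  rep x hx := by
    rw [h6]
    rcases Nat.lt_succ_iff_lt_or_eq.1 hx with hx | rfl
    · rw [Function.update_of_ne hx.ne]
      exact h.rep x hx
    · rw [Function.update_self]
  depth v hv hr := by
    rw [hc 7 (by decide)]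
    rcases Nat.lt_succ_iff_lt_or_eq.1 hv with hv | rfl
    · exact h.depth v hv hr
    · exact absurd hr hb
  first d := by
    rw [hc 24 (by decide), h.first, lastBelow_succ_of_neg fun h' => hb h'.1]
  next' v hv hr := by
    rw [hc 25 (by decide)]
    rcases Nat.lt_succ_iff_lt_or_eq.1 hv with hv | rfl
    · exact h.next' v hv hr
    · exact absurd hr hb

theorem Trie.succ_of_isRep (h : Trie a kind rnd b m) (hb : IsRep a kind b)
    (h6 : m'.cell 6 = Function.update (m.cell 6) b b)
    (h7 : m'.cell 7 = Function.update (m.cell 7) b (word a kind b).length)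
    (h8 : m'.cell 8 = m.cell 8) (h8b : m.cell 8 b = rnd b)
    (h9 : m'.cell 9 = Function.update (m.cell 9) (hash a kind rnd b) b)
    (h10 : m'.cell 10 = Function.update (m.cell 10) b (m.cell 9 (hash a kind rnd b)))
    (h11 : m'.cell 11 = Function.update (m.cell 11) b (WordTrie.rep a kind (b - 1)))
    (h24 : m'.cell 24 = Function.update (m.cell 24) (word a kind b).length b)
    (h25 : m'.cell 25 = Function.update (m.cell 25) b (m.cell 24 (word a kind b).length)) :
    Trie a kind rnd (b + 1) m' where
  mask x hx := by
    rw [h8]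
    rcases Nat.lt_succ_iff_lt_or_eq.1 hx with hx | rfl
    · exact h.mask x hx
    · exact h8b
  head d := by
    rw [h9]
    by_cases hd : d = hash a kind rnd b
    · rw [hd, Function.update_self, lastBelow_succ_of_pos ⟨hb, rfl⟩]
    · rw [Function.update_of_ne hd, h.head, lastBelow_succ_of_neg fun h' => hd h'.2.symm]
  next v hv hr := by
    rw [h10]
    rcases Nat.lt_succ_iff_lt_or_eq.1 hv with hv | rfl
    · rw [Function.update_of_ne hv.ne]
      exact h.next v hv hr
    · rw [Function.update_self, h.head]
  parent v hv hr := by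
    rw [h11]
    rcases Nat.lt_succ_iff_lt_or_eq.1 hv with hv | rfl
    · rw [Function.update_of_ne hv.ne]
      exact h.parent v hv hr
    · rw [Function.update_self]
  rep x hx := by
    rw [h6]
    rcases Nat.lt_succ_iff_lt_or_eq.1 hx with hx | rfl
    · rw [Function.update_of_ne hx.ne]
      exact h.rep x hx
    · rw [Function.update_self, hb.2]
  depth v hv hr := by
    rw [h7]
    rcases Nat.lt_succ_iff_lt_or_eq.1 hv with hv | rfl
    · rw [Function.update_of_ne hv.ne]
      exact h.depth v hv hr
    · rw [Function.update_self]
  first d := by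
    rw [h24]
    by_cases hd : d = (word a kind b).length
    · rw [hd, Function.update_self, lastBelow_succ_of_pos ⟨hb, rfl⟩]
    · rw [Function.update_of_ne hd, h.first, lastBelow_succ_of_neg fun h' => hd h'.2.symm]
  next' v hv hr := by
    rw [h25]
    rcases Nat.lt_succ_iff_lt_or_eq.1 hv with hv | rfl
    · rw [Function.update_of_ne hv.ne]
      exact h.next' v hv hr
    · rw [Function.update_self, h.first]

/-- The table holds the nodes below `i`, so the lookup fails exactly when the word at `i` is read
there for the first time, that is, when `i` is a new node. -/
theorem Trie.runs_addLetter (hw : 0 < w) {i : ℕ} (h : Trie a kind rnd i m) (hi : i ≠ 0)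
    (hk : kind i ≠ 0) (hW : i + 1 < 2 ^ w) (r8 : m.reg 8 = i)
    (r13 : m.reg 13 = (word a kind (i - 1)).length)
    (h4 : m.cell 4 i = a i) (h8 : m.cell 8 i = rnd i) :
    Runs ω addLetter m fun t m' =>
      t ≤ 80 + 12 * coll a kind rnd i (WordTrie.rep a kind (i - 1)) (a i) ∧
      Trie a kind rnd (i + 1) m' ∧ m'.reg 13 = (word a kind i).length := by
  have hr13 : (word a kind (i - 1)).length ≤ i - 1 := length_word_le
  have hword := word_of_kind_ne_zero (a := a) hi hk
  have hlen : (word a kind i).length = (word a kind (i - 1)).length + 1 := by simp [hword]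
  simp only [addLetter, block]
  refine Runs.seq (Runs.of_wp hw ?_)
  simp only [wp, Expr.Safe, Op.Safe, Expr.val, Op.nat, true_and]
  refine ⟨⟨by omega, by omega⟩, Runs.seq (Runs.of_wp hw ?_)⟩
  simp only [wp, Expr.Safe, Op.Safe, Expr.val, Op.nat, true_and]
  simp [-Nat.reduceAdd, r8, r13, ← hlen]
  refine ⟨⟨by omega, by omega⟩, Runs.seq (Runs.of_wp hw ?_)⟩
  simp only [wp, Expr.Safe, Expr.val, true_and]
  simp [-Nat.reduceAdd, r8]
  rw [h.rep (i - 1) (by omega), h4]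
  refine Runs.seq ((Table.runs_lookup (x := WordTrie.rep a kind (i - 1)) (c := a i) (b := i)
    (a := a) (kind := kind) (rnd := rnd) hw (h.toTable.congr ?_) (by omega) ?_ ?_ ?_ ?_).frame.mono
    ?_)
  · simp
  · exact rep_rep
  · have := rep_le (a := a) (kind := kind) (i := i - 1)
    omega
  · simp
  · simp
  rintro t m₁ ⟨⟨ht, r12, r11⟩, hf⟩
  rw [word_rep, ← hword, ← WordTrie.rep] at r11
  have r13' := hf.reg 13 (by decide)
  have r8' := hf.reg 8 (by decide)
  have r9' := hf.reg 9 (by decide)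
  have hc : m₁.cell = m.cell := by
    funext j
    exact hf.cell j (by simp [lookup, block, Program.arrays])
  simp [r8] at r13' r8' r9'
  have hhash : rnd (WordTrie.rep a kind (i - 1)) ^^^ a i = hash a kind rnd i := rfl
  have hi0 : WordTrie.rep a kind i ≠ 0 := by
    rw [WordTrie.rep, Ne, node_eq_zero_iff inTrie_word]
    simp [hword]
  have hlt := rep_le (a := a) (kind := kind) (i := i)
  have hWpos : 0 < 2 ^ w := by positivity
  refine Runs.of_wp hw ?_
  simp only [wp, insertNode, block, Expr.Safe, Op.Safe, Expr.val, Op.nat, true_and, hWpos]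
  simp only [r8', r9', Expr.cost]
  refine ⟨fun h0 => ?_, fun h0 => ?_⟩
  · have hrep : IsRep a kind i := by
      refine ⟨hi, ?_⟩
      by_contra hne
      simp [r11, hi0, lt_of_le_of_ne hlt hne] at h0
    refine ⟨by omega, ?_, by simpa using r13'⟩
    refine h.succ_of_isRep hrep ?_ ?_ ?_ h8 ?_ ?_ ?_ ?_ ?_ <;>
      simp [hc, r8', r12, r13', hhash]
  · have hne : WordTrie.rep a kind i ≠ i := by
      intro hge
      simp [r11, hge] at h0
    have hlt' := lt_of_le_of_ne hlt hne
    rw [if_pos hlt'] at r11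
    refine ⟨by omega, ?_, by simpa using r13'⟩
    refine h.succ_of_not_isRep (fun h' => hne h'.2) h8 (by simp [hc, r11, r8']) fun j hj => ?_
    simp [hc, hj]

/-- One random word is drawn for every position, blanks included, so that the mask of position `i`
is simply `ω i`. Collisions become explicit functions of the tape, while the nodes and letters
looked up depend on the input alone. -/
theorem runs_buildTrie (hw : 0 < w) {z : ℕ} (h4 : m.reg 4 = z) (hz : z + 2 < 2 ^ w)
    (ha : ∀ i, 0 < i → i ≤ z → m.cell 4 i = a i) (hk : ∀ i ≤ z, m.cell 5 i = kind i)
    (hd : m.drawn = 0)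
    (h0 : ∀ j ∈ [6, 7, 8, 9, 10, 11, 24, 25], ∀ i, m.cell j i = 0) :
    Runs ω buildTrie m fun t m' =>
      t ≤ 20 + ∑ i ∈ Finset.Ico 1 (z + 1),
        (120 + 12 * coll a kind (fun i => (ω i).toNat) (z + 1)
          (WordTrie.rep a kind (i - 1)) (a i)) ∧
      Trie a kind (fun i => (ω i).toNat) (z + 1) m' := by
  have hWpos : 0 < 2 ^ w := by positivity
  set r : ℕ → ℕ := fun i => (ω i).toNat with hr
  refine Runs.of_wp hw ?_
  simp [buildTrie, hd]
  refine ⟨by omega, (Runs.loop hw (fun k m' => ∃ i, m'.reg 8 = i ∧ 1 ≤ i ∧ i ≤ z + 1 ∧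
      m'.drawn = i ∧ m'.reg 13 = (word a kind (i - 1)).length ∧ Trie a kind r i m' ∧
      k = ∑ i ∈ Finset.Ico i (z + 1),
        (120 + 12 * coll a kind r (z + 1)
          (WordTrie.rep a kind (i - 1)) (a i)))
    (k := ∑ i ∈ Finset.Ico 1 (z + 1),
        (120 + 12 * coll a kind r (z + 1)
          (WordTrie.rep a kind (i - 1)) (a i))) ?_ ?_).frame.mono ?_⟩
  · refine ⟨1, by simp, le_rfl, by omega, by simp [hd], by simp [word], ?_, rfl⟩
    have hl : ∀ p, lastBelow p 1 = 0 := fun p => lastBelow_eq_zero fun v hv hv0 => by omega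
    have hn : ∀ v < 1, ¬ IsRep a kind v := fun v hv h => h.1 (by omega)
    refine ⟨⟨?_, ?_, fun v hv h => absurd h (hn v hv), fun v hv h => absurd h (hn v hv)⟩, ?_,
      fun v hv h => absurd h (hn v hv), ?_, fun v hv h => absurd h (hn v hv)⟩
    · intro x hx
      obtain rfl : x = 0 := by omega
      simp [hr]
    · simp [hl, h0 9]
    · intro x hx
      obtain rfl : x = 0 := by omega
      simp [h0 6, rep_zero]
    · simp [hl, h0 24]
  · rintro k m' hf ⟨i, h8, h1, hiz, hdr, h13, hT, rfl⟩
    have h4' := hf.reg 4 (by decide)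
    have c4 := hf.cell 4 (by decide)
    have c5 := hf.cell 5 (by decide)
    simp [h4] at h4' c4 c5
    simp [h8, h4']
    refine ⟨by omega, fun hi => ?_⟩
    rw [Finset.sum_eq_sum_Ico_succ_bot (by omega)]
    have hc := coll_mono (a := a) (kind := kind) (rnd := r) (x := WordTrie.rep a kind (i - 1))
      (c := a i) hiz
    refine Runs.seq (Runs.of_wp hw ?_)
    simp
    refine Runs.seq (Runs.of_wp hw ?_)
    simp [h8]
    have hT₁ : Trie a kind r i (((m'.draw 14 (ω m'.drawn).toNat).setCell 8 i
        (ω m'.drawn).toNat)) := by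
      obtain ⟨⟨hm, hh, hn, hp⟩, hr', hd', hf', hn'⟩ := hT
      refine ⟨⟨fun x hx => ?_, hh, hn, hp⟩, hr', hd', hf', hn'⟩
      simp [hx.ne, hm x hx]
    refine Runs.seq (Runs.cond hw (by simp) (fun hk0 => ?_) (fun hk0 => Runs.of_wp hw ?_))
    · have hki : kind i ≠ 0 := by simpa [h8, c5, hk i (by omega)] using hk0
      refine ((hT₁.runs_addLetter hw (by omega) hki (by omega) (by simpa using h8)
        (by simpa using h13) ?_ ?_).frame.drawn ?_).mono ?_
      · simp [c4, ha i (by omega) (by omega)]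
      · simp [hr, hdr]
      · simp [addLetter, insertNode, lookup, Program.Deterministic]
      rintro t m₂ ⟨⟨⟨ht, hT₂, h13'⟩, hf₂⟩, hdr₂⟩
      have h8₂ := hf₂.reg 8 (by decide)
      simp [h8] at h8₂
      refine Runs.of_wp hw ?_
      simp [h8₂]
      refine ⟨by omega, ⟨by omega, ?_, ?_, ?_⟩, by omega⟩
      · simpa [hdr] using hdr₂
      · exact h13'
      · exact hT₂.congr (by simp)
    · have hki : kind i = 0 := by simpa [h8, c5, hk i (by omega)] using hk0
      simp [h8]
      refine Runs.of_wp hw ?_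
      simp [h8]
      refine ⟨by omega, ⟨by omega, ?_, ?_, ?_⟩, by omega⟩
      · exact hdr
      · simp [word_of_kind_eq_zero hki]
      · refine hT₁.succ_of_not_isRep ?_ ?_ ?_ ?_
        · intro h
          exact h.word_ne_nil (word_of_kind_eq_zero hki)
        · simp [hr, hdr]
        · simp [rep_of_kind_eq_zero hki]
        · intro j hj
          simp [hj]
  · rintro t m' ⟨⟨k', ⟨i, h8, h1, hiz, hdr, h13, hT, hk'⟩, he, ht⟩, hf⟩
    have h4' := hf.reg 4 (by decide)
    simp [h4] at h4'
    simp [h8, h4'] at he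
    obtain rfl : i = z + 1 := by omega
    refine ⟨?_, hT⟩
    simp at ht
    omega

end Build

end WordRAM

/-! ### Failure links -/

namespace WordRAM

open WordTrie Program WordRAM.Expr

/-- From the node in register `9`, follow the failure links (array `16`) up to a node with a child
along the letter in register `10`; the child, or `0`, goes to register `11`. -/
def failSearch : Program := block
  [lookup,
   -- The search continues while no child has been found and the node is not the root, which is `0`.
   loop (bin .lt (bin .lt (lit 0) (reg 11)) (bin .lt (lit 0) (reg 9)))
     (block [assign 9 (cell 16 (reg 9)), lookup])]

section FailSearch

variable (a kind rnd : ℕ → ℕ)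

/-- The cost of the lookups along the letter `c` at the suffixes of `p` with lengths in
`[lo, hi)`. -/
noncomputable def searchCost (z : ℕ) (p : List ℕ) (c lo hi : ℕ) : ℕ :=
  ∑ l ∈ Finset.Ico lo hi,
    (60 + 12 * coll a kind rnd (z + 1) (node a kind (p.drop (p.length - l))) c)

variable {a kind rnd} {w : ℕ} {ω : ℕ → BitVec w} {z : ℕ} {m : Mem}

/-- The lookup at the suffix `f` is paid from the summand of index `f.length`; the lengths decrease
along failure links, so no summand is used twice. -/
theorem searchCost_add_le {p f : List ℕ} {c lo hi : ℕ} (hf : f <:+ p) (hlo : lo ≤ f.length)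
    (hhi : f.length < hi) :
    searchCost a kind rnd z p c lo f.length +
      (60 + 12 * coll a kind rnd (z + 1) (node a kind f) c) ≤
    searchCost a kind rnd z p c lo hi := by
  have h := Finset.sum_Ico_succ_top hlo fun l =>
    60 + 12 * coll a kind rnd (z + 1) (node a kind (p.drop (p.length - l))) c
  rw [← List.suffix_iff_eq_drop.1 hf] at h
  rw [searchCost, ← h]
  exact Finset.sum_le_sum_of_subset (Finset.Ico_subset_Ico_right hhi)

theorem Table.runs_lookup_node (hw : 0 < w) (hz : ∀ i, z < i → kind i = 0)
    (hm : Table a kind rnd (z + 1) m) {f : List ℕ} {c : ℕ} (hT : InTrie a kind f)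
    (h9 : m.reg 9 = node a kind f) (h10 : m.reg 10 = c) :
    Runs ω lookup m fun t m' => t ≤ 20 + 12 * coll a kind rnd (z + 1) (node a kind f) c ∧
      m'.reg 9 = node a kind f ∧ m'.reg 10 = c ∧ m'.cell = m.cell ∧
      m'.reg 11 = node a kind (f ++ [c]) := by
  refine (hm.runs_lookup hw (by omega) (rep_node hT) ?_ h9 h10).frame.mono ?_
  · have := node_le_of_kind (a := a) (g := f) hz
    omega
  rintro t m' ⟨⟨h₁, -, h₂⟩, hf⟩
  rw [word_node hT, if_pos] at h₂
  · refine ⟨h₁, (hf.reg 9 (by decide)).trans h9, (hf.reg 10 (by decide)).trans h10, ?_, h₂⟩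
    funext j
    exact hf.cell j (by simp [lookup, Program.arrays])
  · have := node_le_of_kind (a := a) (g := f ++ [c]) hz
    omega

/-- Failure links list the proper suffixes of `p` in the trie by decreasing length, so the first one
with a child along `c` is the longest. Only links of words shorter than `p` are followed, which is
what a visit by increasing depth provides. -/
theorem Table.runs_failSearch (hw : 0 < w) (hz : ∀ i, z < i → kind i = 0)
    (hm : Table a kind rnd (z + 1) m) {p : List ℕ} {c : ℕ} (hp : p ≠ [])
    (h9 : m.reg 9 = node a kind (fail a kind p)) (h10 : m.reg 10 = c)
    (h16 : ∀ f, InTrie a kind f → f.length < p.length →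
      m.cell 16 (node a kind f) = node a kind (fail a kind f)) :
    Runs ω failSearch m fun t m' => m'.cell = m.cell ∧
      m'.reg 11 = node a kind (fail a kind (p ++ [c])) ∧
      t ≤ searchCost a kind rnd z p c ((fail a kind (p ++ [c])).length - 1)
        ((fail a kind p).length + 1) := by
  have hWpos : 0 < 2 ^ w := by positivity
  -- If the failure word is `h ++ [c]`, the search ends at `h`, of length `g.length - 1`. If it is
  -- empty, the search ends at the root, and the truncated difference is `0` too.
  set g := fail a kind (p ++ [c]) with hg
  have hgle : g.length - 1 ≤ (fail a kind p).length := by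
    rw [hg]
    exact Nat.sub_le_of_le_add (length_fail_append_le p c)
  simp only [failSearch, block]
  refine Runs.seq ((hm.runs_lookup_node hw hz inTrie_fail h9 h10).mono ?_)
  rintro t₁ m₁ ⟨ht₁, r9, r10, hc, r11⟩
  refine (Runs.loop hw (fun k m' => ∃ f, InTrie a kind f ∧ f <:+ p ∧ f ≠ p ∧
      m'.cell = m.cell ∧ m'.reg 9 = node a kind f ∧ m'.reg 10 = c ∧
      m'.reg 11 = node a kind (f ++ [c]) ∧
      (∀ h, h <:+ p → h ≠ p → InTrie a kind (h ++ [c]) → h.length ≤ f.length) ∧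
      g.length - 1 ≤ f.length ∧
      k = searchCost a kind rnd z p c (g.length - 1) f.length)
    (k := searchCost a kind rnd z p c (g.length - 1) (fail a kind p).length) ?_ ?_).mono ?_
  · refine ⟨_, inTrie_fail, fail_isSuffix, ?_, hc, r9, r10, r11, ?_, hgle, rfl⟩
    · intro h
      have := length_fail_lt (a := a) (kind := kind) hp
      rw [h] at this
      omega
    · intro h hs hne hT
      exact length_le_fail hs hne hT.of_append
  · rintro k m' - ⟨f, hT, hs, hne, hc', r9', r10', r11', hmax, hlo, rfl⟩
    refine ⟨by simp, fun he => ?_⟩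
    simp [r9', r11'] at he
    have hlt : f.length < p.length := lt_of_le_of_ne hs.length_le fun h => hne (hs.eq_of_length h)
    have hf0 : f ≠ [] := by
      rintro rfl
      simp [node_nil] at he
    have hnT : ¬ InTrie a kind (f ++ [c]) := by
      intro h
      have : node a kind (f ++ [c]) ≠ 0 := by simp [node_eq_zero_iff h]
      simp [Nat.pos_of_ne_zero this] at he
      split_ifs at he <;> omega
    have hmax' : ∀ h, h <:+ p → h ≠ p → InTrie a kind (h ++ [c]) →
        h.length ≤ (fail a kind f).length := by
      intro h hs' hne' hT'
      have hsf := List.suffix_of_suffix_length_le hs' hs (hmax h hs' hne' hT')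
      refine length_le_fail hsf ?_ hT'.of_append
      rintro rfl
      exact hnT hT'
    have hlo' : g.length - 1 ≤ (fail a kind f).length := by
      rcases fail_append_cases (a := a) (kind := kind) (c := c) hp with h₀ | ⟨h, h₁, h₂, h₃⟩
      · simp [hg, h₀]
      · have hT' : InTrie a kind (h ++ [c]) := h₁ ▸ inTrie_fail
        have := hmax' h h₂ h₃ hT'
        simp [hg, h₁]
        omega
    refine Runs.seq (Runs.of_wp hw ?_)
    simp only [wp, Expr.Safe, Expr.val, true_and]
    have hc16 : m'.cell 16 (m'.reg 9) = node a kind (fail a kind f) := by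
      rw [hc', r9', h16 f hT hlt]
    rw [hc16]
    have hm' : Table a kind rnd (z + 1) (m'.setReg 9 (node a kind (fail a kind f))) :=
      hm.congr (by simp [hc'])
    refine (hm'.runs_lookup_node hw hz (f := fail a kind f) (c := c) inTrie_fail (by simp)
      (by simpa using r10')).mono ?_
    rintro t₂ m₂ ⟨ht₂, r9₂, r10₂, hc₂, r11₂⟩
    have hlf := length_fail_lt (a := a) (kind := kind) hf0
    have hcost := searchCost_add_le (a := a) (kind := kind) (rnd := rnd) (z := z) (c := c)
      (fail_isSuffix.trans hs) hlo' hlf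
    refine ⟨_, ⟨fail a kind f, inTrie_fail, fail_isSuffix.trans hs, ?_, ?_, r9₂, r10₂, r11₂,
      hmax', hlo', rfl⟩, ?_⟩
    · intro h
      rw [h] at hlf
      omega
    · simpa [hc'] using hc₂
    · simp only [Expr.cost]
      omega
  · rintro t m' ⟨k', ⟨f, hT, hs, hne, hc', r9', r10', r11', hmax, hlo, rfl⟩, he, ht⟩
    have hcost := searchCost_add_le (a := a) (kind := kind) (rnd := rnd) (z := z) (c := c)
      fail_isSuffix hgle (Nat.lt_succ_self _)
    simp at ht
    refine ⟨hc', ?_, by simp only [Nat.succ_eq_add_one] at hcost; omega⟩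
    rw [r11']
    by_cases hT' : InTrie a kind (f ++ [c])
    · rw [hg, fail_append_of_inTrie hs hne hT' hmax]
    · have hf0 : f = [] := by
        by_contra hf0
        have h1 : node a kind f ≠ 0 := by rwa [Ne, node_eq_zero_iff hT]
        simp [r9', r11', node_of_not_inTrie hT', Nat.pos_of_ne_zero h1] at he
      rw [node_of_not_inTrie hT', hg, fail_append_of_forall_not hp, node_nil]
      intro h hs' hne' hT''
      have := hmax h hs' hne' hT''
      rw [hf0] at this hT'
      obtain rfl : h = [] := List.eq_nil_of_length_eq_zero (by simpa using this)
      exact hT' hT''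

end FailSearch

end WordRAM

/-! ### Links and flags of all nodes, by increasing depth. -/

namespace WordRAM

open WordTrie Program WordRAM.Expr

/-- Compute the links and flags of the node in register `15`. Arrays `16` and `17` hold the failure
links and the longest suffixes that are images; arrays `18`, `19` and `20` tell whether the text,
whose node is in register `22`, is a suffix, a factor and a prefix; array `12` marks the images. -/
def visit : Program := block
  [assign 16 (cell 11 (reg 15)),
   assign 11 (lit 0),
   cond (reg 16)
     (block [assign 9 (cell 16 (reg 16)), assign 10 (cell 4 (reg 15)), failSearch])
     (block []),
   store 16 (reg 15) (reg 11),
   store 17 (reg 15) (cell 17 (reg 11)),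
   cond (cell 12 (reg 15)) (store 17 (reg 15) (reg 15)) (block []),
   store 18 (reg 15) (cell 18 (reg 11)),
   store 20 (reg 15) (cell 20 (reg 16)),
   cond (bin .eq (reg 15) (reg 22))
     (block [store 18 (reg 15) (lit 1), store 20 (reg 15) (lit 1)]) (block []),
   store 19 (reg 15) (cell 19 (reg 16)),
   cond (cell 18 (reg 15)) (store 19 (reg 15) (lit 1)) (block [])]

section Visit

variable (a kind rnd : ℕ → ℕ)

/-- The links and flags of the node of `g` have been computed. -/
structure Visited (T : List ℕ) (m : Mem) (g : List ℕ) : Prop where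
  fail : m.cell 16 (node a kind g) = node a kind (fail a kind g)
  image : m.cell 17 (node a kind g) = node a kind (longestIn (imageWords a kind) g)
  isSuffix : m.cell 18 (node a kind g) ≠ 0 ↔ T <:+ g
  isFactor : m.cell 19 (node a kind g) ≠ 0 ↔ T <:+: g
  isPrefix : m.cell 20 (node a kind g) ≠ 0 ↔ T <+: g

/-- The cost of visiting position `i`. -/
noncomputable def visitCost (z i : ℕ) : ℕ :=
  searchCost a kind rnd z (word a kind (i - 1)) (a i) ((fail a kind (word a kind i)).length - 1)
    ((fail a kind (word a kind (i - 1))).length + 1)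

variable {a kind rnd} {w : ℕ} {ω : ℕ → BitVec w} {z : ℕ} {m : Mem}

theorem mem_imageWords_inTrie {v : List ℕ} (h : v ∈ imageWords a kind) : InTrie a kind v := by
  obtain ⟨i, -, -, h⟩ := h
  exact ⟨i, h⟩

theorem isSuffix_iff_fail {T g : List ℕ} (hT : InTrie a kind T) :
    T <:+ g ↔ g = T ∨ T <:+ fail a kind g := by
  constructor
  · intro h
    by_cases hne : T = g
    · exact Or.inl hne.symm
    · exact Or.inr (isSuffix_fail h hne hT)
  · rintro (rfl | h)
    · exact List.suffix_rfl
    · exact h.trans fail_isSuffix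

/-- The parent `p` and the failure word of `g` are shorter than `g`, hence already done. For `g ≠
T`, the text is a suffix of `g` iff it is one of the failure word, and a prefix of `g` iff it is one
of `p`. It is a factor of `g` iff it is a suffix of `g` or a factor of `p`. -/
theorem Trie.runs_visit (hw : 0 < w) (hz : ∀ i, z < i → kind i = 0)
    (hm : Trie a kind rnd (z + 1) m) {T : List ℕ} (hT : InTrie a kind T)
    {v : ℕ} (hv : IsRep a kind v) (h15 : m.reg 15 = v) (h22 : m.reg 22 = node a kind T)
    (h4 : ∀ i, 0 < i → i ≤ z → m.cell 4 i = a i)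
    (h12 : ∀ g, InTrie a kind g → (m.cell 12 (node a kind g) ≠ 0 ↔ g ∈ imageWords a kind))
    (hvis : ∀ g, InTrie a kind g → g.length < (word a kind v).length → Visited a kind T m g) :
    Runs ω visit m fun t m' => t ≤ 100 + visitCost a kind rnd z v ∧
      Visited a kind T m' (word a kind v) ∧ ∀ j i, i ≠ v → m'.cell j i = m.cell j i := by
  classical
  have hWpos : 1 < 2 ^ w := Nat.one_lt_two_pow hw.ne'
  have hvz : v ≤ z := hv.2 ▸ rep_le_of_kind hz
  have hword := hv.word_eq
  set p := word a kind (v - 1) with hp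
  set g := word a kind v with hg
  have hnode : node a kind g = v := hv.2
  have hgT : InTrie a kind g := inTrie_word
  have hfl : (WordTrie.fail a kind g).length < g.length := length_fail_lt (by simp [hword])
  simp only [visit, block]
  refine Runs.seq (Runs.of_wp hw ?_)
  simp [h15]
  refine Runs.seq (Runs.of_wp hw ?_)
  simp
  rw [hm.parent v (by omega) hv, WordTrie.rep, ← hp]
  -- the failure link
  refine Runs.seq (Runs.mono (Runs.frame (Q := fun t m' => t ≤ 20 + visitCost a kind rnd z v ∧
    m'.cell = m.cell ∧ m'.reg 11 = node a kind (WordTrie.fail a kind g)) ?_) ?_)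
  · refine Runs.cond hw (by simp) (fun h => ?_) fun h => Runs.of_wp hw ?_
    · have hp0 : p ≠ [] := by
        intro h0
        simp [h0, node_nil] at h
      refine Runs.seq (Runs.of_wp hw ?_)
      simp
      refine Runs.seq (Runs.of_wp hw ?_)
      simp [h15]
      rw [(hvis p inTrie_word (by simp [hword])).fail, h4 v (Nat.pos_of_ne_zero hv.1) hvz]
      refine (Table.runs_failSearch (p := p) (c := a v) (a := a) (kind := kind) (rnd := rnd) hw hz
        (hm.toTable.congr ?_) hp0 ?_ ?_ ?_).mono ?_
      · simp
      · simp
      · simp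
      · intro f hf hlt
        simpa using (hvis f hf (by simp [hword]; omega)).fail
      rintro t m' ⟨h₁, h₂, h₃⟩
      simp at h₁
      refine ⟨?_, h₁, by rw [h₂, ← hword]⟩
      rw [visitCost, ← hp, ← hg, hword]
      omega
    · have hp0 : p = [] := (node_eq_zero_iff inTrie_word).1 (by simpa using h)
      simp
      rw [hword, hp0, List.nil_append, fail_singleton, node_nil]
      exact ⟨by omega, rfl⟩
  rintro t m₁ ⟨⟨ht, hc, h11⟩, hf⟩
  have r15 := hf.reg 15 (by decide)
  have r16 := hf.reg 16 (by decide)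
  have r22 := hf.reg 22 (by decide)
  simp [h15, h22] at r15 r16 r22
  refine Runs.of_wp hw ?_
  have vf := hvis _ (inTrie_fail (a := a) (kind := kind) (g := g)) hfl
  have vp := hvis p inTrie_word (by simp [hword])
  have hout := h12 g hgT
  have hTg : v = node a kind T ↔ g = T := by
    rw [← hnode]
    exact ⟨fun h => node_inj hgT hT h, fun h => by rw [h]⟩
  have hsuf := isSuffix_iff_fail (g := g) hT
  have hpre : T <+: g ↔ g = T ∨ T <+: p := by
    rw [hword, List.prefix_concat_iff]
    exact or_congr_left eq_comm
  have hfac : T <:+: g ↔ T <:+ g ∨ T <:+: p := by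
    rw [hword, List.infix_concat_iff]
  have him : longestIn (imageWords a kind) g = if g ∈ imageWords a kind then g else
      longestIn (imageWords a kind) (WordTrie.fail a kind g) := by
    split_ifs with h
    · exact longestIn_of_mem h
    · exact longestIn_of_notMem (fun v hv => mem_imageWords_inTrie hv) h
  rw [hnode] at hout
  simp [r15, r16, r22, h11, hc, hw.ne']
  have c17 := vf.image
  have c18 := vf.isSuffix
  have c19 := vp.isFactor
  have c20 := vp.isPrefix
  have key : ∀ m' : Mem, m'.cell 16 v = node a kind (WordTrie.fail a kind g) →
      m'.cell 17 v = (if m.cell 12 v ≠ 0 then v else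
        m.cell 17 (node a kind (WordTrie.fail a kind g))) →
      (m'.cell 18 v ≠ 0 ↔ v = node a kind T ∨
        m.cell 18 (node a kind (WordTrie.fail a kind g)) ≠ 0) →
      (m'.cell 19 v ≠ 0 ↔ m'.cell 18 v ≠ 0 ∨ m.cell 19 (node a kind p) ≠ 0) →
      (m'.cell 20 v ≠ 0 ↔ v = node a kind T ∨ m.cell 20 (node a kind p) ≠ 0) →
      Visited a kind T m' g := by
    intro m' h16 h17 h18 h19 h20
    refine ⟨by rw [hnode, h16], ?_, ?_, ?_, ?_⟩
    · rw [hnode, h17, him, c17]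
      simp only [hout]
      split_ifs
      · exact hnode.symm
      · rfl
    · rw [hnode, h18, hTg, c18, hsuf]
    · rw [hnode, h19, h18, hTg, c18, c19, hfac, hsuf]
    · rw [hnode, h20, hTg, c20, hpre]
  -- Where `v` is the node of `T`, the suffix flag has just been set, so the last test is decided;
  -- six of the eight branches remain.
  refine ⟨fun h1 => ⟨fun h2 => ?_, fun h2 => ⟨fun h3 => ?_, fun h3 => ?_⟩⟩,
    fun h1 => ⟨fun h2 => ?_, fun h2 => ⟨fun h3 => ?_, fun h3 => ?_⟩⟩⟩
  all_goals
    refine ⟨by omega, key _ ?_ ?_ ?_ ?_ ?_, fun j i hi => ?_⟩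
    · simp [hc]
    · simp [hc, h1]
    · first | simp [hc, h2, h3] | simp [hc, h2]
    · first | simp [hc, h3] | simp [hc]
    · simp [hc, h2]
    · split_ifs <;> (try subst j) <;> simp [hi]

theorem Visited.congr {T g : List ℕ} {m' : Mem} (h : Visited a kind T m g)
    (hc : ∀ j ∈ [16, 17, 18, 19, 20], m'.cell j (node a kind g) = m.cell j (node a kind g)) :
    Visited a kind T m' g := by
  simp only [List.forall_mem_cons] at hc
  obtain ⟨h16, h17, h18, h19, h20, -⟩ := hc
  constructor
  · rw [h16]; exact h.fail
  · rw [h17]; exact h.image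
  · rw [h18]; exact h.isSuffix
  · rw [h19]; exact h.isFactor
  · rw [h20]; exact h.isPrefix

/-- The initial zeros are already right at the root: its links lead to the root, and a nonempty text
is no factor of the empty word. -/
theorem visited_nil {T : List ℕ} (hT0 : T ≠ []) (h0 : ∀ j ∈ [16, 17, 18, 19, 20], m.cell j 0 = 0) :
    Visited a kind T m [] := by
  simp only [List.forall_mem_cons] at h0
  obtain ⟨h16, h17, h18, h19, h20, -⟩ := h0
  constructor <;> simp [node_nil, *, fail_nil, longestIn, longestSuffix]

end Visit

/-- Visit all nodes by increasing depth. -/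
def visitAll : Program := block
  [assign 22 (cell 6 (reg 4)),
   assign 13 (lit 1),
   assign 15 (cell 24 (reg 13)),
   loop (reg 15) (block
     [visit,
      assign 15 (cell 25 (reg 15)),
      cond (reg 15) (block [])
        (block [assign 13 (bin .add (reg 13) (lit 1)), assign 15 (cell 24 (reg 13))])])]

section VisitAll

variable {a kind rnd : ℕ → ℕ} {w : ℕ} {ω : ℕ → BitVec w} {z : ℕ} {m : Mem}

open Classical in
/-- The positions still to be visited when those of depth `d` above `v` are done. -/
noncomputable def unvisited (a kind : ℕ → ℕ) (z d v : ℕ) : Finset ℕ :=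
  (Finset.range (z + 1)).filter fun u => IsRep a kind u ∧
    (d < (word a kind u).length ∨ (word a kind u).length = d ∧ u ≤ v)

/-- Moving on, within the depth or to a greater one, removes `v` from the unvisited nodes and adds
none, so the visit of `v` is paid once. -/
theorem sum_unvisited_add_le {d v d' v' : ℕ} (f : ℕ → ℕ) (hv : v ≤ z) (hr : IsRep a kind v)
    (hd : (word a kind v).length = d) (h : d < d' ∨ d = d' ∧ v' < v) :
    ∑ u ∈ unvisited a kind z d' v', f u + f v ≤ ∑ u ∈ unvisited a kind z d v, f u := by
  classical
  have hn : v ∉ unvisited a kind z d' v' := by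
    simp only [unvisited, Finset.mem_filter]
    omega
  rw [add_comm, ← Finset.sum_insert hn]
  refine Finset.sum_le_sum_of_subset fun u hu => ?_
  rw [Finset.mem_insert] at hu
  simp only [unvisited, Finset.mem_filter, Finset.mem_range] at hu ⊢
  rcases hu with rfl | hu
  · exact ⟨by omega, hr, by omega⟩
  · exact ⟨hu.1, hu.2.1, by omega⟩

/-- The loop stops at the first depth without nodes. The trie is closed under prefixes, so there are
no deeper nodes. The cost is bounded by a sum over all positions, not only over nodes, because the
amortization of the failure links works along the letters of each single word. -/
theorem Trie.runs_visitAll (hw : 0 < w) (hz : ∀ i, z < i → kind i = 0) (hzW : z + 2 < 2 ^ w)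
    (hm : Trie a kind rnd (z + 1) m) {T : List ℕ} (hT0 : T ≠ []) (hzT : word a kind z = T)
    (h4 : ∀ i, 0 < i → i ≤ z → m.cell 4 i = a i) (hr4 : m.reg 4 = z)
    (h12 : ∀ g, InTrie a kind g → (m.cell 12 (node a kind g) ≠ 0 ↔ g ∈ imageWords a kind))
    (h0 : ∀ j ∈ [16, 17, 18, 19, 20], m.cell j 0 = 0) :
    Runs ω visitAll m fun t m' => t ≤ 20 + ∑ i ∈ Finset.Ico 1 (z + 1),
      (120 + visitCost a kind rnd z i) ∧ m'.reg 22 = node a kind T ∧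
      ∀ g, InTrie a kind g → Visited a kind T m' g := by
  have hT : InTrie a kind T := ⟨z, hzT⟩
  have hWpos : 1 < 2 ^ w := Nat.one_lt_two_pow hw.ne'
  have hnode : m.cell 6 z = node a kind T := by rw [hm.rep z (by omega), WordTrie.rep, hzT]
  set f : ℕ → ℕ := fun i => 120 + visitCost a kind rnd z i with hf
  let first (d : ℕ) := lastBelow (fun v => IsRep a kind v ∧ (word a kind v).length = d) (z + 1)
  have hfirst : ∀ d, first d ≠ 0 → first d ≤ z ∧ IsRep a kind (first d) ∧
      (word a kind (first d)).length = d := by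
    intro d hd
    have := lastBelow_spec hd
    exact ⟨Nat.lt_succ_iff.1 this.1, this.2⟩
  have hfirst' : ∀ d g, InTrie a kind g → g.length = d → g ≠ [] → node a kind g ≤ first d := by
    intro d g hg hd hg0
    have := node_le_of_kind (a := a) (g := g) hz
    exact le_lastBelow (by omega) ⟨isRep_node hg hg0, by rw [word_node hg, hd]⟩
  refine Runs.of_wp hw ?_
  simp [visitAll, hw.ne', hr4, hnode, hm.first]
  refine (Runs.loop hw (fun k m' => ∃ d v, m'.reg 13 = d ∧ m'.reg 15 = v ∧ 1 ≤ d ∧ d ≤ z + 1 ∧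
      (v ≠ 0 → v ≤ z ∧ IsRep a kind v ∧ (word a kind v).length = d) ∧
      (v = 0 → first d = 0) ∧
      (∀ g, InTrie a kind g → (g.length < d ∨ g.length = d ∧ v < node a kind g) →
        Visited a kind T m' g) ∧
      k = ∑ u ∈ unvisited a kind z d v, f u)
    (k := ∑ u ∈ unvisited a kind z 1 (first 1), f u) ?_ ?_).frame.mono ?_
  · refine ⟨1, first 1, by simp, by simp [first], le_rfl, by omega, hfirst 1, id, ?_, rfl⟩
    rintro g hg (h | ⟨h, h'⟩)
    · obtain rfl : g = [] := List.eq_nil_of_length_eq_zero (by omega)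
      exact visited_nil hT0 (by simpa using h0)
    · have := hfirst' 1 g hg h (by rintro rfl; simp at h)
      omega
  · rintro k m' hfr ⟨d, v, h13, h15, hd1, hdz, hv, hv0, hvis, rfl⟩
    refine ⟨trivial, fun hne => ?_⟩
    simp only [Expr.val, h15] at hne
    obtain ⟨hvz, hvr, hvd⟩ := hv hne
    have hc : ∀ j ∉ [16, 17, 18, 19, 20], m'.cell j = m.cell j := by
      intro j hj
      have := hfr.cell j (by
        simp at hj
        simp [Program.arrays, visit, failSearch, lookup]
        tauto)
      simpa using this
    have h22 := hfr.reg 22 (by decide)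
    simp at h22
    have hm' : Trie a kind rnd (z + 1) m' := hm.congr fun j hj => hc j (by
      simp at hj ⊢; omega)
    refine Runs.seq ((hm'.runs_visit (T := T) (v := v) hw hz hT hvr h15 h22 ?_ ?_ ?_).frame.mono
      ?_)
    · rwa [hc 4 (by decide)]
    · rwa [hc 12 (by decide)]
    · intro g hg hlt
      exact hvis g hg (by omega)
    rintro t m₁ ⟨⟨ht, hvv, hother⟩, hf₁⟩
    have r15 := hf₁.reg 15 (by decide)
    have r13 := hf₁.reg 13 (by decide)
    rw [h15] at r15
    rw [h13] at r13
    have c24 := hf₁.cell 24 (by decide)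
    have c25 := hf₁.cell 25 (by decide)
    have hvis₁ : ∀ g, InTrie a kind g → (g.length < d ∨ g.length = d ∧ v ≤ node a kind g) →
        Visited a kind T m₁ g := by
      intro g hg h
      by_cases hgv : node a kind g = v
      · have : g = word a kind v := by rw [← hgv, word_node hg]
        rwa [this]
      · exact (hvis g hg (by omega)).congr fun j _ => hother j _ hgv
    set next := lastBelow (fun u => IsRep a kind u ∧ (word a kind u).length =
      (word a kind v).length) v with hnext
    have hnext1 : next ≠ 0 → next < v ∧ IsRep a kind next ∧ (word a kind next).length = d := by
      intro h
      have := lastBelow_spec h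
      exact ⟨this.1, this.2.1, this.2.2.trans hvd⟩
    have hnext2 : ∀ g, InTrie a kind g → g.length = d → next < node a kind g →
        v ≤ node a kind g := by
      intro g hg hgd h
      by_contra hlt
      have := le_lastBelow (p := fun u => IsRep a kind u ∧ (word a kind u).length =
        (word a kind v).length) (b := v) (v := node a kind g) (by omega)
        ⟨isRep_node hg (by rintro rfl; simp at hgd; omega), by rw [word_node hg, hgd, hvd]⟩
      omega
    have hlen := length_word_le (a := a) (kind := kind) (i := v)
    refine Runs.of_wp hw ?_
    simp only [wp, Expr.Safe, Expr.val, Op.Safe, true_and, Mem.setReg_reg, if_true, r15, c25,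
      hm'.next' v (by omega) hvr, ← hnext, Expr.cost, Mem.setReg_cell, c24, r13]
    refine ⟨fun hn0 => ⟨by omega, _, ⟨d, next, ?_, ?_, hd1, hdz, ?_, ?_, ?_, rfl⟩, ?_⟩,
      fun hn0 => ⟨by simp; omega, _, ⟨d + 1, first (d + 1), ?_, ?_, by omega, by omega,
        hfirst (d + 1), id, ?_, rfl⟩, ?_⟩⟩
    · simp
    · simp
    · intro h
      have := hnext1 h
      exact ⟨by omega, this.2⟩
    · intro h
      exact absurd h hn0
    · intro g hg h
      refine (hvis₁ g hg ?_).congr (by simp)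
      rcases h with h | ⟨h, h'⟩
      · exact Or.inl h
      · exact Or.inr ⟨h, hnext2 g hg h h'⟩
    · have := sum_unvisited_add_le (d' := d) (v' := next) f hvz hvr hvd
        (Or.inr ⟨rfl, (hnext1 hn0).1⟩)
      simp only [hf] at this ⊢
      omega
    · simp
    · simp [hm'.first, first]
    · intro g hg h
      refine (hvis₁ g hg ?_).congr (by simp)
      rcases h with h | ⟨h, h'⟩
      · by_cases hgd : g.length = d
        · refine Or.inr ⟨hgd, hnext2 g hg hgd ?_⟩
          rw [hn0, Nat.pos_iff_ne_zero, Ne, node_eq_zero_iff hg]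
          rintro rfl
          simp at hgd
          omega
        · exact Or.inl (by omega)
      · have := hfirst' (d + 1) g hg h (by rintro rfl; simp at h)
        omega
    · have := sum_unvisited_add_le (d' := d + 1) (v' := first (d + 1)) f hvz hvr hvd
        (Or.inl (by omega))
      simp only [hf] at this ⊢
      omega
  · rintro t m' ⟨⟨k', ⟨d, v, h13, h15, hd1, hdz, hv, hv0, hvis, rfl⟩, he, ht⟩, hfr⟩
    have h22 := hfr.reg 22 (by decide)
    simp at h22
    simp only [Expr.val, h15] at he
    refine ⟨?_, h22, ?_⟩
    · have : ∑ u ∈ unvisited a kind z 1 (first 1), f u ≤ ∑ i ∈ Finset.Ico 1 (z + 1), f i := by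
        refine Finset.sum_le_sum_of_subset fun u hu => ?_
        simp only [unvisited, Finset.mem_filter, Finset.mem_range] at hu
        have := hu.2.1.1
        simp only [Finset.mem_Ico]
        omega
      simp at ht
      have h : 3 + (2 + (3 + t)) ≤ 20 + ∑ i ∈ Finset.Ico 1 (z + 1), f i := by omega
      exact h
    · intro g hg
      refine hvis g hg (Or.inl ?_)
      by_contra hlt
      have hp : InTrie a kind (g.take d) := hg.of_isPrefix (List.take_prefix _ _)
      have hl : (g.take d).length = d := by simp; omega
      have hne : g.take d ≠ [] := by
        intro h
        rw [h] at hl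
        simp at hl
        omega
      have h1 := hfirst' d _ hp hl hne
      rw [hv0 he, Nat.le_zero, node_eq_zero_iff hp] at h1
      exact hne h1

end VisitAll

end WordRAM

/-! ### Marking image words and prefixes -/

namespace WordRAM

open WordTrie Program WordRAM.Expr

/-- Mark the nodes of the images (array `12`), of their proper prefixes (array `13`) and of the
nonempty prefixes of the text (array `14`). -/
def markNodes : Program := block
  [assign 8 (lit 1),
   loop (bin .lt (reg 8) (bin .add (reg 4) (lit 1))) (block
     [cond (bin .eq (cell 5 (reg 8)) (lit 1))
        (block
          [store 13 (cell 6 (bin .sub (reg 8) (lit 1))) (lit 1),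
           cond (cell 5 (bin .add (reg 8) (lit 1))) (block []) (store 12 (cell 6 (reg 8)) (lit 1))])
        (cond (cell 5 (reg 8)) (store 14 (cell 6 (reg 8)) (lit 1)) (block [])),
      assign 8 (bin .add (reg 8) (lit 1))])]

/-- The cells that are not `0` are those marked for some number below `b`. -/
def Marks (p : ℕ → ℕ → Prop) (b : ℕ) (c : ℕ → ℕ) : Prop := ∀ x, c x ≠ 0 ↔ ∃ i < b, p i x

section Marks

variable {p : ℕ → ℕ → Prop} {b : ℕ} {c : ℕ → ℕ}

theorem Marks.succ_of_iff (h : Marks p b c) {x₀ : ℕ} (hx : ∀ x, p b x ↔ x = x₀) :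
    Marks p (b + 1) (Function.update c x₀ 1) := by
  intro x
  rw [Function.update_apply]
  constructor
  · intro h'
    split_ifs at h' with hxx
    · exact ⟨b, by omega, (hx x).2 hxx⟩
    · obtain ⟨i, hi, hp⟩ := (h x).1 h'
      exact ⟨i, by omega, hp⟩
  · rintro ⟨i, hi, hp⟩
    split_ifs with hxx
    · simp
    · rcases Nat.lt_succ_iff_lt_or_eq.1 hi with hi | rfl
      · exact (h x).2 ⟨i, hi, hp⟩
      · exact absurd ((hx x).1 hp) hxx

theorem Marks.succ_of_not (h : Marks p b c) (hx : ∀ x, ¬ p b x) : Marks p (b + 1) c := by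
  intro x
  rw [h x]
  constructor
  · rintro ⟨i, hi, hp⟩
    exact ⟨i, by omega, hp⟩
  · rintro ⟨i, hi, hp⟩
    rcases Nat.lt_succ_iff_lt_or_eq.1 hi with hi | rfl
    · exact ⟨i, hi, hp⟩
    · exact absurd hp (hx x)

end Marks

section MarkNodes

variable {a kind rnd : ℕ → ℕ} {w : ℕ} {ω : ℕ → BitVec w} {z : ℕ} {m : Mem}

/-- An image ends where a position of kind `1` is followed by a blank; hence the kinds are needed up
to position `z + 1`. -/
theorem runs_markNodes (hw : 0 < w) (hz : ∀ i, z < i → kind i = 0) (hk0 : kind 0 = 0)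
    (hzW : z + 2 < 2 ^ w) (hr4 : m.reg 4 = z) (h5 : ∀ i ≤ z + 1, m.cell 5 i = kind i)
    (h6 : ∀ i ≤ z, m.cell 6 i = rep a kind i) (h0 : ∀ j ∈ [12, 13, 14], ∀ i, m.cell j i = 0) :
    Runs ω markNodes m fun t m' => t ≤ 20 + 60 * z ∧
      ∀ g, InTrie a kind g →
        (m'.cell 12 (node a kind g) ≠ 0 ↔ g ∈ imageWords a kind) ∧
        (m'.cell 13 (node a kind g) ≠ 0 ↔ g ∈ imagePrefixes a kind) ∧
        (m'.cell 14 (node a kind g) ≠ 0 ↔ g ∈ textPrefixes a kind) := by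
  simp only [List.forall_mem_cons] at h0
  obtain ⟨h12, h13, h14, -⟩ := h0
  let p12 : ℕ → ℕ → Prop := fun i x => kind i = 1 ∧ kind (i + 1) = 0 ∧ rep a kind i = x
  let p13 : ℕ → ℕ → Prop := fun i x => kind i = 1 ∧ rep a kind (i - 1) = x
  let p14 : ℕ → ℕ → Prop := fun i x => kind i ≠ 0 ∧ kind i ≠ 1 ∧ rep a kind i = x
  refine Runs.of_wp hw ?_
  simp [markNodes, hw.ne']
  refine (Runs.loop hw (fun k m' => ∃ i, m'.reg 8 = i ∧ 1 ≤ i ∧ i ≤ z + 1 ∧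
      Marks p12 i (m'.cell 12) ∧ Marks p13 i (m'.cell 13) ∧ Marks p14 i (m'.cell 14) ∧
      k = 60 * (z + 1 - i)) (k := 60 * z) ?_ ?_).frame.mono ?_
  · refine ⟨1, by simp, le_rfl, by omega, ?_, ?_, ?_, by omega⟩
    · intro x
      simp [h12, p12, hk0]
    · intro x
      simp [h13, p13, hk0]
    · intro x
      simp [h14, p14, hk0]
  · rintro k m' hf ⟨i, h8, h1, hiz, hm12, hm13, hm14, rfl⟩
    have h4' := hf.reg 4 (by decide)
    have c5 := hf.cell 5 (by decide)
    have c6 := hf.cell 6 (by decide)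
    simp [hr4] at h4' c5 c6
    simp [h8, h4']
    refine ⟨by omega, fun hi => Runs.of_wp hw ?_⟩
    simp [h8, c5, c6, h5 i hiz, h5 (i + 1) (by omega), h6 i (by omega), h6 (i - 1) (by omega),
      hw.ne']
    have hs : i + 1 < 2 ^ w := by omega
    refine ⟨fun hk => ⟨h1, hs, fun hk' => ⟨hs, ⟨by omega, ?_, ?_, ?_⟩, by omega⟩,
      fun hk' => ⟨hs, ⟨by omega, ?_, ?_, ?_⟩, by omega⟩⟩, fun hk =>
        ⟨fun hk' => ⟨hs, ⟨by omega, ?_, ?_, ?_⟩, by omega⟩,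
         fun hk' => ⟨hs, ⟨by omega, ?_, ?_, ?_⟩, by omega⟩⟩⟩
    · exact hm12.succ_of_not fun x h => hk' h.2.1
    · exact hm13.succ_of_iff fun x => by simp [p13, hk, eq_comm]
    · exact hm14.succ_of_not fun x h => h.2.1 hk
    · exact hm12.succ_of_iff fun x => by simp [p12, hk, hk', eq_comm]
    · exact hm13.succ_of_iff fun x => by simp [p13, hk, eq_comm]
    · exact hm14.succ_of_not fun x h => h.2.1 hk
    · exact hm12.succ_of_not fun x h => hk h.1
    · exact hm13.succ_of_not fun x h => hk h.1
    · exact hm14.succ_of_iff fun x => by simp [p14, hk, hk', eq_comm]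
    · exact hm12.succ_of_not fun x h => hk h.1
    · exact hm13.succ_of_not fun x h => hk h.1
    · exact hm14.succ_of_not fun x h => h.1 hk'
  · rintro t m' ⟨⟨k', ⟨i, h8, h1, hiz, hm12, hm13, hm14, rfl⟩, he, ht⟩, hf⟩
    have h4' := hf.reg 4 (by decide)
    simp [hr4] at h4'
    simp [h8, h4'] at he
    obtain rfl : i = z + 1 := by omega
    simp at ht
    refine ⟨by omega, fun g hg => ⟨?_, ?_, ?_⟩⟩
    · refine (hm12 _).trans ?_
      constructor
      · rintro ⟨i, -, h, h', h''⟩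
        exact ⟨i, h, h', node_inj inTrie_word hg h''⟩
      · rintro ⟨i, h, h', rfl⟩
        exact ⟨i, by by_contra hlt; simp [hz i (by omega)] at h, h, h', rfl⟩
    · refine (hm13 _).trans ?_
      constructor
      · rintro ⟨i, -, h, h'⟩
        exact ⟨i, h, node_inj inTrie_word hg h'⟩
      · rintro ⟨i, h, rfl⟩
        exact ⟨i, by by_contra hlt; simp [hz i (by omega)] at h, h, rfl⟩
    · refine (hm14 _).trans ?_
      constructor
      · rintro ⟨i, -, h, h', h''⟩
        exact ⟨i, h, h', node_inj inTrie_word hg h''⟩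
      · rintro ⟨i, h, h', rfl⟩
        exact ⟨i, by by_contra hlt; simp [hz i (by omega)] at h, h, h', rfl⟩

end MarkNodes

end WordRAM

/-! ### Proper suffixes of images and inner factors -/

namespace WordRAM

open WordTrie Program WordRAM.Expr

/-- Mark, in array `21`, the lengths of the prefixes of the text on the chain of failure links that
starts in register `18`. -/
def markSuffixes : Program := loop (reg 18) (block
  [cond (cell 14 (reg 18)) (store 21 (cell 7 (reg 18)) (lit 1)) (block []),
   assign 18 (cell 16 (reg 18))])

/-- Examine all images: register `17` tells whether the text is a proper factor of one of them, but
neither a prefix nor a suffix; array `21` marks the lengths of the nonempty prefixes of the text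
that are proper suffixes of images. -/
def examineImages : Program := block
  [assign 8 (lit 1),
   loop (bin .lt (reg 8) (bin .add (reg 4) (lit 1))) (block
     [cond (bin .eq (cell 5 (reg 8)) (lit 1))
        (cond (cell 5 (bin .add (reg 8) (lit 1))) (block []) (block
          [assign 15 (cell 6 (reg 8)),
           cond (cell 20 (reg 15)) (block [])
             (cond (cell 18 (reg 15)) (block [])
               (cond (cell 19 (reg 15)) (assign 17 (lit 1)) (block []))),
           assign 18 (cell 16 (reg 15)),
           markSuffixes]))
        (block []),
      assign 8 (bin .add (reg 8) (lit 1))])]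

section ExamineImages

variable {a kind rnd : ℕ → ℕ} {w : ℕ} {ω : ℕ → BitVec w} {z : ℕ} {m : Mem}

/-- What array `21` is to mark for the image `v`. -/
def SuffixMark (a kind : ℕ → ℕ) (v : List ℕ) (l : ℕ) : Prop :=
  ∃ f ∈ textPrefixes a kind, f ≠ [] ∧ f <:+ v ∧ f ≠ v ∧ f.length = l

/-- The word `T` is a factor of `v`, but neither a prefix nor a suffix. -/
def IsInner (T v : List ℕ) : Prop := T <:+: v ∧ ¬ T <+: v ∧ ¬ T <:+ v

theorem inTrie_of_mem_textPrefixes {g : List ℕ} (h : g ∈ textPrefixes a kind) :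
    InTrie a kind g := by
  obtain ⟨i, -, -, h⟩ := h
  exact ⟨i, h⟩

/-- The proper suffixes of `v` in the trie are exactly the words on its failure chain. Their lengths
decrease strictly, so there are fewer than `v.length` rounds. -/
theorem runs_markSuffixes (hw : 0 < w) {v : List ℕ} (hv : v ≠ [])
    (h18 : m.reg 18 = node a kind (fail a kind v))
    (h7 : ∀ g, InTrie a kind g → g ≠ [] → m.cell 7 (node a kind g) = g.length)
    (h14 : ∀ g, InTrie a kind g → (m.cell 14 (node a kind g) ≠ 0 ↔ g ∈ textPrefixes a kind))
    (h16 : ∀ g, InTrie a kind g → m.cell 16 (node a kind g) = node a kind (fail a kind g)) :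
    Runs ω markSuffixes m fun t m' => t ≤ 20 * v.length ∧
      ∀ l, m'.cell 21 l ≠ 0 ↔ m.cell 21 l ≠ 0 ∨ SuffixMark a kind v l := by
  have hlt := length_fail_lt (a := a) (kind := kind) hv
  refine (Runs.loop hw (fun k m' => ∃ f, InTrie a kind f ∧ f <:+ v ∧ m'.reg 18 = node a kind f ∧
      (∀ l, m'.cell 21 l ≠ 0 ↔ m.cell 21 l ≠ 0 ∨ ∃ h ∈ textPrefixes a kind, h ≠ [] ∧ h <:+ v ∧
        h ≠ v ∧ f.length < h.length ∧ h.length = l) ∧ f ≠ v ∧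
      k = 20 * f.length) (k := 20 * (fail a kind v).length) ?_ ?_).mono ?_
  · refine ⟨_, inTrie_fail, fail_isSuffix, h18, fun l => ?_, fun h => by rw [h] at hlt; omega, rfl⟩
    rw [iff_self_or]
    rintro ⟨h, hT, h0, hs, hne, hl, -⟩
    have := length_le_fail hs hne (inTrie_of_mem_textPrefixes hT)
    omega
  · rintro k m' hf ⟨f, hT, hs, h18', hm, hfv, rfl⟩
    refine ⟨trivial, fun he => Runs.of_wp hw ?_⟩
    simp only [Expr.val, h18', ne_eq, node_eq_zero_iff hT] at he
    have c7 := hf.cell 7 (by decide)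
    have c14 := hf.cell 14 (by decide)
    have c16 := hf.cell 16 (by decide)
    have hlf := length_fail_lt (a := a) (kind := kind) he
    -- Between `fail a kind f` and `f` there is no suffix of `v` in the trie, so one step of the
    -- chain adds at most the word `f`.
    have hstep : ∀ l, (∃ h ∈ textPrefixes a kind, h ≠ [] ∧ h <:+ v ∧ h ≠ v ∧
        (fail a kind f).length < h.length ∧ h.length = l) ↔
        (f ∈ textPrefixes a kind ∧ f.length = l) ∨
        ∃ h ∈ textPrefixes a kind, h ≠ [] ∧ h <:+ v ∧ h ≠ v ∧
          f.length < h.length ∧ h.length = l := by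
      intro l
      constructor
      · rintro ⟨h, h1, h2, h3, h4, h5, h6⟩
        rcases lt_trichotomy h.length f.length with hl | hl | hl
        · have hsf := List.suffix_of_suffix_length_le h3 hs hl.le
          have := length_le_fail hsf (by rintro rfl; omega) (inTrie_of_mem_textPrefixes h1)
          omega
        · have hsf := (List.suffix_of_suffix_length_le h3 hs hl.le).eq_of_length hl
          exact Or.inl ⟨hsf ▸ h1, hsf ▸ h6⟩
        · exact Or.inr ⟨h, h1, h2, h3, h4, hl, h6⟩
      · rintro (⟨h1, h2⟩ | ⟨h, h1, h2, h3, h4, h5, h6⟩)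
        · exact ⟨f, h1, he, hs, hfv, hlf, h2⟩
        · exact ⟨h, h1, h2, h3, h4, by omega, h6⟩
    have hne : fail a kind f ≠ v := by
      intro h
      have := hs.length_le
      rw [h] at hlf
      omega
    simp only [wp, Expr.Safe, Expr.val, block, h18', c14, c7, c16, true_and, h14 f hT,
      Mem.setCell_reg, Mem.setCell_cell, Mem.setReg_cell, Mem.setReg_reg, Expr.cost,
      h7 f hT he]
    refine ⟨fun hfT => ⟨Nat.one_lt_two_pow hw.ne', _, ⟨fail a kind f, inTrie_fail,
      fail_isSuffix.trans hs, ?_, fun l => ?_, hne, rfl⟩, ?_⟩,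
      fun hfT => ⟨by positivity, _, ⟨fail a kind f, inTrie_fail,
      fail_isSuffix.trans hs, ?_, fun l => ?_, hne, rfl⟩, ?_⟩⟩
    · simp [h16 f hT]
    · rw [hstep]
      by_cases hl : l = f.length
      · simp [hl, hfT]
      · have := hm l
        simp [Ne.symm hl, Function.update_of_ne hl]
        simpa using this
    · omega
    · simp [h16 f hT]
    · have hfT' : f ∉ textPrefixes a kind := fun h => (h14 f hT).2 h hfT
      rw [hstep, hm]
      simp [hfT']
    · omega
  · rintro t m' ⟨k', ⟨f, hT, hs, h18', hm, hfv, rfl⟩, he, ht⟩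
    simp only [Expr.val, h18', node_eq_zero_iff hT] at he
    subst he
    simp at ht
    refine ⟨by omega, fun l => ?_⟩
    rw [hm, SuffixMark]
    refine or_congr_right (exists_congr fun h => and_congr_right fun _ => and_congr_right fun h0 =>
      and_congr_right fun _ => and_congr_right fun _ => ?_)
    simp [List.length_pos_iff.2 h0]

theorem runs_examineImages (hw : 0 < w) (hz : ∀ i, z < i → kind i = 0) (hk0 : kind 0 = 0)
    (hzW : z + 2 < 2 ^ w) (hr4 : m.reg 4 = z) (h5 : ∀ i ≤ z + 1, m.cell 5 i = kind i)
    (h6 : ∀ i ≤ z, m.cell 6 i = rep a kind i) {T : List ℕ}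
    (h7 : ∀ g, InTrie a kind g → g ≠ [] → m.cell 7 (node a kind g) = g.length)
    (h14 : ∀ g, InTrie a kind g → (m.cell 14 (node a kind g) ≠ 0 ↔ g ∈ textPrefixes a kind))
    (hvis : ∀ g, InTrie a kind g → Visited a kind T m g)
    (h17 : m.reg 17 = 0) (h21 : ∀ l, m.cell 21 l = 0) :
    Runs ω examineImages m fun t m' => t ≤ 20 + 200 * z ∧
      (m'.reg 17 ≠ 0 ↔ ∃ v ∈ imageWords a kind, IsInner T v) ∧
      ∀ l, m'.cell 21 l ≠ 0 ↔ ∃ v ∈ imageWords a kind, SuffixMark a kind v l := by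
  have hWpos : 1 < 2 ^ w := Nat.one_lt_two_pow hw.ne'
  let E (i : ℕ) : Prop := kind i = 1 ∧ kind (i + 1) = 0
  refine Runs.of_wp hw ?_
  simp [examineImages, hw.ne']
  -- The failure chain of an image costs up to 20 steps per letter. They are saved while the letters
  -- are passed: the second term of the credit is the amount saved in the current block, and it is
  -- spent where the image ends.
  refine (Runs.loop hw (fun k m' => ∃ i, m'.reg 8 = i ∧ 1 ≤ i ∧ i ≤ z + 1 ∧
      (m'.reg 17 ≠ 0 ↔ ∃ j < i, E j ∧ IsInner T (word a kind j)) ∧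
      (∀ l, m'.cell 21 l ≠ 0 ↔ ∃ j < i, E j ∧ SuffixMark a kind (word a kind j) l) ∧
      k = 150 * (z + 1 - i) + if kind i = 0 then 0 else 20 * (word a kind (i - 1)).length)
    (k := 150 * z) ?_ ?_).frame.mono ?_
  · refine ⟨1, by simp, le_rfl, by omega, ?_, fun l => ?_, ?_⟩
    · simp [h17, E, hk0]
    · simp [h21, E, hk0]
    · simp [word]
  · rintro k m' hf ⟨i, h8, h1, hiz, hm17, hm21, rfl⟩
    have h4' := hf.reg 4 (by decide)
    have c5 := hf.cell 5 (by decide)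
    have c6 := hf.cell 6 (by decide)
    have c7 := hf.cell 7 (by decide)
    have c14 := hf.cell 14 (by decide)
    have c16 := hf.cell 16 (by decide)
    have c18 := hf.cell 18 (by decide)
    have c19 := hf.cell 19 (by decide)
    have c20 := hf.cell 20 (by decide)
    simp only [Mem.setReg_reg, Mem.setReg_cell, hr4] at h4' c5 c6 c7 c14 c16 c18 c19 c20
    simp at h4'
    have hcell : m'.cell 5 i = kind i := by rw [c5, h5 i hiz]
    have hcell' : i ≤ z → m'.cell 5 (i + 1) = kind (i + 1) := fun h => by
      rw [c5, h5 (i + 1) (by omega)]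
    have hlast : ∀ p : ℕ → Prop, (∃ j < i + 1, p j) ↔ (∃ j < i, p j) ∨ p i := fun p => by
      constructor
      · rintro ⟨j, hj, hp⟩
        rcases Nat.lt_succ_iff_lt_or_eq.1 hj with hj | rfl
        · exact Or.inl ⟨j, hj, hp⟩
        · exact Or.inr hp
      · rintro (⟨j, hj, hp⟩ | hp)
        · exact ⟨j, by omega, hp⟩
        · exact ⟨i, by omega, hp⟩
    -- the credit for a position that does not end an image
    have hcredit : i ≤ z → (150 * (z + 1 - (i + 1)) +
        if kind (i + 1) = 0 then 0 else 20 * (word a kind i).length) + 100 ≤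
        150 * (z + 1 - i) + if kind i = 0 then 0 else 20 * (word a kind (i - 1)).length := by
      intro hi
      by_cases hk : kind i = 0
      · simp only [word_of_kind_eq_zero hk, List.length_nil, mul_zero, ite_self]
        omega
      · have : (word a kind i).length = (word a kind (i - 1)).length + 1 := by
          simp [word_of_kind_ne_zero (a := a) (by omega : i ≠ 0) hk]
        rw [if_neg hk, this]
        split_ifs <;> omega
    refine ⟨by simp [h4']; omega, fun he => ?_⟩
    have hi : i ≤ z := by
      simp [h8, h4'] at he
      omega
    -- a position that does not end an image
    have hskip : ∀ m'' : Mem, m''.reg 8 = i → m''.cell 21 = m'.cell 21 → m''.reg 17 = m'.reg 17 →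
        ¬ E i → Runs ω (assign 8 (bin .add (reg 8) (lit 1))) m'' fun t m₁ => t = 4 ∧
        ∃ k', (∃ i, m₁.reg 8 = i ∧ 1 ≤ i ∧ i ≤ z + 1 ∧
          (m₁.reg 17 ≠ 0 ↔ ∃ j < i, E j ∧ IsInner T (word a kind j)) ∧
          (∀ l, m₁.cell 21 l ≠ 0 ↔ ∃ j < i, E j ∧ SuffixMark a kind (word a kind j) l) ∧
          k' = 150 * (z + 1 - i) + if kind i = 0 then 0 else 20 * (word a kind (i - 1)).length) ∧
          k' + 100 ≤ 150 * (z + 1 - i) +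
            if kind i = 0 then 0 else 20 * (word a kind (i - 1)).length := by
      intro m'' h8'' h21'' h17'' hE
      refine Runs.of_wp hw ?_
      simp only [wp, Expr.Safe, Op.Safe, Expr.val, Op.nat, true_and, h8'', Expr.cost]
      refine ⟨⟨by omega, by omega⟩, _, ⟨i + 1, by simp, by omega, by omega, ?_, fun l => ?_, rfl⟩,
        hcredit hi⟩
      · simp only [Mem.setReg_reg, h17'', hlast, hE, false_and, or_false]
        simpa using hm17
      · simp only [Mem.setReg_cell, h21'', hlast, hE, false_and, or_false]
        exact hm21 l
    refine Runs.seq (Runs.cond hw (by simp; omega) (fun hk => ?_) (fun hk => ?_))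
    · have hk1 : kind i = 1 := by
        simpa [h8, hcell] using hk
      refine Runs.cond hw (by simp [h8]; omega) (fun hk' => ?_) (fun hk' => ?_)
      · have hk2 : kind (i + 1) ≠ 0 := by simpa [h8, hcell' hi] using hk'
        refine Runs.of_wp hw ?_
        simp only [wp, Expr.Safe]
        refine ⟨by omega,
          (hskip _ (by simpa using h8) (by simp) (by simp) fun h => hk2 h.2).mono ?_⟩
        rintro t m₁ ⟨rfl, k', h, hle⟩
        refine ⟨k', h, ?_⟩
        simp
        omega
      · have hk2 : kind (i + 1) = 0 := by simpa [h8, hcell' hi] using hk'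
        have hE : E i := ⟨hk1, hk2⟩
        have hw0 : word a kind i ≠ [] := by
          rw [word_of_kind_ne_zero (by omega) (by omega)]
          simp
        have hmem : word a kind i ∈ imageWords a kind := ⟨i, hk1, hk2, rfl⟩
        have hvi := hvis (word a kind i) inTrie_word
        have hfail := hvi.fail
        have hsuf := hvi.isSuffix
        have hfac := hvi.isFactor
        have hpre := hvi.isPrefix
        refine Runs.seq (Runs.of_wp hw ?_)
        have hrep : WordTrie.rep a kind i = node a kind (word a kind i) := rfl
        simp only [wp, Expr.Safe, Expr.val, h8, c6, h6 i hi, true_and]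
        refine Runs.seq (Runs.mono (Runs.frame (Q := fun t m₁ => t ≤ 20 ∧
          (m₁.reg 17 ≠ 0 ↔ m'.reg 17 ≠ 0 ∨ IsInner T (word a kind i))) ?_) ?_)
        · refine Runs.of_wp hw ?_
          simp [c18, c19, c20, IsInner, hrep, hw.ne']
          refine ⟨fun h => ?_, fun h => ⟨fun h' => ?_, fun h' => ⟨fun h'' => ?_, fun h'' => ?_⟩⟩⟩
          · exact fun _ h' => absurd (hpre.1 h) h'
          · exact fun _ _ h₀ => absurd (hsuf.1 h') h₀
          · exact Or.inr ⟨hfac.1 h'', fun h₀ => hpre.2 h₀ h, fun h₀ => hsuf.2 h₀ h'⟩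
          · exact fun h₀ => absurd h'' (hfac.2 h₀)
        rintro t₁ m₁ ⟨⟨ht₁, r17⟩, hf₁⟩
        have r15₁ := hf₁.reg 15 (by decide)
        have r8₁ := hf₁.reg 8 (by decide)
        have cc : m₁.cell = m'.cell := by
          funext j
          exact hf₁.cell j (by simp [Program.arrays])
        simp [h8] at r15₁ r8₁
        refine Runs.seq (Runs.of_wp hw ?_)
        simp only [wp, Expr.Safe, Expr.val, r15₁, cc, c16, hrep, hfail, true_and]
        refine (runs_markSuffixes (a := a) (kind := kind) hw hw0 ?_ ?_ ?_ ?_).frame.mono ?_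
        · simp
        · simpa [cc, c7] using h7
        · simpa [cc, c14] using h14
        · intro g hg
          simpa [cc, c16] using (hvis g hg).fail
        rintro t₂ m₂ ⟨⟨ht₂, h21₂⟩, hf₂⟩
        have r8₂ := hf₂.reg 8 (by decide)
        have r17₂ := hf₂.reg 17 (by decide)
        simp [r8₁] at r8₂ r17₂
        refine Runs.of_wp hw ?_
        simp only [wp, Expr.Safe, Op.Safe, Expr.val, Op.nat, true_and, r8₂, Expr.cost]
        refine ⟨⟨by omega, by omega⟩, _, ⟨i + 1, by simp, by omega, by omega, ?_, fun l => ?_, rfl⟩,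
          ?_⟩
        · rw [hlast, ← hm17]
          simp only [Mem.setReg_reg, hE, true_and]
          simpa [r17₂] using r17
        · rw [hlast, ← hm21]
          simp only [Mem.setReg_cell, hE, true_and]
          simpa [cc] using h21₂ l
        · have : (word a kind i).length = (word a kind (i - 1)).length + 1 := by
            simp [word_of_kind_ne_zero (a := a) (by omega : i ≠ 0) (by omega : kind i ≠ 0)]
          rw [if_pos hk2, if_neg (by omega)]
          omega
    · have hk1 : kind i ≠ 1 := by
        simpa [h8, hcell] using hk
      refine Runs.of_wp hw ?_
      simp only [wp, Expr.Safe]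
      refine ⟨by omega, (hskip _ (by simpa using h8) (by simp) (by simp) fun h => hk1 h.1).mono ?_⟩
      rintro t m₁ ⟨rfl, k', h, hle⟩
      refine ⟨k', h, ?_⟩
      simp
      omega
  · rintro t m' ⟨⟨k', ⟨i, h8, h1, hiz, hm17, hm21, rfl⟩, he, ht⟩, hf⟩
    have h4' := hf.reg 4 (by decide)
    simp [hr4] at h4'
    simp [h8, h4'] at he
    obtain rfl : i = z + 1 := by omega
    have hall : ∀ p : List ℕ → Prop, (∃ j < z + 1, E j ∧ p (word a kind j)) ↔
        ∃ v ∈ imageWords a kind, p v := by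
      intro p
      constructor
      · rintro ⟨j, -, hE, hp⟩
        exact ⟨_, ⟨j, hE.1, hE.2, rfl⟩, hp⟩
      · rintro ⟨v, ⟨j, hk, hk', rfl⟩, hp⟩
        exact ⟨j, by by_contra hlt; simp [hz j (by omega)] at hk, ⟨hk, hk'⟩, hp⟩
    simp at ht
    exact ⟨by omega, hm17.trans (hall _), fun l => (hm21 l).trans (hall (SuffixMark a kind · l))⟩

end ExamineImages

end WordRAM

/-! ### Factorizations of the prefixes of the text -/

namespace WordRAM

open WordTrie Program WordRAM.Expr

/-- The words obtained from a word with the property `B` by appending words of `V`. -/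
inductive Extends (V : Set (List ℕ)) (B : List ℕ → Prop) : List ℕ → Prop
  | base {g : List ℕ} : B g → Extends V B g
  | append {g v : List ℕ} : Extends V B g → v ∈ V → Extends V B (g ++ v)

/-- The recurrence of the dynamic programme: the last word of `V`, if there is one, is split off. -/
theorem extends_iff {V : Set (List ℕ)} {B : List ℕ → Prop} {g : List ℕ} :
    Extends V B g ↔ B g ∨ ∃ v ∈ V, v <:+ g ∧ Extends V B (g.take (g.length - v.length)) := by
  constructor
  · intro h
    cases h with
    | base h => exact Or.inl h
    | append h hv => exact Or.inr ⟨_, hv, List.suffix_append _ _, by simpa using h⟩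
  · rintro (h | ⟨v, hv, ⟨t, rfl⟩, h⟩)
    · exact .base h
    · exact .append (by simpa using h) hv

/-- Follow the chain of the images that are suffixes of the prefix of length `j` (register `19`) of
the text. -/
def extendFactorizations : Program := loop (reg 18) (block
  [assign 20 (bin .sub (reg 19) (cell 7 (reg 18))),
   cond (cell 22 (reg 20)) (store 22 (reg 19) (lit 1)) (block []),
   cond (cell 23 (reg 20)) (store 23 (reg 19) (lit 1)) (block []),
   assign 18 (cell 17 (cell 16 (reg 18)))])

/-- Compute which prefixes of the text are products of images (array `22`), or products of images
after a nonempty proper suffix of an image (array `23`). Register `7` holds the position before the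
text. -/
def factorizePrefixes : Program := block
  [store 22 (lit 0) (lit 1),
   assign 19 (lit 1),
   assign 24 (bin .sub (reg 4) (reg 7)),
   loop (bin .lt (reg 19) (bin .add (reg 24) (lit 1))) (block
     [cond (cell 21 (reg 19)) (store 23 (reg 19) (lit 1)) (block []),
      assign 18 (cell 17 (cell 6 (bin .add (reg 7) (reg 19)))),
      extendFactorizations,
      assign 19 (bin .add (reg 19) (lit 1))])]

section Factorize

variable {a kind rnd : ℕ → ℕ} {w : ℕ} {ω : ℕ → BitVec w} {z : ℕ} {m : Mem}

open Classical in
/-- The number of suffixes of `g` in `V` of length at most `l`. -/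
noncomputable def suffixCountUpTo (V : Set (List ℕ)) (g : List ℕ) (l : ℕ) : ℕ :=
  ((Finset.range (l + 1)).filter fun l => g.drop (g.length - l) ∈ V).card

/-- The number of suffixes of `g` in `V`. -/
noncomputable def suffixCount (V : Set (List ℕ)) (g : List ℕ) : ℕ := suffixCountUpTo V g g.length

theorem suffixCountUpTo_lt {V : Set (List ℕ)} {g v : List ℕ} {l : ℕ} (hs : v <:+ g) (hv : v ∈ V)
    (hl : l < v.length) : suffixCountUpTo V g l < suffixCountUpTo V g v.length := by
  classical
  refine Finset.card_lt_card (Finset.ssubset_iff_of_subset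
    (Finset.filter_subset_filter _ (Finset.range_mono (by omega))) |>.2 ⟨v.length, ?_, ?_⟩)
  · simp only [Finset.mem_filter, Finset.mem_range]
    rw [← List.suffix_iff_eq_drop.1 hs]
    exact ⟨by omega, hv⟩
  · simp only [Finset.mem_filter, Finset.mem_range]
    omega

theorem suffixCountUpTo_le {V : Set (List ℕ)} {g : List ℕ} {l : ℕ} (hl : l ≤ g.length) :
    suffixCountUpTo V g l ≤ suffixCount V g := by
  classical
  exact Finset.card_le_card (Finset.filter_subset_filter _ (Finset.range_mono (by omega)))

/-- After the image suffix `f` of `g`, the next shorter one is the longest image suffix of the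
failure word of `f`. The chain thus visits exactly the images ending at this position, one round for
each. -/
theorem runs_extendFactorizations (hw : 0 < w) {V : Set (List ℕ)} (hV : V = imageWords a kind)
    (hV0 : [] ∉ V) {g : List ℕ} (h19 : m.reg 19 = g.length)
    (h18 : m.reg 18 = node a kind (longestIn V g))
    (h7 : ∀ g, InTrie a kind g → g ≠ [] → m.cell 7 (node a kind g) = g.length)
    (h16 : ∀ g, InTrie a kind g → m.cell 16 (node a kind g) = node a kind (fail a kind g))
    (h17 : ∀ g, InTrie a kind g → m.cell 17 (node a kind g) = node a kind (longestIn V g)) :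
    Runs ω extendFactorizations m fun t m' => t ≤ 20 + 60 * suffixCount V g ∧
      ∀ e ∈ [22, 23], (∀ l, l ≠ g.length → m'.cell e l = m.cell e l) ∧
        (m'.cell e g.length ≠ 0 ↔ m.cell e g.length ≠ 0 ∨
          ∃ v ∈ V, v <:+ g ∧ m.cell e (g.length - v.length) ≠ 0) := by
  have hVT : ∀ v ∈ V, InTrie a kind v := fun v hv => mem_imageWords_inTrie (hV ▸ hv)
  have hVne : ∀ v ∈ V, v ≠ [] := fun v hv h => hV0 (h ▸ hv)
  refine (Runs.loop hw (fun k m' => ∃ f, InTrie a kind f ∧ (f ≠ [] → f ∈ V) ∧ f <:+ g ∧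
      m'.reg 18 = node a kind f ∧
      (∀ e ∈ [22, 23], (∀ l, l ≠ g.length → m'.cell e l = m.cell e l) ∧
        (m'.cell e g.length ≠ 0 ↔ m.cell e g.length ≠ 0 ∨
          ∃ v ∈ V, v <:+ g ∧ f.length < v.length ∧ m.cell e (g.length - v.length) ≠ 0)) ∧
      k = 60 * suffixCountUpTo V g f.length)
    (k := 60 * suffixCountUpTo V g (longestIn V g).length) ?_ ?_).mono ?_
  · refine ⟨longestIn V g, ?_, longestSuffix_spec, longestSuffix_isSuffix, h18, ?_, rfl⟩
    · by_cases h : longestIn V g = []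
      · rw [h]
        exact inTrie_nil
      · exact hVT _ (longestSuffix_spec h)
    · refine fun e he => ⟨fun _ _ => rfl, ?_⟩
      rw [iff_self_or]
      rintro ⟨v, hv, hs, hl, -⟩
      have : v.length ≤ (longestIn V g).length := length_le_longestSuffix hs hv
      omega
  · rintro k m' hf ⟨f, hT, hfV, hs, h18', hm, rfl⟩
    refine ⟨trivial, fun he => ?_⟩
    simp only [Expr.val, h18', ne_eq, node_eq_zero_iff hT] at he
    have hfV := hfV he
    have c7 := hf.cell 7 (by decide)
    have c16 := hf.cell 16 (by decide)
    have c17 := hf.cell 17 (by decide)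
    have r19 := hf.reg 19 (by decide)
    rw [h19] at r19
    set f' := longestIn V (fail a kind f) with hf'
    have hs' : f' <:+ fail a kind f := longestSuffix_isSuffix
    have hlf : f'.length < f.length := hs'.length_le.trans_lt (length_fail_lt he)
    have hsg : f' <:+ g := (hs'.trans fail_isSuffix).trans hs
    have hfl := hs.length_le
    have hf0 := List.length_pos_iff.2 he
    have hstep : ∀ p : List ℕ → Prop, (∃ v ∈ V, v <:+ g ∧ f'.length < v.length ∧ p v) ↔
        p f ∨ ∃ v ∈ V, v <:+ g ∧ f.length < v.length ∧ p v := by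
      intro p
      constructor
      · rintro ⟨v, h1, h2, h3, h4⟩
        rcases lt_trichotomy v.length f.length with hl | hl | hl
        · have hsf := List.suffix_of_suffix_length_le h2 hs hl.le
          have h5 := isSuffix_fail hsf (by rintro rfl; omega) (hVT v h1)
          have : v.length ≤ f'.length := length_le_longestSuffix h5 h1
          omega
        · have hsf := (List.suffix_of_suffix_length_le h2 hs hl.le).eq_of_length hl
          exact Or.inl (hsf ▸ h4)
        · exact Or.inr ⟨v, h1, h2, hl, h4⟩
      · rintro (h | ⟨v, h1, h2, h3, h4⟩)
        · exact ⟨f, hfV, hs, hlf, h⟩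
        · exact ⟨v, h1, h2, by omega, h4⟩
    have hcount := suffixCountUpTo_lt hs hfV hlf
    have hpost : ∀ m₁ : Mem, m₁.reg 18 = node a kind f' →
        (∀ e ∈ [22, 23], (∀ l, l ≠ g.length → m₁.cell e l = m'.cell e l) ∧
          (m₁.cell e g.length ≠ 0 ↔ m'.cell e g.length ≠ 0 ∨
            m'.cell e (g.length - f.length) ≠ 0)) → ∀ t, t ≤ 50 →
        ∃ k', (∃ f, InTrie a kind f ∧ (f ≠ [] → f ∈ V) ∧ f <:+ g ∧ m₁.reg 18 = node a kind f ∧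
          (∀ e ∈ [22, 23], (∀ l, l ≠ g.length → m₁.cell e l = m.cell e l) ∧
            (m₁.cell e g.length ≠ 0 ↔ m.cell e g.length ≠ 0 ∨
              ∃ v ∈ V, v <:+ g ∧ f.length < v.length ∧ m.cell e (g.length - v.length) ≠ 0)) ∧
          k' = 60 * suffixCountUpTo V g f.length) ∧
          1 + 1 + t + k' ≤ 60 * suffixCountUpTo V g f.length := by
      intro m₁ r18 he' t ht
      refine ⟨_, ⟨f', ?_, longestSuffix_spec, hsg, r18, fun e hee => ⟨fun l hl => ?_, ?_⟩, rfl⟩,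
        by omega⟩
      · by_cases h : f' = []
        · rw [h]
          exact inTrie_nil
        · exact hVT _ (longestSuffix_spec h)
      · rw [(he' e hee).1 l hl, (hm e hee).1 l hl]
      · rw [(he' e hee).2, (hm e hee).2, hstep, (hm e hee).1 _ (by omega)]
        rw [or_assoc]
        exact or_congr_right or_comm
    have hnode : m'.cell 17 (m'.cell 16 (node a kind f)) = node a kind f' := by
      rw [c16, c17, h16 f hT, h17 _ inTrie_fail]
    -- Since `f` is not empty, the cell read lies strictly below the cell written, so earlier rounds
    -- have not changed it.
    have hne : g.length - f.length ≠ g.length := by omega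
    refine Runs.mono (Runs.of_wp hw (Q := fun t m₁ => t ≤ 50 ∧ m₁.reg 18 = node a kind f' ∧
      ∀ e ∈ [22, 23], (∀ l, l ≠ g.length → m₁.cell e l = m'.cell e l) ∧
          (m₁.cell e g.length ≠ 0 ↔ m'.cell e g.length ≠ 0 ∨
            m'.cell e (g.length - f.length) ≠ 0)) ?_) fun t m₁ h => hpost m₁ h.2.1 h.2.2 t h.1
    simp +contextual [h18', r19, c7, h7 f hT he, hnode, hw.ne', Function.update_of_ne, hfl]
  · rintro t m' ⟨k', ⟨f, hT, hfV, hs, h18', hm, rfl⟩, he, ht⟩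
    simp only [Expr.val, h18', node_eq_zero_iff hT] at he
    subst he
    have := suffixCountUpTo_le (V := V) (Nat.zero_le g.length)
    have hc := suffixCountUpTo_le (V := V) (g := g) (l := (longestIn V g).length)
      longestSuffix_isSuffix.length_le
    simp at ht
    refine ⟨by omega, fun e he => ⟨(hm e he).1, (hm e he).2.trans (or_congr_right ?_)⟩⟩
    refine exists_congr fun v => and_congr_right fun hv => and_congr_right fun _ => ?_
    simp [List.length_pos_iff.2 (hVne v hv)]

/-- Images are not empty, so the recurrence `extends_iff` refers only to shorter prefixes, and the
two arrays can be filled by increasing length. Array `22` starts from the empty word, array `23`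
from the prefixes with the property `B`, which excludes the empty word. -/
theorem runs_factorizePrefixes (hw : 0 < w) {V : Set (List ℕ)} (hV : V = imageWords a kind)
    (hV0 : [] ∉ V) {T : List ℕ} {z₀ : ℕ} (hzW : z₀ + T.length + 2 < 2 ^ w)
    (hr4 : m.reg 4 = z₀ + T.length) (hr7 : m.reg 7 = z₀)
    (hT : ∀ j ≤ T.length, word a kind (z₀ + j) = T.take j)
    (h6 : ∀ j ≤ T.length, m.cell 6 (z₀ + j) = rep a kind (z₀ + j))
    (h7 : ∀ g, InTrie a kind g → g ≠ [] → m.cell 7 (node a kind g) = g.length)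
    (h16 : ∀ g, InTrie a kind g → m.cell 16 (node a kind g) = node a kind (fail a kind g))
    (h17 : ∀ g, InTrie a kind g → m.cell 17 (node a kind g) = node a kind (longestIn V g))
    {B : List ℕ → Prop} (hB : ¬ B [])
    (h21 : ∀ j, 1 ≤ j → j ≤ T.length → (m.cell 21 j ≠ 0 ↔ B (T.take j)))
    (h22 : ∀ j, m.cell 22 j = 0) (h23 : ∀ j, m.cell 23 j = 0) :
    Runs ω factorizePrefixes m fun t m' =>
      t ≤ 40 + ∑ j ∈ Finset.Ico 1 (T.length + 1), (100 + 60 * suffixCount V (T.take j)) ∧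
      m'.reg 24 = T.length ∧
      ∀ j ≤ T.length, (m'.cell 22 j ≠ 0 ↔ Extends V (· = []) (T.take j)) ∧
        (m'.cell 23 j ≠ 0 ↔ Extends V B (T.take j)) := by
  have hWpos : 1 < 2 ^ w := Nat.one_lt_two_pow hw.ne'
  have hVne : ∀ v ∈ V, v ≠ [] := fun v hv h => hV0 (h ▸ hv)
  refine Runs.of_wp hw ?_
  simp [factorizePrefixes, hw.ne', hr4, hr7]
  refine (Runs.loop hw (fun k m' => ∃ j, m'.reg 19 = j ∧ 1 ≤ j ∧ j ≤ T.length + 1 ∧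
      (∀ l < j, (m'.cell 22 l ≠ 0 ↔ Extends V (· = []) (T.take l)) ∧
        (m'.cell 23 l ≠ 0 ↔ Extends V B (T.take l))) ∧
      (∀ l, j ≤ l → m'.cell 22 l = 0 ∧ m'.cell 23 l = 0) ∧
      k = ∑ j ∈ Finset.Ico j (T.length + 1), (100 + 60 * suffixCount V (T.take j)))
    (k := ∑ j ∈ Finset.Ico 1 (T.length + 1), (100 + 60 * suffixCount V (T.take j)))
    ?_ ?_).frame.mono ?_
  · refine ⟨1, by simp, le_rfl, by omega, ?_, ?_, rfl⟩
    · intro l hl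
      obtain rfl : l = 0 := by omega
      simp [h23]
      refine ⟨.base rfl, fun h => ?_⟩
      rcases extends_iff.1 h with h | ⟨v, hv, hs, -⟩
      · exact hB h
      · exact hVne v hv (List.suffix_nil.1 hs)
    · intro l hl
      have : l ≠ 0 := by omega
      simp [h22, h23, this]
  · rintro k m' hf ⟨j, r19, hj1, hjn, hm, hm0, rfl⟩
    have r24 := hf.reg 24 (by decide)
    have r7 := hf.reg 7 (by decide)
    have c6 := hf.cell 6 (by decide)
    have c7 := hf.cell 7 (by decide)
    have c16 := hf.cell 16 (by decide)
    have c17 := hf.cell 17 (by decide)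
    have c21 := hf.cell 21 (by decide)
    simp [hr7] at r24 r7 c6 c7 c16 c17 c21
    refine ⟨by simp [r24, hw.ne']; omega, fun he => ?_⟩
    have hjn' : j ≤ T.length := by
      simp [r19, r24] at he
      omega
    rw [Finset.sum_eq_sum_Ico_succ_bot (by omega)]
    have hlen : (T.take j).length = j := by simp [hjn']
    have hnode : m.cell 6 (z₀ + j) = node a kind (T.take j) := by rw [h6 j hjn', rep, hT j hjn']
    have hTT : InTrie a kind (T.take j) := ⟨_, hT j hjn'⟩
    -- The empty branch writes the dummy register `99`; all other registers are unchanged.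
    refine Runs.seq (Runs.mono (Q := fun t m₁ => t ≤ 10 ∧ m₁.reg = (m'.setReg 99 (m₁.reg 99)).reg ∧
      (∀ i, i ≠ 23 → m₁.cell i = m'.cell i) ∧ (∀ l, l ≠ j → m₁.cell 23 l = m'.cell 23 l) ∧
      (m₁.cell 23 j ≠ 0 ↔ B (T.take j))) (Runs.of_wp hw ?_) ?_)
    · have h21j := h21 j hj1 hjn'
      simp +contextual [r19, c21, hw.ne', Function.update_of_ne]
      refine ⟨fun h => ⟨?_, h21j.1 h⟩, fun h => ?_⟩
      · funext i
        by_cases hi : i = 99 <;> simp [hi]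
      · simp [(hm0 j le_rfl).2]
        exact fun hb => h21j.2 hb h
    rintro t₁ m₁ ⟨ht₁, hreg₁, hc₁, h23₁, hB₁⟩
    have hreg₁' : ∀ i, i ≠ 99 → m₁.reg i = m'.reg i := fun i hi => by
      rw [hreg₁]
      simp [hi]
    refine Runs.seq (Runs.of_wp hw ?_)
    simp only [wp, Expr.Safe, Op.Safe, Expr.val, Op.nat, true_and, hreg₁' 7 (by decide),
      hreg₁' 19 (by decide), r7, r19, hc₁ 6 (by decide), hc₁ 17 (by decide), c6, c17, hnode,
      h17 _ hTT]
    refine ⟨by omega, Runs.seq ((runs_extendFactorizations (a := a) (kind := kind) hw hV hV0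
      (g := T.take j) ?_ ?_ ?_ ?_ ?_).frame.mono ?_)⟩
    · simp [hreg₁' 19, r19, hjn']
    · simp
    · simpa [hc₁ 7, c7] using h7
    · simpa [hc₁ 16, c16] using h16
    · simpa [hc₁ 17, c17] using h17
    rintro t₂ m₂ ⟨⟨ht₂, hm₂⟩, hf₂⟩
    have r19₂ := hf₂.reg 19 (by decide)
    simp [hreg₁' 19, r19] at r19₂
    have h22₂ := hm₂ 22 (by simp)
    have h23₂ := hm₂ 23 (by simp)
    rw [hlen] at h22₂ h23₂
    simp only [Mem.setReg_cell, hc₁ 22 (by decide)] at h22₂ h23₂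
    have htake : ∀ l, (T.take j).take (j - l) = T.take (j - l) := fun l => by
      rw [List.take_take, min_eq_left (by omega)]
    have e22 : m₂.cell 22 j ≠ 0 ↔ Extends V (· = []) (T.take j) := by
      have hne : T.take j ≠ [] := by
        intro h
        rw [h] at hlen
        simp at hlen
        omega
      rw [h22₂.2, extends_iff]
      simp only [(hm0 j le_rfl).1, hne, hlen, htake, ne_eq, not_true, false_or]
      refine exists_congr fun v => and_congr_right fun hv => and_congr_right fun hs => ?_
      have := List.length_pos_iff.2 (hVne v hv)
      exact (hm _ (by omega)).1
    have e23 : m₂.cell 23 j ≠ 0 ↔ Extends V B (T.take j) := by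
      rw [h23₂.2, extends_iff, hB₁]
      simp only [hlen, htake]
      refine or_congr_right (exists_congr fun v => and_congr_right fun hv =>
        and_congr_right fun hs => ?_)
      have := List.length_pos_iff.2 (hVne v hv)
      rw [h23₁ _ (by omega)]
      exact (hm _ (by omega)).2
    refine Runs.of_wp hw ?_
    simp only [wp, Expr.Safe, Op.Safe, Expr.val, Op.nat, true_and, r19₂, Expr.cost]
    refine ⟨⟨hWpos, by omega⟩, _, ⟨j + 1, by simp, by omega, by omega, ?_, ?_, rfl⟩, by omega⟩
    · intro l hl
      rcases Nat.lt_succ_iff_lt_or_eq.1 hl with hl | rfl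
      · simp only [Mem.setReg_cell]
        rw [h22₂.1 l hl.ne, h23₂.1 l hl.ne, h23₁ l hl.ne]
        exact hm l hl
      · exact ⟨e22, e23⟩
    · intro l hl
      have hl' : l ≠ j := by omega
      simp only [Mem.setReg_cell]
      rw [h22₂.1 l hl', h23₂.1 l hl', h23₁ l hl']
      exact hm0 l (by omega)
  · rintro t m' ⟨⟨k', ⟨j, r19, hj1, hjn, hm, hm0, rfl⟩, he, ht⟩, hf⟩
    have r24 := hf.reg 24 (by decide)
    simp at r24
    simp [r19, r24] at he
    obtain rfl : j = T.length + 1 := by omega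
    simp at ht
    refine ⟨?_, r24, fun l hl => hm l (by omega)⟩
    rw [Finset.sum_add_distrib] at ht ⊢
    simp at ht ⊢
    omega

end Factorize

end WordRAM

/-! ### The answer -/

namespace WordRAM

open WordTrie Program WordRAM.Expr

/-- Follow the chain of failure links from the node in register `18`, looking for proper prefixes of
images that complete a factorization of the text. Register `24` holds the length of the text. -/
def completeFactorizations : Program := loop (reg 18) (block
  [cond (cell 13 (reg 18)) (block
     [assign 20 (bin .sub (reg 24) (cell 7 (reg 18))),
      cond (cell 22 (reg 20)) (assign 21 (lit 1)) (block []),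
      cond (cell 23 (reg 20)) (assign 21 (lit 1)) (block [])]) (block []),
   assign 18 (cell 16 (reg 18))])

/-- Give the answer; register `17` tells whether the text is an inner factor of an image. -/
def answer : Program := block
  [assign 18 (reg 22),
   assign 21 (cell 23 (reg 24)),
   completeFactorizations,
   assign 0 (lit 0),
   cond (reg 21) (block []) (cond (reg 17) (block []) (assign 0 (lit 1)))]

section Answer

variable {a kind : ℕ → ℕ} {w : ℕ} {ω : ℕ → BitVec w} {m : Mem}

/-- The chain starts at `T` itself, since the whole text may be a proper prefix of an image. It then
runs through all nonempty suffixes of `T` in the trie, and every proper prefix of an image is in the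
trie. -/
theorem runs_completeFactorizations (hw : 0 < w) {T : List ℕ} (hT : InTrie a kind T)
    (h18 : m.reg 18 = node a kind T) (h24 : m.reg 24 = T.length)
    (h7 : ∀ g, InTrie a kind g → g ≠ [] → m.cell 7 (node a kind g) = g.length)
    (h13 : ∀ g, InTrie a kind g → (m.cell 13 (node a kind g) ≠ 0 ↔ g ∈ imagePrefixes a kind))
    (h16 : ∀ g, InTrie a kind g → m.cell 16 (node a kind g) = node a kind (fail a kind g)) :
    Runs ω completeFactorizations m fun t m' => t ≤ 10 + 60 * T.length ∧
      (m'.reg 21 ≠ 0 ↔ m.reg 21 ≠ 0 ∨ ∃ f ∈ imagePrefixes a kind, f ≠ [] ∧ f <:+ T ∧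
        (m.cell 22 (T.length - f.length) ≠ 0 ∨ m.cell 23 (T.length - f.length) ≠ 0)) := by
  have hPT : ∀ v ∈ imagePrefixes a kind, InTrie a kind v := by
    rintro _ ⟨i, -, rfl⟩
    exact inTrie_word
  set D : List ℕ → Prop := fun f =>
    m.cell 22 (T.length - f.length) ≠ 0 ∨ m.cell 23 (T.length - f.length) ≠ 0 with hD
  refine (Runs.loop hw (fun k m' => ∃ f, InTrie a kind f ∧ f <:+ T ∧ m'.reg 18 = node a kind f ∧
      (m'.reg 21 ≠ 0 ↔ m.reg 21 ≠ 0 ∨ ∃ h ∈ imagePrefixes a kind, h ≠ [] ∧ h <:+ T ∧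
        f.length < h.length ∧ D h) ∧ k = 60 * f.length) (k := 60 * T.length) ?_ ?_).mono ?_
  · refine ⟨T, hT, List.suffix_rfl, h18, ?_, rfl⟩
    rw [iff_self_or]
    rintro ⟨v, -, -, hs, hl, -⟩
    have := hs.length_le
    omega
  · rintro k m' hf ⟨f, hT, hs, h18', hm, rfl⟩
    refine ⟨trivial, fun he => ?_⟩
    simp only [Expr.val, h18', ne_eq, node_eq_zero_iff hT] at he
    have c7 := hf.cell 7 (by decide)
    have c13 := hf.cell 13 (by decide)
    have c16 := hf.cell 16 (by decide)
    have c22 := hf.cell 22 (by decide)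
    have c23 := hf.cell 23 (by decide)
    have r24 := hf.reg 24 (by decide)
    have hlf := length_fail_lt (a := a) (kind := kind) he
    have hfl := hs.length_le
    have h13f := h13 f hT
    have hstep : (∃ h ∈ imagePrefixes a kind, h ≠ [] ∧ h <:+ T ∧
        (fail a kind f).length < h.length ∧ D h) ↔ (f ∈ imagePrefixes a kind ∧ D f) ∨
        ∃ h ∈ imagePrefixes a kind, h ≠ [] ∧ h <:+ T ∧ f.length < h.length ∧ D h := by
      constructor
      · rintro ⟨h, h1, h2, h3, h4, h5⟩
        rcases lt_trichotomy h.length f.length with hl | hl | hl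
        · have hsf := List.suffix_of_suffix_length_le h3 hs hl.le
          have := length_le_fail hsf (by rintro rfl; omega) (hPT h h1)
          omega
        · have hsf := (List.suffix_of_suffix_length_le h3 hs hl.le).eq_of_length hl
          exact Or.inl ⟨hsf ▸ h1, hsf ▸ h5⟩
        · exact Or.inr ⟨h, h1, h2, h3, hl, h5⟩
      · rintro (⟨h1, h2⟩ | ⟨h, h1, h2, h3, h4, h5⟩)
        · exact ⟨f, h1, he, hs, hlf, h2⟩
        · exact ⟨h, h1, h2, h3, by omega, h5⟩
    refine Runs.mono (Runs.of_wp hw (Q := fun t m₁ => t ≤ 50 ∧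
      m₁.reg 18 = node a kind (fail a kind f) ∧
      (m₁.reg 21 ≠ 0 ↔ m'.reg 21 ≠ 0 ∨ (f ∈ imagePrefixes a kind ∧ D f))) ?_) ?_
    · simp only [hD, ← h13f]
      simp +contextual [h18', r24, h24, c7, h7 f hT he, c13, c16, h16 f hT, c22, c23, hw.ne', hfl]
    · rintro t m₁ ⟨ht, r18, r21⟩
      refine ⟨_, ⟨fail a kind f, inTrie_fail, fail_isSuffix.trans hs, r18, ?_, rfl⟩, ?_⟩
      · rw [r21, hm, hstep, or_assoc, or_congr_right or_comm]
      · simp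
        omega
  · rintro t m' ⟨k', ⟨f, hT, hs, h18', hm, rfl⟩, he, ht⟩
    simp only [Expr.val, h18', node_eq_zero_iff hT] at he
    subst he
    simp at ht
    refine ⟨by omega, hm.trans (or_congr_right ?_)⟩
    refine exists_congr fun v => and_congr_right fun hv => and_congr_right fun hv0 => ?_
    simp [List.length_pos_iff.2 hv0, hD]

/-- Register `21` starts with the case of an empty last part, where the first part must be nonempty.
This is why array `23`, but not array `22`, is read at the full length. -/
theorem runs_answer (hw : 0 < w) {T : List ℕ} (hT : InTrie a kind T)
    (h22 : m.reg 22 = node a kind T) (h24 : m.reg 24 = T.length)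
    (h7 : ∀ g, InTrie a kind g → g ≠ [] → m.cell 7 (node a kind g) = g.length)
    (h13 : ∀ g, InTrie a kind g → (m.cell 13 (node a kind g) ≠ 0 ↔ g ∈ imagePrefixes a kind))
    (h16 : ∀ g, InTrie a kind g → m.cell 16 (node a kind g) = node a kind (fail a kind g))
    {p : Prop} (hp : p ↔ ¬ (m.cell 23 T.length ≠ 0 ∨ ∃ f ∈ imagePrefixes a kind, f ≠ [] ∧
      f <:+ T ∧ (m.cell 22 (T.length - f.length) ≠ 0 ∨ m.cell 23 (T.length - f.length) ≠ 0)) ∧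
      ¬ m.reg 17 ≠ 0) :
    Runs ω answer m fun t m' => t ≤ 60 + 60 * T.length ∧
      (p → m'.reg 0 = 1) ∧ (¬ p → m'.reg 0 = 0) := by
  simp only [answer, block]
  refine Runs.seq (Runs.of_wp hw ?_)
  simp only [wp, Expr.Safe, Expr.val, true_and]
  refine Runs.seq (Runs.of_wp hw ?_)
  simp only [wp, Expr.Safe, Expr.val, true_and]
  refine Runs.seq ((runs_completeFactorizations (a := a) (kind := kind) hw hT ?_ ?_ ?_ ?_
    ?_).frame.mono ?_)
  · simpa using h22
  · simpa using h24
  · simpa using h7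
  · simpa using h13
  · simpa using h16
  rintro t m' ⟨⟨ht, h21⟩, hf⟩
  have r17 := hf.reg 17 (by decide)
  simp only [Mem.setReg_reg, Mem.setReg_cell] at h21 r17
  simp at r17
  simp only [show (24 : ℕ) ≠ 18 by decide, if_false, if_true, h24] at h21
  rw [← h21] at hp
  refine Runs.of_wp hw ?_
  by_cases h1 : m'.reg 21 = 0 <;> by_cases h2 : m.reg 17 = 0 <;>
    simp [hp, h1, h2, r17, hw.ne'] <;> omega

end Answer

end WordRAM

/-! ### The layout of the images and the text -/

namespace WordTrie

/-- The letter at a position of a list of letters and kinds; the list occupies the positions from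
`1` on. -/
def letterAt (L : List (ℕ × ℕ)) : ℕ → ℕ
  | 0 => 0
  | i + 1 => (L.getD i (0, 0)).1

/-- The kind of a position of a list of letters and kinds. -/
def kindAt (L : List (ℕ × ℕ)) : ℕ → ℕ
  | 0 => 0
  | i + 1 => (L.getD i (0, 0)).2

/-- The letters of the images, with kind `1`, and a blank after every image. -/
def imageLayout (vs : List (List ℕ)) : List (ℕ × ℕ) :=
  vs.flatMap fun v => v.map (·, 1) ++ [(0, 0)]

/-- The letters of the images, with kind `1`, a blank after every image, and the letters of the
text, with kind `2`. -/
def layout (vs : List (List ℕ)) (T : List ℕ) : List (ℕ × ℕ) := imageLayout vs ++ T.map (·, 2)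

section Layout

variable {L R : List (ℕ × ℕ)} {vs : List (List ℕ)} {v T : List ℕ} {c k : ℕ}

theorem letterAt_concat : letterAt (L ++ [(c, k)]) =
    Function.update (letterAt L) (L.length + 1) c := by
  funext i
  cases i with
  | zero => simp [letterAt]
  | succ i =>
    simp only [letterAt, Function.update_apply, List.getD_eq_getElem?_getD, List.getElem?_append,
      Nat.add_right_cancel_iff]
    rcases lt_trichotomy i L.length with h | rfl | h
    · simp [h, h.ne]
    · simp
    · simp [h.ne', List.getElem?_eq_none, show ¬ i < L.length by omega,
        show 1 ≤ i - L.length by omega]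

theorem kindAt_concat : kindAt (L ++ [(c, k)]) =
    Function.update (kindAt L) (L.length + 1) k := by
  funext i
  cases i with
  | zero => simp [kindAt]
  | succ i =>
    simp only [kindAt, Function.update_apply, List.getD_eq_getElem?_getD, List.getElem?_append,
      Nat.add_right_cancel_iff]
    rcases lt_trichotomy i L.length with h | rfl | h
    · simp [h, h.ne]
    · simp
    · simp [h.ne', List.getElem?_eq_none, show ¬ i < L.length by omega,
        show 1 ≤ i - L.length by omega]

theorem kindAt_of_length_lt {i : ℕ} (h : L.length < i) : kindAt L i = 0 := by
  cases i with
  | zero => rfl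
  | succ i => simp [kindAt, show L.length ≤ i by omega]

theorem letterAt_of_length_lt {i : ℕ} (h : L.length < i) : letterAt L i = 0 := by
  cases i with
  | zero => rfl
  | succ i => simp [letterAt, show L.length ≤ i by omega]

/-- Positions beyond the list read as blanks by default, so the program appends a blank by advancing
register `4` without writing anything. -/
theorem letterAt_concat_blank : letterAt (L ++ [(0, 0)]) = letterAt L := by
  rw [letterAt_concat, Function.update_eq_self_iff, letterAt_of_length_lt (by omega)]

theorem kindAt_concat_blank : kindAt (L ++ [(0, 0)]) = kindAt L := by
  rw [kindAt_concat, Function.update_eq_self_iff, kindAt_of_length_lt (by omega)]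

theorem kindAt_append_map {j : ℕ} (hj : j < v.length) :
    kindAt (L ++ (v.map (·, k) ++ R)) (L.length + 1 + j) = k := by
  rw [show L.length + 1 + j = L.length + j + 1 by omega]
  simp [kindAt, List.getElem?_append, hj]

theorem letterAt_append_map {j : ℕ} (hj : j < v.length) :
    letterAt (L ++ (v.map (·, k) ++ R)) (L.length + 1 + j) = v[j] := by
  rw [show L.length + 1 + j = L.length + j + 1 by omega]
  simp [letterAt, List.getElem?_append, hj]

theorem word_append_map (hk : k ≠ 0)
    (h0 : kindAt (L ++ (v.map (·, k) ++ R)) L.length = 0) {j : ℕ} (hj : j ≤ v.length) :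
    word (letterAt (L ++ (v.map (·, k) ++ R))) (kindAt (L ++ (v.map (·, k) ++ R))) (L.length + j) =
      v.take j := by
  induction j with
  | zero => simpa using word_of_kind_eq_zero h0
  | succ j ih =>
    rw [word_of_kind_ne_zero (by omega), show L.length + (j + 1) - 1 = L.length + j by omega,
      ih (by omega), show L.length + (j + 1) = L.length + 1 + j by omega,
      letterAt_append_map (by omega), List.take_concat_get']
    rw [show L.length + (j + 1) = L.length + 1 + j by omega, kindAt_append_map (by omega)]
    exact hk

theorem imageLayout_append {ws : List (List ℕ)} :
    imageLayout (vs ++ ws) = imageLayout vs ++ imageLayout ws := by simp [imageLayout]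

theorem imageLayout_cons :
    imageLayout (v :: vs) = v.map (·, 1) ++ (0, 0) :: imageLayout vs := by simp [imageLayout]

theorem kindAt_length_imageLayout : kindAt (imageLayout vs ++ R) (imageLayout vs).length = 0 := by
  rcases List.eq_nil_or_concat vs with rfl | ⟨ws, v, rfl⟩
  · rfl
  · simp [imageLayout, kindAt]

theorem length_imageLayout : (imageLayout vs).length = vs.flatten.length + vs.length := by
  induction vs with
  | nil => rfl
  | cons v vs ih => simp [imageLayout_cons, ih]; omega

theorem length_layout : (layout vs T).length = vs.flatten.length + vs.length + T.length := by
  simp [layout, length_imageLayout]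

theorem layout_append_cons {ws : List (List ℕ)} : layout (vs ++ v :: ws) T =
    imageLayout vs ++ (v.map (·, 1) ++ ((0, 0) :: layout ws T)) := by
  simp [layout, imageLayout_append, imageLayout_cons]

/-- Every position that is not blank lies in the block of an image or of the text. The descriptions
of the image words, image prefixes and text prefixes rest on this. -/
theorem kindAt_layout_cases {i : ℕ} (h : kindAt (layout vs T) i ≠ 0) :
    (∃ ws v ws' j, vs = ws ++ v :: ws' ∧ j < v.length ∧ i = (imageLayout ws).length + 1 + j) ∨
    ∃ j < T.length, i = (imageLayout vs).length + 1 + j := by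
  induction vs generalizing i with
  | nil =>
    cases i with
    | zero => simp [kindAt] at h
    | succ i =>
      refine Or.inr ⟨i, ?_, by simp [imageLayout]; omega⟩
      by_contra hi
      exact h (kindAt_of_length_lt (by simp [layout, imageLayout]; omega))
  | cons v vs ih =>
    cases i with
    | zero => simp [kindAt] at h
    | succ i =>
      rcases lt_trichotomy i v.length with hi | rfl | hi
      · exact Or.inl ⟨[], v, vs, i, rfl, hi, by simp [imageLayout]; omega⟩
      · simp [layout, imageLayout_cons, kindAt] at h
      · obtain ⟨d, rfl⟩ := Nat.exists_eq_add_of_lt hi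
        have : kindAt (layout vs T) (d + 1) ≠ 0 := by
          rw [← List.nil_append (v :: vs), layout_append_cons] at h
          have e : v.length + d + 1 - v.length = d + 1 := by omega
          simpa [imageLayout, kindAt, List.getElem?_append, e,
            show ¬ v.length + d + 1 < v.length by omega] using h
        rcases ih this with ⟨ws, v', ws', j, rfl, hj, hd⟩ | ⟨j, hj, hd⟩
        · exact Or.inl ⟨v :: ws, v', ws', j, rfl, hj, by simp [imageLayout_cons]; omega⟩
        · exact Or.inr ⟨j, hj, by simp [imageLayout_cons]; omega⟩

section Blocks

variable {ws : List (List ℕ)} {j : ℕ}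

theorem kindAt_image (hj : j < v.length) :
    kindAt (layout (vs ++ v :: ws) T) ((imageLayout vs).length + 1 + j) = 1 := by
  rw [layout_append_cons]
  exact kindAt_append_map hj

theorem kindAt_text (hj : j < T.length) :
    kindAt (layout vs T) ((imageLayout vs).length + 1 + j) = 2 := by
  have := kindAt_append_map (L := imageLayout vs) (R := []) (k := 2) hj
  rwa [List.append_nil] at this

theorem word_image (hj : j ≤ v.length) :
    word (letterAt (layout (vs ++ v :: ws) T)) (kindAt (layout (vs ++ v :: ws) T))
      ((imageLayout vs).length + j) = v.take j := by
  rw [layout_append_cons]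
  exact word_append_map one_ne_zero kindAt_length_imageLayout hj

theorem word_text (hj : j ≤ T.length) :
    word (letterAt (layout vs T)) (kindAt (layout vs T)) ((imageLayout vs).length + j) =
      T.take j := by
  have := word_append_map (L := imageLayout vs) (R := []) two_ne_zero kindAt_length_imageLayout hj
  rwa [List.append_nil] at this

end Blocks

/-- An empty image would leave no position of kind `1` at which it could end, so it has to be
excluded. -/
theorem mem_imageWords_layout (hvs : [] ∉ vs) {g : List ℕ} :
    g ∈ imageWords (letterAt (layout vs T)) (kindAt (layout vs T)) ↔ g ∈ vs := by
  constructor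
  · rintro ⟨i, h1, h2, rfl⟩
    rcases kindAt_layout_cases (h1.trans_ne one_ne_zero) with
      ⟨ws, v, ws', j, rfl, hj, rfl⟩ | ⟨j, hj, rfl⟩
    · have hj' : j + 1 = v.length := by
        by_contra hne
        rw [add_assoc, kindAt_image (by omega)] at h2
        exact absurd h2 one_ne_zero
      rw [show (imageLayout ws).length + 1 + j = (imageLayout ws).length + v.length by omega,
        word_image le_rfl]
      simp
    · rw [kindAt_text hj] at h1
      exact absurd h1 (by decide)
  · intro h
    obtain ⟨ws, ws', rfl⟩ := List.append_of_mem h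
    have hg : g.length ≠ 0 := fun h0 => hvs (by simp [List.length_eq_zero_iff.1 h0])
    refine ⟨(imageLayout ws).length + g.length, ?_, ?_, ?_⟩
    · have := kindAt_image (vs := ws) (ws := ws') (T := T) (v := g) (j := g.length - 1) (by omega)
      rwa [show (imageLayout ws).length + 1 + (g.length - 1) =
        (imageLayout ws).length + g.length by omega] at this
    · rw [layout_append_cons]
      simp [kindAt]
    · simpa using word_image (vs := ws) (ws := ws') (T := T) (v := g) le_rfl

theorem mem_imagePrefixes_layout {g : List ℕ} :
    g ∈ imagePrefixes (letterAt (layout vs T)) (kindAt (layout vs T)) ↔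
      ∃ v ∈ vs, g <+: v ∧ g ≠ v := by
  constructor
  · rintro ⟨i, h1, rfl⟩
    rcases kindAt_layout_cases (h1.trans_ne one_ne_zero) with
      ⟨ws, v, ws', j, rfl, hj, rfl⟩ | ⟨j, hj, rfl⟩
    · rw [show (imageLayout ws).length + 1 + j - 1 = (imageLayout ws).length + j by omega,
        word_image hj.le]
      refine ⟨v, by simp, List.take_prefix _ _, fun h => ?_⟩
      have := congrArg List.length h
      simp at this
      omega
    · rw [kindAt_text hj] at h1
      exact absurd h1 (by decide)
  · rintro ⟨v, hv, hg, hne⟩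
    obtain ⟨ws, ws', rfl⟩ := List.append_of_mem hv
    have hlt : g.length < v.length :=
      lt_of_le_of_ne hg.length_le fun h => hne (hg.eq_of_length h)
    refine ⟨(imageLayout ws).length + 1 + g.length, kindAt_image hlt, ?_⟩
    rw [show (imageLayout ws).length + 1 + g.length - 1 = (imageLayout ws).length + g.length by
      omega, word_image hlt.le, ← List.prefix_iff_eq_take.1 hg]

theorem mem_textPrefixes_layout {g : List ℕ} :
    g ∈ textPrefixes (letterAt (layout vs T)) (kindAt (layout vs T)) ↔ g ≠ [] ∧ g <+: T := by
  constructor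
  · rintro ⟨i, h0, h1, rfl⟩
    rcases kindAt_layout_cases h0 with ⟨ws, v, ws', j, rfl, hj, rfl⟩ | ⟨j, hj, rfl⟩
    · exact absurd (kindAt_image hj) h1
    · rw [add_assoc, word_text (by omega)]
      refine ⟨fun h => ?_, List.take_prefix _ _⟩
      have := congrArg List.length h
      rw [List.length_take, List.length_nil] at this
      omega
  · rintro ⟨h0, h⟩
    have hl := h.length_le
    have h0 := List.length_pos_iff.2 h0
    have h2 := kindAt_text (vs := vs) (T := T) (j := g.length - 1) (by omega)
    rw [show (imageLayout vs).length + 1 + (g.length - 1) =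
        (imageLayout vs).length + g.length by omega] at h2
    exact ⟨(imageLayout vs).length + g.length, by simp [h2], by simp [h2],
      by rw [word_text hl, ← List.prefix_iff_eq_take.1 h]⟩

end Layout

end WordTrie

/-! ### Laying out the input -/

namespace WordRAM

open WordTrie Program WordRAM.Expr

/-- Append the word of length register `5` that starts at the address in register `3` of array `0`
to the layout, whose last position is in register `4`; register `6` holds the kind. -/
def copyWord : Program := loop (reg 5) (block
  [assign 4 (bin .add (reg 4) (lit 1)),
   store 4 (reg 4) (cell 0 (reg 3)),
   store 5 (reg 4) (reg 6),
   assign 3 (bin .add (reg 3) (lit 1)),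
   assign 5 (bin .sub (reg 5) (lit 1))])

/-- Lay out the images; array `3` gets the addresses of their first letters in array `0`. -/
def layoutImages : Program := block
  [assign 6 (lit 1),
   loop (bin .lt (reg 8) (reg 0)) (block
     [store 3 (reg 8) (reg 3),
      assign 5 (cell 1 (reg 8)),
      copyWord,
      assign 4 (bin .add (reg 4) (lit 1)),
      assign 8 (bin .add (reg 8) (lit 1))])]

/-- Lay out the text. -/
def layoutText : Program := block
  [assign 7 (reg 4),
   assign 6 (lit 2),
   assign 8 (lit 0),
   loop (bin .lt (reg 8) (reg 1)) (block
     [assign 3 (cell 3 (cell 2 (reg 8))),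
      assign 5 (cell 1 (cell 2 (reg 8))),
      copyWord,
      assign 8 (bin .add (reg 8) (lit 1))])]

/-- The layout consists of the list `L` of letters and kinds. -/
structure LaidOut (L : List (ℕ × ℕ)) (m : Mem) : Prop where
  last : m.reg 4 = L.length
  letter : m.cell 4 = letterAt L
  kind : m.cell 5 = kindAt L

/-- The total length of the words before the `i`-th one. -/
def offset (vs : List (List ℕ)) (i : ℕ) : ℕ := (vs.take i).flatten.length

section Layout

variable {w : ℕ} {ω : ℕ → BitVec w} {m : Mem} {L : List (ℕ × ℕ)} {v : List ℕ} {p k : ℕ}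

theorem runs_copyWord (hw : 0 < w) (hL : LaidOut L m) (h3 : m.reg 3 = p) (h5 : m.reg 5 = v.length)
    (h6 : m.reg 6 = k) (h0 : ∀ j (h : j < v.length), m.cell 0 (p + j) = v[j])
    (hp : p + v.length < 2 ^ w) (hl : L.length + v.length < 2 ^ w) :
    Runs ω copyWord m fun t m' => t ≤ 2 + 30 * v.length ∧ LaidOut (L ++ v.map (·, k)) m' ∧
      m'.reg 3 = p + v.length := by
  have hWpos : 1 < 2 ^ w := Nat.one_lt_two_pow hw.ne'
  refine (Runs.loop hw (fun c m' => ∃ j, j ≤ v.length ∧ m'.reg 3 = p + j ∧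
      m'.reg 5 = v.length - j ∧ LaidOut (L ++ (v.take j).map (·, k)) m' ∧
      c = 30 * (v.length - j)) (k := 30 * v.length) ?_ ?_).mono ?_
  · exact ⟨0, by omega, h3, h5, by simpa using hL, rfl⟩
  · rintro c m' hf ⟨j, hj, r3, r5, ⟨hl4, hc4, hc5⟩, rfl⟩
    refine ⟨trivial, fun he => Runs.of_wp hw ?_⟩
    have r6 := hf.reg 6 (by decide)
    have c0 := hf.cell 0 (by decide)
    rw [h6] at r6
    simp only [Expr.val, r5] at he
    have hjl : j < v.length := by omega
    have hlen : (L ++ (v.take j).map (·, k)).length = L.length + j := by simp; omega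
    have hL' : L ++ (v.take (j + 1)).map (·, k) = L ++ (v.take j).map (·, k) ++ [(v[j], k)] := by
      rw [List.append_assoc, ← List.take_concat_get' v j hjl, List.map_append]
      rfl
    rw [hlen] at hl4
    simp only [block, wp, Expr.Safe, Op.Safe, Expr.val, Op.nat, true_and, Mem.setReg_reg,
      Mem.setReg_cell, Mem.setCell_reg]
    simp only [show (3 : ℕ) ≠ 4 by decide, show (6 : ℕ) ≠ 4 by decide, show (5 : ℕ) ≠ 3 by decide,
      show (5 : ℕ) ≠ 4 by decide, if_false, if_true, hl4, r3, r5, r6, c0,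
      h0 j hjl]
    refine ⟨⟨hWpos, by omega⟩, ⟨hWpos, by omega⟩, ⟨hWpos, by omega⟩, _, ⟨j + 1, by omega,
      by simp; omega, by omega, ⟨?_, ?_, ?_⟩, rfl⟩, by simp; omega⟩
    · rw [hL', List.length_append, hlen]
      simp
    · rw [hL', letterAt_concat, hlen]
      simp [hc4]
    · rw [hL', kindAt_concat, hlen]
      simp [hc5]
  · rintro t m' ⟨c, ⟨j, hj, r3, r5, hL', rfl⟩, he, ht⟩
    simp only [Expr.val, r5] at he
    obtain rfl : j = v.length := by omega
    simp at ht
    exact ⟨by omega, by simpa using hL', r3⟩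

theorem LaidOut.concat_blank (h : LaidOut L m) {m' : Mem} (h4 : m'.reg 4 = m.reg 4 + 1)
    (hc : m'.cell = m.cell) : LaidOut (L ++ [(0, 0)]) m' := by
  refine ⟨?_, ?_, ?_⟩
  · rw [h4, h.last, List.length_append, List.length_singleton]
  · rw [letterAt_concat_blank, hc, h.letter]
  · rw [kindAt_concat_blank, hc, h.kind]

variable {vs : List (List ℕ)} {us : List ℕ}

theorem getD_flatten_offset_add {i j : ℕ} (hi : i < vs.length) (hj : j < vs[i].length) :
    vs.flatten.getD (offset vs i + j) 0 = vs[i][j] := by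
  rw [offset]
  conv_lhs => rw [← List.take_append_drop i vs, List.flatten_append,
    List.drop_eq_getElem_cons hi, List.flatten_cons]
  simp [List.getElem?_append, hj]

theorem offset_le (i : ℕ) : offset vs i ≤ offset vs vs.length := by
  simp only [offset, List.take_length]
  conv_rhs => rw [← List.take_append_drop i vs, List.flatten_append, List.length_append]
  omega

theorem offset_succ {i : ℕ} (hi : i < vs.length) :
    offset vs (i + 1) = offset vs i + vs[i].length := by
  rw [offset, List.take_add_one, List.getElem?_eq_getElem hi, List.flatten_append,
    List.length_append, offset]
  simp

theorem runs_layoutImages (hw : 0 < w) (hr0 : m.reg 0 = vs.length)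
    (h0 : ∀ i, m.cell 0 i = vs.flatten.getD i 0) (h1 : ∀ i, m.cell 1 i = (vs.getD i []).length)
    (hr3 : m.reg 3 = 0) (hr8 : m.reg 8 = 0) (hL : LaidOut [] m)
    (hW : offset vs vs.length + vs.length < 2 ^ w) :
    Runs ω layoutImages m fun t m' => t ≤ 10 + 60 * (offset vs vs.length + vs.length) ∧
      LaidOut (imageLayout vs) m' ∧
      ∀ i < vs.length, m'.cell 3 i = offset vs i := by
  have hWpos : 1 < 2 ^ w := Nat.one_lt_two_pow hw.ne'
  refine Runs.of_wp hw ?_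
  simp [layoutImages, hw.ne']
  refine (Runs.loop hw (fun c m' => ∃ i, i ≤ vs.length ∧ m'.reg 8 = i ∧
      m'.reg 3 = offset vs i ∧ LaidOut (imageLayout (vs.take i)) m' ∧
      (∀ i' < i, m'.cell 3 i' = offset vs i') ∧
      c + 60 * (offset vs i + i) = 60 * (offset vs vs.length + vs.length))
    (k := 60 * (offset vs vs.length + vs.length)) ?_ ?_).frame.mono ?_
  · exact ⟨0, by omega, hr8, by simp [hr3, offset],
      ⟨by simpa [imageLayout] using hL.last, hL.letter, hL.kind⟩,
      by omega, by simp [offset]⟩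
  · rintro c m' hf ⟨i, hi, r8, r3, hL', h3, hc⟩
    have r0 := hf.reg 0 (by decide)
    have r6 := hf.reg 6 (by decide)
    have c0 := hf.cell 0 (by decide)
    have c1 := hf.cell 1 (by decide)
    simp [hr0] at r0 r6 c0 c1
    refine ⟨by simp, fun he => ?_⟩
    simp [r8, r0] at he
    have hlen := offset_succ he
    have hle := offset_le (vs := vs) (i + 1)
    have hll : (imageLayout (vs.take i)).length = offset vs i + i := by
      rw [length_imageLayout, List.length_take_of_le hi, offset]
    refine Runs.seq (Runs.of_wp hw ?_)
    simp
    refine Runs.seq (Runs.of_wp hw ?_)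
    simp [r8, r3, c1]
    refine Runs.seq ((runs_copyWord (v := vs[i]) (L := imageLayout (vs.take i)) (k := 1)
      (p := offset vs i) hw ⟨?_, ?_, ?_⟩ ?_ ?_ ?_ ?_ ?_ ?_).frame.mono ?_)
    · simpa using hL'.last
    · simpa using hL'.letter
    · simpa using hL'.kind
    · simpa using r3
    · simp [h1, he]
    · simp [r6]
    · intro j hj
      simp only [Mem.setReg_cell, Mem.setCell_cell]
      simp only [show (0 : ℕ) ≠ 3 by decide, if_false, c0, h0]
      exact getD_flatten_offset_add he hj
    · omega
    · omega
    rintro t m₁ ⟨⟨ht, hL₁, r3₁⟩, hf₁⟩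
    have r8₁ := hf₁.reg 8 (by decide)
    have c3₁ := hf₁.cell 3 (by decide)
    have r4₁ := hL₁.last
    simp [r8] at r8₁ c3₁
    rw [List.length_append, hll, List.length_map] at r4₁
    refine Runs.of_wp hw ?_
    simp only [wp, Expr.Safe, Op.Safe, Expr.val, Op.nat, true_and, Mem.setReg_reg]
    simp only [show (8 : ℕ) ≠ 4 by decide, show (3 : ℕ) ≠ 8 by decide, show (3 : ℕ) ≠ 4 by decide,
      if_false, if_true, r8₁, r4₁, r3₁]
    refine ⟨⟨hWpos, by omega⟩, ⟨hWpos, by omega⟩,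
      60 * (offset vs vs.length + vs.length) - 60 * (offset vs (i + 1) + (i + 1)),
      ⟨by omega, hlen.symm, ?_, ?_, ?_⟩, ?_⟩
    · have : imageLayout (vs.take (i + 1)) =
          imageLayout (vs.take i) ++ vs[i].map (·, 1) ++ [(0, 0)] := by
        rw [List.take_add_one, List.getElem?_eq_getElem he, imageLayout_append, List.append_assoc]
        simp [imageLayout]
      rw [this]
      exact hL₁.concat_blank (by simp [r4₁]) rfl
    · intro i' hi'
      simp only [Mem.setReg_cell, c3₁, Function.update_apply]
      split_ifs with h
      · rw [h]
      · exact h3 i' (by omega)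
    · omega
    · simp
      omega
  · rintro t m' ⟨⟨c, ⟨i, hi, r8, r3, hL', h3, hc⟩, he, ht⟩, hf⟩
    have r0 := hf.reg 0 (by decide)
    simp [hr0] at r0
    simp [r8, r0] at he
    obtain rfl : i = vs.length := by omega
    simp at ht
    exact ⟨by omega, by simpa using hL', h3⟩

/-- The input contains `u` but not `φ(u)`; the text is assembled by copying images from the
addresses recorded in array `3`. -/
theorem runs_layoutText (hw : 0 < w) (hus : ∀ c ∈ us, c < vs.length) (hr1 : m.reg 1 = us.length)
    (h0 : ∀ i, m.cell 0 i = vs.flatten.getD i 0) (h1 : ∀ i, m.cell 1 i = (vs.getD i []).length)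
    (h2 : ∀ i, m.cell 2 i = us.getD i 0) (h3 : ∀ i < vs.length, m.cell 3 i = offset vs i)
    (hL : LaidOut L m) {T : List ℕ} (hT : T = us.flatMap fun c => vs.getD c [])
    (hW : offset vs vs.length + L.length + T.length + us.length + 2 < 2 ^ w) :
    Runs ω layoutText m fun t m' => t ≤ 20 + 60 * (T.length + us.length) ∧
      LaidOut (L ++ T.map (·, 2)) m' ∧ m'.reg 7 = L.length := by
  have hWpos : 1 < 2 ^ w := Nat.one_lt_two_pow hw.ne'
  obtain ⟨text, htext⟩ : ∃ text : ℕ → List ℕ,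
    ∀ j, text j = (us.take j).flatMap fun c => vs.getD c [] := ⟨_, fun _ => rfl⟩
  have htextT : text us.length = T := by rw [htext, hT, List.take_length]
  have hsucc : ∀ j (h : j < us.length), text (j + 1) = text j ++ vs.getD us[j] [] := by
    intro j h
    rw [htext, htext, List.take_add_one, List.getElem?_eq_getElem h, List.flatMap_append]
    simp
  have hle : ∀ j, (text j).length ≤ T.length := by
    intro j
    rw [htext, hT]
    conv_rhs => rw [← List.take_append_drop j us, List.flatMap_append, List.length_append]
    omega
  refine Runs.of_wp hw ?_
  simp [layoutText]
  refine ⟨by omega, (Runs.loop hw (fun c m' => ∃ j, j ≤ us.length ∧ m'.reg 8 = j ∧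
      LaidOut (L ++ (text j).map (·, 2)) m' ∧
      c + 60 * ((text j).length + j) = 60 * (T.length + us.length))
    (k := 60 * (T.length + us.length)) ?_ ?_).frame.mono ?_⟩
  · refine ⟨0, by omega, by simp, ?_, by simp [htext]⟩
    simp only [htext, List.take_zero, List.flatMap_nil, List.map_nil, List.append_nil]
    exact ⟨by simpa using hL.last, hL.letter, hL.kind⟩
  · rintro c m' hf ⟨j, hj, r8, hL', hc⟩
    have r1 := hf.reg 1 (by decide)
    have r6 := hf.reg 6 (by decide)
    have c0 := hf.cell 0 (by decide)
    have c1 := hf.cell 1 (by decide)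
    have c2 := hf.cell 2 (by decide)
    have c3 := hf.cell 3 (by decide)
    simp [hr1] at r1 r6 c0 c1 c2 c3
    refine ⟨by simp, fun he => ?_⟩
    simp [r8, r1] at he
    have hu : us.getD j 0 = us[j] := by simp [he]
    have hc' : us[j] < vs.length := hus _ (List.getElem_mem he)
    have hv : vs.getD us[j] [] = vs[us[j]] := by simp [hc']
    have hsj := hsucc j he
    have hsl := hle (j + 1)
    have hoff := offset_succ hc'
    have hoff' := offset_le (vs := vs) (us[j] + 1)
    rw [hv] at hsj
    have hlen : (text (j + 1)).length = (text j).length + vs[us[j]].length := by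
      rw [hsj, List.length_append]
    refine Runs.seq (Runs.of_wp hw ?_)
    simp only [wp, Expr.Safe, Expr.val, true_and, r8, c2, c3, h2, hu, h3 _ hc']
    refine Runs.seq (Runs.of_wp hw ?_)
    simp only [wp, Expr.Safe, Expr.val, true_and, Mem.setReg_reg, Mem.setReg_cell,
      show (8 : ℕ) ≠ 3 by decide, if_false, r8, c1, c2, h1, h2, hu, hv]
    refine Runs.seq ((runs_copyWord (v := vs[us[j]]) (L := L ++ (text j).map (·, 2)) (k := 2)
      (p := offset vs us[j]) hw ⟨?_, ?_, ?_⟩ ?_ ?_ ?_ ?_ ?_ ?_).frame.mono ?_)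
    · simpa using hL'.last
    · simpa using hL'.letter
    · simpa using hL'.kind
    · simp
    · simp
    · simp [r6]
    · intro i hi
      simp only [Mem.setReg_cell, c0, h0]
      exact getD_flatten_offset_add hc' hi
    · omega
    · rw [List.length_append, List.length_map]
      omega
    rintro t m₁ ⟨⟨ht, hL₁, -⟩, hf₁⟩
    have r8₁ := hf₁.reg 8 (by decide)
    simp [r8] at r8₁
    refine Runs.of_wp hw ?_
    simp only [wp, Expr.Safe, Op.Safe, Expr.val, Op.nat, true_and, r8₁]
    refine ⟨⟨hWpos, by omega⟩,
      60 * (T.length + us.length) - 60 * ((text (j + 1)).length + (j + 1)),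
      ⟨j + 1, by omega, by simp, ?_, ?_⟩, ?_⟩
    · rw [hsj, List.map_append, ← List.append_assoc]
      exact ⟨by simpa using hL₁.last, hL₁.letter, hL₁.kind⟩
    · omega
    · simp
      omega
  · rintro t m' ⟨⟨c, ⟨j, hj, r8, hL', hc⟩, he, ht⟩, hf⟩
    have r1 := hf.reg 1 (by decide)
    have r7 := hf.reg 7 (by decide)
    simp [hr1] at r1 r7
    simp [r8, r1] at he
    obtain rfl : j = us.length := by omega
    rw [htextT] at hL'
    simp at ht
    exact ⟨by omega, hL', by rw [r7, hL.last]⟩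

end Layout

end WordRAM

/-! ### The complete program -/

namespace WordRAM

open WordTrie Program WordRAM.Expr

/-- The word `T` is the concatenation of a proper suffix of a word of `vs`, of words of `vs`, and of
a proper prefix of a word of `vs`, where the suffix and the prefix are not both empty. -/
def Interfered (vs : List (List ℕ)) (T : List ℕ) : Prop :=
  ∃ x y z : List ℕ, T = x ++ y ++ z ∧ (∃ v ∈ vs, x <:+ v ∧ x ≠ v) ∧
    (∃ X : List (List ℕ), (∀ x ∈ X, x ∈ vs) ∧ y = X.flatten) ∧
    (∃ v ∈ vs, z <+: v ∧ z ≠ v) ∧ x ++ z ≠ []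

section Interfered

variable {V : Set (List ℕ)} {B : List ℕ → Prop} {vs : List (List ℕ)} {g T : List ℕ}

theorem extends_iff_exists_flatten :
    Extends V B g ↔ ∃ x, B x ∧ ∃ X : List (List ℕ), (∀ v ∈ X, v ∈ V) ∧ g = x ++ X.flatten := by
  constructor
  · intro h
    induction h with
    | base h => exact ⟨_, h, [], by simp, by simp⟩
    | @append g v _ hv ih =>
      obtain ⟨x, hx, X, hX, rfl⟩ := ih
      refine ⟨x, hx, X ++ [v], ?_, by simp⟩
      simp only [List.mem_append, List.mem_singleton]
      rintro v (h | rfl)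
      · exact hX v h
      · exact hv
  · rintro ⟨x, hx, X, hX, rfl⟩
    induction X using List.reverseRecOn with
    | nil => simpa using .base hx
    | append_singleton X v ih =>
      rw [List.flatten_append, ← List.append_assoc]
      simpa using (ih fun v hv => hX v (by simp [hv])).append (hX v (by simp))

/-- A nonempty proper suffix of a word of `vs`. -/
def IsProperSuffixOf (vs : List (List ℕ)) (x : List ℕ) : Prop :=
  x ≠ [] ∧ ∃ v ∈ vs, x <:+ v ∧ x ≠ v

/-- The cases are: `z` empty, so that `x` is not; `z` nonempty and `x` empty; both nonempty.
Conversely an empty `x` or `z` must be a proper suffix or prefix of some image, and any image serves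
because it is not empty. -/
theorem interfered_iff (hvs : [] ∉ vs) (hne : vs ≠ []) : Interfered vs T ↔
    Extends {v | v ∈ vs} (IsProperSuffixOf vs) T ∨ ∃ f, (∃ v ∈ vs, f <+: v ∧ f ≠ v) ∧ f ≠ [] ∧
      f <:+ T ∧ (Extends {v | v ∈ vs} (· = []) (T.take (T.length - f.length)) ∨
        Extends {v | v ∈ vs} (IsProperSuffixOf vs) (T.take (T.length - f.length))) := by
  obtain ⟨v₀, hv₀⟩ := List.exists_mem_of_ne_nil _ hne
  have hv₀' : [] ≠ v₀ := fun h => hvs (h ▸ hv₀)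
  constructor
  · rintro ⟨x, y, z, rfl, hx, ⟨X, hX, rfl⟩, hz, hxz⟩
    by_cases hz0 : z = []
    · subst hz0
      refine Or.inl (extends_iff_exists_flatten.2 ⟨x, ⟨by simpa using hxz, hx⟩, X, hX, by simp⟩)
    · refine Or.inr ⟨z, hz, hz0, List.suffix_append _ _, ?_⟩
      rw [List.length_append, Nat.add_sub_cancel, List.take_left]
      by_cases hx0 : x = []
      · exact Or.inl (extends_iff_exists_flatten.2 ⟨x, hx0, X, hX, rfl⟩)
      · exact Or.inr (extends_iff_exists_flatten.2 ⟨x, ⟨hx0, hx⟩, X, hX, rfl⟩)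
  · rintro (h | ⟨z, hz, hz0, ⟨t, rfl⟩, h⟩)
    · obtain ⟨x, ⟨hx0, hx⟩, X, hX, rfl⟩ := extends_iff_exists_flatten.1 h
      exact ⟨x, X.flatten, [], by simp, hx, ⟨X, hX, rfl⟩, ⟨v₀, hv₀, List.nil_prefix, hv₀'⟩,
        by simpa using hx0⟩
    · rw [List.length_append, Nat.add_sub_cancel, List.take_left] at h
      rcases h with h | h
      · obtain ⟨x, rfl, X, hX, rfl⟩ := extends_iff_exists_flatten.1 h
        exact ⟨[], X.flatten, z, by simp, ⟨v₀, hv₀, List.nil_suffix, hv₀'⟩, ⟨X, hX, rfl⟩, hz,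
          by simpa using hz0⟩
      · obtain ⟨x, ⟨-, hx⟩, X, hX, rfl⟩ := extends_iff_exists_flatten.1 h
        exact ⟨x, X.flatten, z, rfl, hx, ⟨X, hX, rfl⟩, hz, by simp [hz0]⟩

theorem exists_suffixMark_iff {j : ℕ} (h1 : 1 ≤ j) (hj : j ≤ T.length) :
    (∃ v ∈ vs, SuffixMark (letterAt (layout vs T)) (kindAt (layout vs T)) v j) ↔
      IsProperSuffixOf vs (T.take j) := by
  have h0 : T.take j ≠ [] := by
    intro h
    have := congrArg List.length h
    rw [List.length_take, List.length_nil] at this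
    omega
  constructor
  · rintro ⟨v, hv, f, hf, -, hs, hne, rfl⟩
    rw [mem_textPrefixes_layout] at hf
    rw [← List.prefix_iff_eq_take.1 hf.2]
    exact ⟨hf.1, v, hv, hs, hne⟩
  · rintro ⟨-, v, hv, hs, hne⟩
    exact ⟨v, hv, T.take j, mem_textPrefixes_layout.2 ⟨h0, List.take_prefix _ _⟩, h0, hs, hne,
      by simp [hj]⟩

end Interfered

/-- Decide whether the morphism is interference-free on the word. -/
def decideInterferenceFree : Program := cond (reg 1)
  (block [layoutImages, layoutText, buildTrie, markNodes, visitAll, examineImages,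
    factorizePrefixes, answer])
  (assign 0 (lit 1))

/-- The memory holds the images `vs` and the word `us` of numbers of images. -/
structure Input (vs : List (List ℕ)) (us : List ℕ) (m : Mem) : Prop where
  numImages : m.reg 0 = vs.length
  length : m.reg 1 = us.length
  reg : ∀ i, i ≠ 0 → i ≠ 1 → m.reg i = 0
  letters : ∀ i, m.cell 0 i = vs.flatten.getD i 0
  lengths : ∀ i, m.cell 1 i = (vs.getD i []).length
  word : ∀ i, m.cell 2 i = us.getD i 0
  cell : ∀ j i, 3 ≤ j → m.cell j i = 0
  drawn : m.drawn = 0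

section Decide

variable {w : ℕ} {ω : ℕ → BitVec w} {m : Mem} {vs : List (List ℕ)} {us T : List ℕ}

/-- The frame conditions carry each array from the stage that fills it to the stages that read it.
In the time bound only the first sum depends on the tape; the last one counts the occurrences of
images. -/
theorem runs_decideInterferenceFree_of_ne_nil (hw : 0 < w) (hm : Input vs us m) (hu : us ≠ [])
    (hvs : [] ∉ vs) (hus : ∀ c ∈ us, c < vs.length) (hT : T = us.flatMap fun c => vs.getD c [])
    {z : ℕ} (hz : z = (layout vs T).length) (hzW : 2 * z + 2 < 2 ^ w) {a kind : ℕ → ℕ}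
    (ha : a = letterAt (layout vs T)) (hk : kind = kindAt (layout vs T)) :
    Runs ω decideInterferenceFree m fun t m' =>
      t ≤ 300 + 900 * z + ∑ i ∈ Finset.Ico 1 (z + 1),
          (12 * coll a kind (fun i => (ω i).toNat) (z + 1) (rep a kind (i - 1)) (a i) +
            visitCost a kind (fun i => (ω i).toNat) z i) +
        60 * ∑ j ∈ Finset.Ico 1 (T.length + 1), suffixCount {v | v ∈ vs} (T.take j) ∧
      (¬ Interfered vs T ∧ (¬ ∃ v ∈ vs, IsInner T v) → m'.reg 0 = 1) ∧
      (¬ (¬ Interfered vs T ∧ ¬ ∃ v ∈ vs, IsInner T v) → m'.reg 0 = 0) := by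
  have hV : {v | v ∈ vs} = imageWords a kind := by
    ext v
    rw [ha, hk, mem_imageWords_layout hvs]
    rfl
  have hV' : ∀ v, v ∈ imageWords a kind ↔ v ∈ vs := fun v => by rw [← hV]; rfl
  have hlen := length_layout (vs := vs) (T := T)
  have hlenI := length_imageLayout (vs := vs)
  have hoff : offset vs vs.length = vs.flatten.length := by rw [offset, List.take_length]
  -- No image is empty. This keeps the rounds of `layoutText` within `z` and, with `2 * z + 2 < 2 ^
  -- w`, gives its overflow condition.
  have husT : us.length ≤ T.length := by
    rw [hT, List.length_flatMap]
    refine (List.length_map (as := us) _).symm.le.trans (List.length_le_sum_of_one_le _ ?_)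
    simp only [List.mem_map]
    rintro _ ⟨c, hc, rfl⟩
    rw [Nat.one_le_iff_ne_zero, ne_eq, List.length_eq_zero_iff]
    intro h
    rw [List.getD_eq_getElem _ _ (hus c hc)] at h
    exact hvs (h ▸ List.getElem_mem _)
  have hu0 := List.length_pos_iff.2 hu
  have hT0 : T ≠ [] := List.length_pos_iff.1 (by omega)
  have hzT : word a kind z = T := by
    rw [ha, hk, hz, layout, List.length_append, List.length_map]
    simpa [layout] using word_text (vs := vs) (T := T) le_rfl
  have hTin : InTrie a kind T := ⟨z, hzT⟩
  have hkz : ∀ i, z < i → kind i = 0 := fun i hi => by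
    rw [hk, kindAt_of_length_lt (by omega)]
  have hk0 : kind 0 = 0 := by rw [hk]; rfl
  refine Runs.cond hw trivial (fun _ => ?_) (fun h => ?_)
  swap
  · simp only [Expr.val, hm.length] at h
    omega
  simp only [block]
  -- the layout of the images
  refine Runs.seq ((((runs_layoutImages hw hm.numImages hm.letters hm.lengths (hm.reg 3 (by decide)
    (by decide)) (hm.reg 8 (by decide) (by decide)) ⟨?_, ?_, ?_⟩ ?_).drawn ?_).frame).mono ?_)
  · exact hm.reg 4 (by decide) (by decide)
  · funext i
    rw [hm.cell 4 i (by decide)]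
    cases i <;> rfl
  · funext i
    rw [hm.cell 5 i (by decide)]
    cases i <;> rfl
  · omega
  · simp [layoutImages, copyWord, Program.Deterministic]
  rintro t₁ m₁ ⟨⟨⟨ht₁, hL₁, h3₁⟩, hd₁⟩, hf₁⟩
  -- the layout of the text
  refine Runs.seq ((((runs_layoutText (T := T) (vs := vs) (us := us) (L := imageLayout vs) hw hus
    ?_ ?_ ?_ ?_ h3₁ hL₁ hT ?_).drawn ?_).frame).mono ?_)
  · rw [hf₁.reg 1 (by decide), hm.length]
  · rw [hf₁.cell 0 (by decide)]
    exact hm.letters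
  · rw [hf₁.cell 1 (by decide)]
    exact hm.lengths
  · rw [hf₁.cell 2 (by decide)]
    exact hm.word
  · omega
  · simp [layoutText, copyWord, Program.Deterministic]
  rintro t₂ m₂ ⟨⟨⟨ht₂, hL₂, h7₂⟩, hd₂⟩, hf₂⟩
  rw [show imageLayout vs ++ T.map (·, 2) = layout vs T from rfl] at hL₂
  have hr4 : m₂.reg 4 = z := by rw [hL₂.last, hz]
  have hz₂ : ∀ j, 6 ≤ j → ∀ i, m₂.cell j i = 0 := fun j hj i => by
    rw [hf₂.cell j ?_, hf₁.cell j ?_, hm.cell j i (by omega)]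
    all_goals
      simp [layoutText, layoutImages, copyWord, Program.arrays]
      omega
  -- the trie
  refine Runs.seq ((runs_buildTrie (a := a) (kind := kind) (z := z) hw hr4 (by omega) ?_ ?_ ?_
    ?_).frame.mono ?_)
  · intro i _ _
    rw [hL₂.letter, ha]
  · intro i _
    rw [hL₂.kind, hk]
  · rw [hd₂, hd₁, hm.drawn]
  · intro j hj
    exact hz₂ j (by revert j; decide)
  rintro t₃ m₃ ⟨⟨ht₃, hm₃⟩, hf₃⟩
  have hr4₃ : m₃.reg 4 = z := by rw [hf₃.reg 4 (by decide), hr4]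
  have h7₃ : ∀ g, InTrie a kind g → g ≠ [] → m₃.cell 7 (node a kind g) = g.length := by
    intro g hg hg0
    have := node_le_of_kind (a := a) (g := g) hkz
    rw [hm₃.depth _ (by omega) (isRep_node hg hg0), word_node hg]
  have h6₃ : ∀ i ≤ z, m₃.cell 6 i = rep a kind i := fun i hi => hm₃.rep i (by omega)
  have h5₃ : ∀ i, m₃.cell 5 i = kind i := fun i => by
    rw [hf₃.cell 5 (by decide), hL₂.kind, hk]
  have h4₃ : ∀ i, m₃.cell 4 i = a i := fun i => by
    rw [hf₃.cell 4 (by decide), hL₂.letter, ha]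
  -- the marks
  refine Runs.seq ((runs_markNodes (a := a) (kind := kind) (z := z) hw hkz hk0 (by omega) hr4₃
    (fun i _ => h5₃ i) h6₃ ?_).frame.mono ?_)
  · intro j hj i
    have hj' : j ∉ buildTrie.arrays := by revert j; decide
    rw [hf₃.cell j hj']
    exact hz₂ j (by revert j; decide) i
  rintro t₄ m₄ ⟨⟨ht₄, hm₄⟩, hf₄⟩
  -- the failure links
  refine Runs.seq (((hm₃.congr (m' := m₄) ?_).runs_visitAll (z := z) hw hkz (by omega) hT0 hzT
    ?_ ?_ ?_ ?_).frame.mono ?_)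
  · intro i hi
    exact hf₄.cell i (by revert i; decide)
  · intro i _ _
    rw [hf₄.cell 4 (by decide), h4₃]
  · rw [hf₄.reg 4 (by decide), hr4₃]
  · exact fun g hg => (hm₄ g hg).1
  · intro j hj
    have hj' : j ∉ markNodes.arrays := by revert j; decide
    have hj'' : j ∉ buildTrie.arrays := by revert j; decide
    rw [hf₄.cell j hj', hf₃.cell j hj'']
    exact hz₂ j (by revert j; decide) 0
  rintro t₅ m₅ ⟨⟨ht₅, h22₅, hvis⟩, hf₅⟩
  -- the images
  refine Runs.seq ((runs_examineImages (a := a) (kind := kind) (T := T) (z := z) hw hkz hk0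
    (by omega) ?_ ?_ ?_ ?_ ?_ hvis ?_ ?_).frame.mono ?_)
  · rw [hf₅.reg 4 (by decide), hf₄.reg 4 (by decide), hr4₃]
  · intro i _
    rw [hf₅.cell 5 (by decide), hf₄.cell 5 (by decide), h5₃]
  · rw [hf₅.cell 6 (by decide), hf₄.cell 6 (by decide)]
    exact h6₃
  · rw [hf₅.cell 7 (by decide), hf₄.cell 7 (by decide)]
    exact h7₃
  · rw [hf₅.cell 14 (by decide)]
    exact fun g hg => (hm₄ g hg).2.2
  · rw [hf₅.reg 17 (by decide), hf₄.reg 17 (by decide), hf₃.reg 17 (by decide),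
      hf₂.reg 17 (by decide), hf₁.reg 17 (by decide), hm.reg 17 (by decide) (by decide)]
  · rw [hf₅.cell 21 (by decide), hf₄.cell 21 (by decide), hf₃.cell 21 (by decide)]
    exact hz₂ 21 (by decide)
  rintro t₆ m₆ ⟨⟨ht₆, h17₆, h21₆⟩, hf₆⟩
  have c7 : ∀ g, InTrie a kind g → g ≠ [] → m₆.cell 7 (node a kind g) = g.length := by
    rw [hf₆.cell 7 (by decide), hf₅.cell 7 (by decide), hf₄.cell 7 (by decide)]
    exact h7₃
  have c16 : ∀ g, InTrie a kind g → m₆.cell 16 (node a kind g) = node a kind (fail a kind g) := by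
    rw [hf₆.cell 16 (by decide)]
    exact fun g hg => (hvis g hg).fail
  -- the factorizations of the prefixes of the text
  refine Runs.seq ((runs_factorizePrefixes (a := a) (kind := kind) (z₀ := (imageLayout vs).length)
    (T := T) (B := IsProperSuffixOf vs) hw hV hvs (by omega) ?_ ?_ ?_ ?_ c7 c16 ?_ ?_ ?_ ?_
    ?_).frame.mono ?_)
  · rw [hf₆.reg 4 (by decide), hf₅.reg 4 (by decide), hf₄.reg 4 (by decide), hr4₃]
    omega
  · rw [hf₆.reg 7 (by decide), hf₅.reg 7 (by decide), hf₄.reg 7 (by decide),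
      hf₃.reg 7 (by decide), h7₂]
  · intro j hj
    rw [ha, hk, word_text hj]
  · intro j hj
    rw [hf₆.cell 6 (by decide), hf₅.cell 6 (by decide), hf₄.cell 6 (by decide), h6₃ _ (by omega)]
  · rw [hf₆.cell 17 (by decide), hV]
    exact fun g hg => (hvis g hg).image
  · exact fun h => h.1 rfl
  · intro j h1 hj
    rw [h21₆, ← exists_suffixMark_iff h1 hj, ha, hk]
    simp only [mem_imageWords_layout hvs]
  · rw [hf₆.cell 22 (by decide), hf₅.cell 22 (by decide), hf₄.cell 22 (by decide),
      hf₃.cell 22 (by decide)]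
    exact hz₂ 22 (by decide)
  · rw [hf₆.cell 23 (by decide), hf₅.cell 23 (by decide), hf₄.cell 23 (by decide),
      hf₃.cell 23 (by decide)]
    exact hz₂ 23 (by decide)
  rintro t₇ m₇ ⟨⟨ht₇, h24₇, hm₇⟩, hf₇⟩
  -- the answer
  refine (runs_answer (a := a) (kind := kind) (T := T)
    (p := ¬ Interfered vs T ∧ ¬ ∃ v ∈ vs, IsInner T v) hw hTin ?_ h24₇ ?_ ?_ ?_ ?_).mono ?_
  · rw [hf₇.reg 22 (by decide), hf₆.reg 22 (by decide), h22₅]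
  · rw [hf₇.cell 7 (by decide)]
    exact c7
  · rw [hf₇.cell 13 (by decide), hf₆.cell 13 (by decide), hf₅.cell 13 (by decide)]
    exact fun g hg => (hm₄ g hg).2.1
  · rw [hf₇.cell 16 (by decide)]
    exact c16
  · refine and_congr (not_congr ?_) (not_congr ?_)
    · rw [interfered_iff hvs (by rintro rfl; exact absurd (hus _ (List.head_mem hu)) (by simp)),
        (hm₇ _ le_rfl).2, List.take_length]
      refine or_congr_right (exists_congr fun f => ?_)
      rw [ha, hk, mem_imagePrefixes_layout, (hm₇ _ (Nat.sub_le _ _)).1, (hm₇ _ (Nat.sub_le _ _)).2]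
    · rw [hf₇.reg 17 (by decide), h17₆]
      simp only [hV']
  rintro t₈ m₈ ⟨ht₈, hm₈⟩
  refine ⟨?_, hm₈⟩
  have e1 : ∀ f : ℕ → ℕ, ∑ i ∈ Finset.Ico 1 (z + 1), (120 + f i) =
      120 * z + ∑ i ∈ Finset.Ico 1 (z + 1), f i := fun f => by
    rw [Finset.sum_add_distrib]
    simp [mul_comm]
  rw [e1] at ht₃ ht₅
  rw [Finset.sum_add_distrib, ← Finset.mul_sum, Finset.sum_const, Nat.card_Ico, smul_eq_mul] at ht₇
  rw [Finset.sum_add_distrib]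
  simp only [Expr.cost]
  omega

end Decide

end WordRAM

/-! ### The expected number of collisions -/

namespace WordRAM

open WordTrie MeasureTheory

section Tape

variable {w : ℕ}

instance : IsProbabilityMeasure (tapeLaw w) := by
  unfold tapeLaw
  infer_instance

/-- Given the word `y` at `j`, at most one word at `i` satisfies the equation, because the exclusive
or with `c` is injective. The event is thus covered by `2 ^ w` cylinders, each of measure at most `2
^ w * 2 ^ w` inverted. -/
theorem tapeLaw_xor_le {i j : ℕ} (hij : i ≠ j) (c d : ℕ) :
    tapeLaw w {ω | (ω i).toNat ^^^ c = (ω j).toNat ^^^ d} ≤ (2 ^ w : ℝ≥0∞)⁻¹ := by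
  classical
  have hcard : Fintype.card (BitVec w) = 2 ^ w := by
    rw [Fintype.card_congr BitVec.equivFin.toEquiv, Fintype.card_fin]
  let t (y : BitVec w) (k : ℕ) : Set (BitVec w) :=
    if k = i then {x | x.toNat ^^^ c = y.toNat ^^^ d} else {y}
  have ht : ∀ y k, (t y k).Subsingleton := by
    intro y k
    simp only [t]
    split_ifs
    · intro x hx x' hx'
      exact BitVec.eq_of_toNat_eq (Nat.xor_left_inj.1 (hx.trans hx'.symm))
    · exact Set.subsingleton_singleton
  have hμ : ∀ s : Set (BitVec w), s.Subsingleton →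
      (PMF.uniformOfFintype (BitVec w)).toMeasure s ≤ (2 ^ w : ℝ≥0∞)⁻¹ := by
    intro s hs
    rcases hs.eq_empty_or_singleton with rfl | ⟨x, rfl⟩
    · simp
    · rw [PMF.toMeasure_apply_singleton _ _ (MeasurableSet.singleton x)]
      simp [hcard]
  have hsub : {ω : ℕ → BitVec w | (ω i).toNat ^^^ c = (ω j).toNat ^^^ d} ⊆
      ⋃ y, Set.pi (({i, j} : Finset ℕ) : Set ℕ) (t y) := by
    intro ω hω
    refine Set.mem_iUnion.2 ⟨ω j, fun k hk => ?_⟩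
    simp only [Finset.coe_insert, Finset.coe_singleton, Set.mem_insert_iff,
      Set.mem_singleton_iff] at hk
    simp only [t]
    split_ifs with h
    · subst h
      exact hω
    · rw [hk.resolve_left h]
      rfl
  refine (measure_mono hsub).trans ((measure_iUnion_le _).trans ?_)
  rw [tsum_fintype]
  calc ∑ y, tapeLaw w (Set.pi (({i, j} : Finset ℕ) : Set ℕ) (t y))
      ≤ ∑ _y : BitVec w, (2 ^ w : ℝ≥0∞)⁻¹ * (2 ^ w : ℝ≥0∞)⁻¹ := by
        refine Finset.sum_le_sum fun y _ => ?_
        rw [tapeLaw, Measure.infinitePi_pi _ fun _ _ => MeasurableSpace.measurableSet_top,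
          Finset.prod_pair hij]
        exact mul_le_mul' (hμ _ (ht y i)) (hμ _ (ht y j))
    _ = (2 ^ w : ℝ≥0∞)⁻¹ := by
        rw [Finset.sum_const, Finset.card_univ, hcard, nsmul_eq_mul, ← mul_assoc]
        push_cast
        rw [ENNReal.mul_inv_cancel (by simp) (by simp), one_mul]

variable {a kind : ℕ → ℕ} {b x c z : ℕ}

theorem coll_eq_sum (rnd : ℕ → ℕ) : coll a kind rnd b x c =
    ∑ v ∈ Finset.range b, if rep a kind (v - 1) ≠ x ∧ hash a kind rnd v = rnd x ^^^ c
      then 1 else 0 := by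
  classical
  rw [coll, Finset.card_filter]

theorem measurableSet_collision (v : ℕ) : MeasurableSet {ω : ℕ → BitVec w |
    rep a kind (v - 1) ≠ x ∧ hash a kind (fun i => (ω i).toNat) v = (ω x).toNat ^^^ c} := by
  have h (i : ℕ) : Measurable fun ω : ℕ → BitVec w => (ω i).toNat :=
    (measurable_from_top (f := BitVec.toNat)).comp (measurable_pi_apply i)
  refine (MeasurableSet.const _).inter (measurableSet_eq_fun ?_ ?_)
  · exact (measurable_from_top (f := fun n : ℕ => n ^^^ a v)).comp (h _)
  · exact (measurable_from_top (f := fun n : ℕ => n ^^^ c)).comp (h _)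

theorem measurable_coll : Measurable fun ω : ℕ → BitVec w =>
    coll a kind (fun i => (ω i).toNat) b x c := by
  classical
  simp only [coll_eq_sum]
  exact Finset.measurable_sum _ fun v _ =>
    Measurable.ite (measurableSet_collision v) measurable_const measurable_const

/-- At most `2 ^ w` positions are counted, each with probability at most the inverse of `2 ^ w`: by
the definition of `coll` their parents differ from `x`, so two independent masks are compared, and
both indices are fixed independently of the tape. -/
theorem lintegral_coll_le (hb : b ≤ 2 ^ w) :
    ∫⁻ ω, (coll a kind (fun i => (ω i).toNat) b x c : ℝ≥0∞) ∂(tapeLaw w) ≤ 1 := by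
  classical
  simp only [coll_eq_sum, Nat.cast_sum, Nat.cast_ite, Nat.cast_one, Nat.cast_zero]
  rw [lintegral_finsetSum _ fun v _ =>
    Measurable.ite (measurableSet_collision v) measurable_const measurable_const]
  calc _ ≤ ∑ _v ∈ Finset.range b, (2 ^ w : ℝ≥0∞)⁻¹ := by
        refine Finset.sum_le_sum fun v _ => ?_
        have := lintegral_indicator_one (μ := tapeLaw w)
          (measurableSet_collision (w := w) (a := a) (kind := kind) (x := x) (c := c) v)
        simp only [Set.indicator_apply, Pi.one_apply] at this
        refine this.trans_le ?_
        by_cases hx : rep a kind (v - 1) = x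
        · simp [hx]
        · exact (measure_mono fun ω hω => hω.2).trans (tapeLaw_xor_le hx (a v) c)
    _ ≤ 1 := by
        rw [Finset.sum_const, Finset.card_range, nsmul_eq_mul]
        refine (mul_le_mul_left (by exact_mod_cast hb : (b : ℝ≥0∞) ≤ 2 ^ w) _).trans ?_
        rw [ENNReal.mul_inv_cancel (by simp) (by simp)]

/-- The lookups of all searches for failure links are linearly many. -/
theorem sum_card_searches_le (z : ℕ) : ∑ i ∈ Finset.Ico 1 (z + 1),
    ((fail a kind (word a kind (i - 1))).length + 1 - ((fail a kind (word a kind i)).length - 1)) +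
      (fail a kind (word a kind z)).length ≤ 2 * z := by
  -- The extra summand, the length of the current failure word, is the potential that makes the
  -- induction work. It rises by at most one per letter and drops to zero at a blank.
  induction z with
  | zero => simp [word, fail_nil]
  | succ z ih =>
    rw [Finset.sum_Ico_succ_top (by omega)]
    have : (fail a kind (word a kind (z + 1))).length ≤
        (fail a kind (word a kind z)).length + 1 := by
      rw [word]
      split_ifs
      · simp [fail_nil]
      · exact length_fail_append_le _ _
    simp only [Nat.add_sub_cancel]
    omega

theorem measurable_visitCost (i : ℕ) : Measurable fun ω : ℕ → BitVec w =>
    visitCost a kind (fun i => (ω i).toNat) z i := by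
  unfold visitCost searchCost
  exact Finset.measurable_sum _ fun l _ => (measurable_coll.const_mul _).const_add _

/-- A lookup in a search costs 60 steps and 12 per collision, of which at most one is expected: 72
together. The range of lookups does not depend on the tape. -/
theorem lintegral_visitCost_le (hz : z + 1 ≤ 2 ^ w) (i : ℕ) :
    ∫⁻ ω, (visitCost a kind (fun i => (ω i).toNat) z i : ℝ≥0∞) ∂(tapeLaw w) ≤
      72 * (((fail a kind (word a kind (i - 1))).length + 1 -
        ((fail a kind (word a kind i)).length - 1) : ℕ) : ℝ≥0∞) := by
  have hm (x c : ℕ) : Measurable fun ω : ℕ → BitVec w =>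
      (coll a kind (fun i => (ω i).toNat) (z + 1) x c : ℝ≥0∞) :=
    measurable_from_top.comp measurable_coll
  simp only [visitCost, searchCost, Nat.cast_sum, Nat.cast_add, Nat.cast_mul, Nat.cast_ofNat]
  rw [lintegral_finsetSum _ fun l _ => ((hm _ _).const_mul _).const_add _]
  refine (Finset.sum_le_card_nsmul _ _ 72 fun l _ => ?_).trans_eq ?_
  · rw [lintegral_add_left measurable_const, lintegral_const_mul _ (hm _ _)]
    simp only [lintegral_const, measure_univ, mul_one]
    refine (add_le_add_right (mul_le_mul_right (lintegral_coll_le hz) _) _).trans ?_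
    norm_num
  · rw [Nat.card_Ico, nsmul_eq_mul, mul_comm]

/-- The constant is 12 for the insertion at each position plus 72 for each lookup in a search, of
which `sum_card_searches_le` allows two per position: `12 + 2 * 72 = 156`. -/
theorem lintegral_cost_le (hz : z + 1 ≤ 2 ^ w) (y : ℕ → ℕ) :
    ∫⁻ ω, ((∑ i ∈ Finset.Ico 1 (z + 1),
      (12 * coll a kind (fun i => (ω i).toNat) (z + 1) (y i) (a i) +
        visitCost a kind (fun i => (ω i).toNat) z i) : ℕ) : ℝ≥0∞) ∂(tapeLaw w) ≤
      ((156 * z : ℕ) : ℝ≥0∞) := by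
  have hm (x c : ℕ) : Measurable fun ω : ℕ → BitVec w =>
      (coll a kind (fun i => (ω i).toNat) (z + 1) x c : ℝ≥0∞) :=
    measurable_from_top.comp measurable_coll
  have hm' (i : ℕ) : Measurable fun ω : ℕ → BitVec w =>
      (visitCost a kind (fun i => (ω i).toNat) z i : ℝ≥0∞) :=
    measurable_from_top.comp (measurable_visitCost i)
  simp only [Nat.cast_sum, Nat.cast_add, Nat.cast_mul, Nat.cast_ofNat]
  rw [lintegral_finsetSum]
  swap
  · exact fun i _ => Measurable.add ((hm (y i) (a i)).const_mul 12) (hm' i)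
  calc _ ≤ ∑ i ∈ Finset.Ico 1 (z + 1), ((12 + 72 *
        ((fail a kind (word a kind (i - 1))).length + 1 -
          ((fail a kind (word a kind i)).length - 1)) : ℕ) : ℝ≥0∞) := by
        refine Finset.sum_le_sum fun i _ => ?_
        rw [lintegral_add_left ((hm _ _).const_mul _), lintegral_const_mul _ (hm _ _)]
        push_cast
        refine add_le_add ?_ (by exact_mod_cast lintegral_visitCost_le hz i)
        exact (mul_le_mul_right (lintegral_coll_le hz) _).trans_eq (mul_one _)
    _ ≤ _ := by
        rw [← Nat.cast_sum]
        suffices h : _ ≤ 156 * z from (Nat.cast_le.2 h).trans_eq (by push_cast; rfl)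
        rw [Finset.sum_add_distrib, ← Finset.mul_sum, Finset.sum_const, Nat.card_Ico, smul_eq_mul]
        have := sum_card_searches_le (a := a) (kind := kind) z
        omega

end Tape

end WordRAM

/-! ### Encoding morphisms by lists of numbers -/

namespace WordRAM

open WordTrie WordMorphism MeasureTheory

section Encoding

variable {A B : Type*}

/-- The list of the codes of the letters of a word. -/
def encode (e : B → ℕ) (x : FreeMonoid B) : List ℕ := x.toList.map e

/-- The list of the encoded images of a morphism. -/
def encodeImages {σ : ℕ} (num : A ≃ Fin σ) (e : B → ℕ) (φ : FreeMonoid A →* FreeMonoid B) :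
    List (List ℕ) := List.ofFn fun k => encode e (φ (FreeMonoid.of (num.symm k)))

variable {e : B → ℕ} {φ : FreeMonoid A →* FreeMonoid B} {vs : List (List ℕ)} {x y : FreeMonoid B}

@[simp] theorem encode_mul : encode e (x * y) = encode e x ++ encode e y := by
  simp [encode]

@[simp] theorem encode_one : encode e (1 : FreeMonoid B) = [] := rfl

@[simp] theorem length_encode : (encode e x).length = x.length := List.length_map _

theorem encode_prod (X : List (FreeMonoid B)) : encode e X.prod = (X.map (encode e)).flatten := by
  induction X with
  | nil => rfl
  | cons x X ih => simp [ih]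

theorem encode_injective (he : Function.Injective e) : Function.Injective (encode e) :=
  fun _ _ h => FreeMonoid.toList.injective (List.map_injective_iff.2 he h)

theorem encode_eq_nil_iff : encode e x = [] ↔ x = 1 := by
  rw [← List.length_eq_zero_iff, length_encode, FreeMonoid.length_eq_zero]

theorem encode_prefix_iff (he : Function.Injective e) :
    encode e x <+: encode e y ↔ x.toList <+: y.toList := List.prefix_map_iff_of_injective he

theorem encode_suffix_iff (he : Function.Injective e) :
    encode e x <:+ encode e y ↔ x.toList <:+ y.toList := List.suffix_map_iff_of_injective he

theorem encode_infix_iff (he : Function.Injective e) :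
    encode e x <:+: encode e y ↔ x.toList <:+: y.toList := by
  constructor
  · intro h
    obtain ⟨l, hl, h⟩ := List.infix_map_iff.1 h
    rwa [List.map_injective_iff.2 he h]
  · exact fun h => h.map e

/-- The list consists of the encoded images. -/
def IsImageList (e : B → ℕ) (φ : FreeMonoid A →* FreeMonoid B) (vs : List (List ℕ)) : Prop :=
  ∀ l, l ∈ vs ↔ ∃ v ∈ images φ, encode e v = l

theorem exists_properSuffix_iff (he : Function.Injective e) (hvs : IsImageList e φ vs)
    {l : List ℕ} : (∃ v ∈ vs, l <:+ v ∧ l ≠ v) ↔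
      ∃ x, encode e x = l ∧ ∃ v ∈ images φ, IsProperSuffix x v := by
  constructor
  · rintro ⟨v, hv, hs, hne⟩
    obtain ⟨v, hv', rfl⟩ := (hvs v).1 hv
    obtain ⟨x, hx, rfl⟩ := List.suffix_map_iff.1 hs
    exact ⟨FreeMonoid.ofList x, rfl, v, hv', hx, by rintro rfl; exact hne rfl⟩
  · rintro ⟨x, rfl, v, hv, hs, hne⟩
    exact ⟨_, (hvs _).2 ⟨v, hv, rfl⟩, (encode_suffix_iff he).2 hs, (encode_injective he).ne hne⟩

theorem exists_properPrefix_iff (he : Function.Injective e) (hvs : IsImageList e φ vs)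
    {l : List ℕ} : (∃ v ∈ vs, l <+: v ∧ l ≠ v) ↔
      ∃ x, encode e x = l ∧ ∃ v ∈ images φ, IsProperPrefix x v := by
  constructor
  · rintro ⟨v, hv, hs, hne⟩
    obtain ⟨v, hv', rfl⟩ := (hvs v).1 hv
    obtain ⟨x, hx, rfl⟩ := List.prefix_map_iff.1 hs
    exact ⟨FreeMonoid.ofList x, rfl, v, hv', hx, by rintro rfl; exact hne rfl⟩
  · rintro ⟨x, rfl, v, hv, hs, hne⟩
    exact ⟨_, (hvs _).2 ⟨v, hv, rfl⟩, (encode_prefix_iff he).2 hs, (encode_injective he).ne hne⟩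

theorem exists_flatten_iff (hvs : IsImageList e φ vs) {l : List ℕ} :
    (∃ X : List (List ℕ), (∀ x ∈ X, x ∈ vs) ∧ l = X.flatten) ↔
      ∃ y, encode e y = l ∧ HasImageFactorization φ y := by
  constructor
  · rintro ⟨X, hX, rfl⟩
    have : ∃ Y : List (FreeMonoid B), (∀ y ∈ Y, y ∈ images φ) ∧ Y.map (encode e) = X := by
      induction X with
      | nil => exact ⟨[], by simp⟩
      | cons x X ih =>
        simp only [List.forall_mem_cons] at hX
        obtain ⟨Y, hY, rfl⟩ := ih hX.2
        obtain ⟨y, hy, rfl⟩ := (hvs x).1 hX.1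
        exact ⟨y :: Y, by simpa using ⟨hy, hY⟩, rfl⟩
    obtain ⟨Y, hY, rfl⟩ := this
    exact ⟨Y.prod, encode_prod Y, Y, hY, rfl⟩
  · rintro ⟨_, rfl, X, hX, rfl⟩
    refine ⟨X.map (encode e), ?_, encode_prod X⟩
    simp only [List.mem_map]
    rintro _ ⟨x, hx, rfl⟩
    exact (hvs _).2 ⟨x, hX x hx, rfl⟩

theorem interfered_encode_iff (he : Function.Injective e) (hvs : IsImageList e φ vs) :
    Interfered vs (encode e x) ↔ HasInterferedImageFactorization φ x := by
  constructor
  · rintro ⟨x', y', z', h, h1, h2, h3, h4⟩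
    obtain ⟨x', rfl, h1'⟩ := (exists_properSuffix_iff he hvs).1 h1
    obtain ⟨y', rfl, h2'⟩ := (exists_flatten_iff hvs).1 h2
    obtain ⟨z', rfl, h3'⟩ := (exists_properPrefix_iff he hvs).1 h3
    refine ⟨x', y', z', encode_injective he (by simpa using h), h1', h2', h3', ?_⟩
    rwa [← encode_mul, ne_eq, encode_eq_nil_iff] at h4
  · rintro ⟨x', y', z', rfl, h1, h2, h3, h4⟩
    refine ⟨encode e x', encode e y', encode e z', by simp,
      (exists_properSuffix_iff he hvs).2 ⟨_, rfl, h1⟩, (exists_flatten_iff hvs).2 ⟨_, rfl, h2⟩,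
      (exists_properPrefix_iff he hvs).2 ⟨_, rfl, h3⟩, ?_⟩
    rwa [← encode_mul, ne_eq, encode_eq_nil_iff]

/-- That the factor be proper need not be tested: a word equal to the image is a prefix of it. -/
theorem exists_isInner_encode_iff (he : Function.Injective e) (hvs : IsImageList e φ vs) :
    (∃ v ∈ vs, IsInner (encode e x) v) ↔ IsInnerImageFactor φ x := by
  constructor
  · rintro ⟨v, hv, h⟩
    obtain ⟨v, hv', rfl⟩ := (hvs v).1 hv
    rw [IsInner, encode_infix_iff he, encode_prefix_iff he, encode_suffix_iff he] at h
    exact ⟨v, hv', ⟨h.1, by rintro rfl; exact h.2.1 List.prefix_rfl⟩, h.2⟩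
  · rintro ⟨v, hv, h⟩
    refine ⟨_, (hvs _).2 ⟨v, hv, rfl⟩, ?_⟩
    rw [IsInner, encode_infix_iff he, encode_prefix_iff he, encode_suffix_iff he]
    exact ⟨h.1.1, h.2⟩

theorem toList_map_eq_flatMap (u : FreeMonoid A) :
    (φ u).toList = u.toList.flatMap fun c => (φ (FreeMonoid.of c)).toList := by
  induction u using FreeMonoid.recOn with
  | one => simp
  | of_mul c u h => simp [h]

section Numbering

variable {σ : ℕ} {num : A ≃ Fin σ}

theorem isImageList_encodeImages : IsImageList e φ (encodeImages num e φ) := by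
  intro l
  simp only [encodeImages, List.mem_ofFn, images, Set.exists_range_iff]
  exact num.symm.exists_congr_left.trans (by simp)

theorem length_encodeImages : (encodeImages num e φ).length = σ := List.length_ofFn

theorem getElem_encodeImages (k : Fin σ) (h : (k : ℕ) < (encodeImages num e φ).length) :
    (encodeImages num e φ)[(k : ℕ)] = encode e (φ (FreeMonoid.of (num.symm k))) := by
  simp [encodeImages]

theorem image_ne_one (hφ : Function.Injective φ) (c : A) : φ (FreeMonoid.of c) ≠ 1 := fun h =>
  FreeMonoid.of_ne_one c (hφ (h.trans (map_one φ).symm))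

theorem image_injective (hφ : Function.Injective φ) :
    Function.Injective fun c => φ (FreeMonoid.of c) := hφ.comp FreeMonoid.of_injective

theorem nil_notMem_encodeImages (hφ : Function.Injective φ) : [] ∉ encodeImages num e φ := by
  rw [encodeImages, List.mem_ofFn]
  rintro ⟨k, hk⟩
  exact image_ne_one hφ _ (encode_eq_nil_iff.1 hk)

theorem encode_map_eq_flatMap (u : FreeMonoid A) : encode e (φ u) =
    (u.toList.map fun c => (num c : ℕ)).flatMap fun k => (encodeImages num e φ).getD k [] := by
  rw [encode, toList_map_eq_flatMap, List.map_flatMap, List.flatMap_map]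
  refine List.flatMap_congr fun c _ => ?_
  rw [List.getD_eq_getElem _ _ (by rw [length_encodeImages]; exact (num c).isLt),
    getElem_encodeImages]
  simp [encode]

/-- Different letters have different images, so nothing is lost between the set of images in the
statement and the list in the input. -/
theorem finsum_images (hφ : Function.Injective φ) (num : A ≃ Fin σ) (f : FreeMonoid B → ℕ) :
    ∑ᶠ x ∈ images φ, f x = ∑ k, f (φ (FreeMonoid.of (num.symm k))) := by
  rw [images, finsum_mem_range (image_injective hφ), ← finsum_comp_equiv num.symm,
    finsum_eq_sum_of_fintype]

theorem length_flatten_encodeImages (hφ : Function.Injective φ) :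
    (encodeImages num e φ).flatten.length = totalLength φ := by
  rw [totalLength, finsum_images hφ num, List.length_flatten, encodeImages, List.map_ofFn,
    List.sum_ofFn]
  simp

theorem le_totalLength (hφ : Function.Injective φ) (num : A ≃ Fin σ) : σ ≤ totalLength φ := by
  rw [totalLength, finsum_images hφ num]
  refine le_trans (by simp) (Finset.sum_le_sum (f := fun _ => 1) fun k _ => ?_)
  rw [Nat.one_le_iff_ne_zero, ne_eq, FreeMonoid.length_eq_zero]
  exact image_ne_one hφ _

theorem length_le_of_injective (hφ : Function.Injective φ) (u : FreeMonoid A) :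
    u.length ≤ (φ u).length := by
  induction u using FreeMonoid.recOn with
  | one => simp
  | of_mul c u h =>
    rw [map_mul, FreeMonoid.length_mul, FreeMonoid.length_mul, FreeMonoid.length_of]
    have := FreeMonoid.length_eq_zero.not.2 (image_ne_one hφ c)
    omega

theorem finite_occurrences {x y : FreeMonoid B} : (occurrences x y).Finite :=
  (Set.finite_Iic y.length).subset fun _ h => h.1

/-- An image that is a suffix of the prefix of length `j` occurs in the word from position `j` minus
its length on. For a fixed image the end `j` is determined by the start, so exchanging the sums over
images and ends gives the bound. -/
theorem sum_suffixCount_le (he : Function.Injective e) (hφ : Function.Injective φ)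
    (x : FreeMonoid B) : ∑ j ∈ Finset.Ico 1 (x.length + 1),
      suffixCount {v | v ∈ encodeImages num e φ} ((encode e x).take j) ≤ totalOcc φ x := by
  classical
  set v : Fin σ → FreeMonoid B := fun k => φ (FreeMonoid.of (num.symm k)) with hv
  have h1 : ∀ g, suffixCount {v | v ∈ encodeImages num e φ} g ≤
      ∑ k, if encode e (v k) <:+ g then 1 else 0 := by
    intro g
    rw [suffixCount, suffixCountUpTo, ← Finset.card_filter]
    refine (Finset.card_le_card (fun l hl => ?_)).trans
      (Finset.card_image_le (f := fun k => (v k).length))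
    simp only [Finset.mem_filter, Finset.mem_range, Set.mem_ofPred_eq, encodeImages,
      List.mem_ofFn] at hl
    obtain ⟨hl, k, hk⟩ := hl
    simp only [Finset.mem_image, Finset.mem_filter, Finset.mem_univ, true_and]
    refine ⟨k, ?_, ?_⟩
    · rw [hv]
      simp only [hk]
      exact List.drop_suffix _ _
    · have := congrArg List.length hk
      simp only [length_encode, List.length_drop] at this
      simp only [hv, this]
      omega
  refine (Finset.sum_le_sum fun j _ => h1 _).trans ?_
  rw [Finset.sum_comm, totalOcc, finsum_images hφ num]
  refine Finset.sum_le_sum fun k _ => ?_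
  rw [← Finset.card_filter, occ, ← Set.ncard_coe_finset]
  refine Set.ncard_le_ncard_of_injOn (fun j => j - (v k).length) ?_ ?_ finite_occurrences
  · intro j hj
    simp only [Finset.coe_filter, Finset.mem_Ico, Set.mem_ofPred_eq] at hj
    obtain ⟨⟨hj1, hj2⟩, t, ht⟩ := hj
    have hlen := congrArg List.length ht
    simp only [List.length_append, length_encode, List.length_take] at hlen
    refine ⟨by omega, ?_⟩
    rw [← List.prefix_map_iff_of_injective he, List.map_drop]
    change encode e (v k) <+: (encode e x).drop _
    rw [show j - (v k).length = t.length by omega, ← List.take_append_drop j (encode e x), ← ht,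
      List.append_assoc, List.drop_left]
    exact List.prefix_append _ _
  · intro i hi j hj hij
    simp only [Finset.coe_filter, Finset.mem_Ico, Set.mem_ofPred_eq] at hi hj
    have h1 := hi.2.length_le
    have h2 := hj.2.length_le
    simp only [length_encode, List.length_take] at h1 h2
    simp only at hij
    omega

end Numbering

end Encoding

end WordRAM

/-! ### The initial memory, and the passage from single runs to expected time. -/

namespace WordRAM

open WordTrie WordMorphism MeasureTheory

section Input

variable {A B : Type*} {w σ : ℕ} {num : A ≃ Fin σ} {code : B ↪ BitVec w}
  {φ : FreeMonoid A →* FreeMonoid B} {u : FreeMonoid A}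

/-- A list that fits into the address space is read without wrap-around, and beyond the address
space both sides take the default `0`. -/
theorem toNat_arrayOf {l : List (BitVec w)} (hl : l.length ≤ 2 ^ w) (i : ℕ) :
    (if i < 2 ^ w then (arrayOf l (BitVec.ofNat w i)).toNat else 0) =
      (l.map BitVec.toNat).getD i 0 := by
  split_ifs with h
  · rw [arrayOf, BitVec.toNat_ofNat, Nat.mod_eq_of_lt h, List.getD_eq_getElem?_getD,
      List.getD_eq_getElem?_getD, List.getElem?_map]
    cases l[i]? <;> simp
  · rw [List.getD_eq_default]
    rw [List.length_map]
    omega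

theorem input_inputState (hφ : Function.Injective φ)
    (h : totalLength φ + (φ u).length + 1 ≤ 2 ^ w) :
    Input (encodeImages num (fun b => (code b).toNat) φ) (u.toList.map fun c => (num c : ℕ))
      (inputState num code φ u).mem := by
  have hσ := le_totalLength hφ num
  have hu := length_le_of_injective hφ u
  have hflat := length_flatten_encodeImages (num := num) (e := fun b => (code b).toNat) hφ
  have hlen (k : Fin σ) : (φ (FreeMonoid.of (num.symm k))).length ≤ totalLength φ := by
    rw [totalLength, finsum_images hφ num]
    exact Finset.single_le_sum (f := fun k => (φ (FreeMonoid.of (num.symm k))).length)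
      (fun _ _ => Nat.zero_le _) (Finset.mem_univ k)
  constructor
  · simp only [State.mem, inputState, BitVec.toNat_ofNat]
    rw [length_encodeImages, Nat.mod_eq_of_lt (by omega)]
  · simp only [State.mem, inputState, BitVec.toNat_ofNat]
    rw [List.length_map, Nat.mod_eq_of_lt (by omega)]
    rfl
  · intro i h0 h1
    match i, h0, h1 with
    | i + 2, _, _ => simp [State.mem, inputState]
  · intro i
    have hmap : ((List.ofFn fun k : Fin σ =>
        (φ (FreeMonoid.of (num.symm k))).toList.map code).flatten.map BitVec.toNat) =
        (encodeImages num (fun b => (code b).toNat) φ).flatten := by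
      rw [List.map_flatten, List.map_ofFn, encodeImages]
      congr 2
      funext k
      simp [encode]
    rw [← hmap]
    refine toNat_arrayOf ?_ i
    rw [← List.length_map BitVec.toNat, hmap]
    omega
  · intro i
    refine (toNat_arrayOf ?_ i).trans ?_
    · rw [List.length_ofFn]
      omega
    · by_cases hi : i < σ
      · have := hlen ⟨i, hi⟩
        rw [List.getD_eq_getElem _ _ (by simpa), List.getD_eq_getElem _ _
          (by rwa [length_encodeImages]), getElem_encodeImages ⟨i, hi⟩]
        simp only [List.getElem_map, List.getElem_ofFn, BitVec.toNat_ofNat, length_encode]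
        exact Nat.mod_eq_of_lt (by omega)
      · rw [List.getD_eq_default _ _ (by simpa using hi), List.getD_eq_default _ _
          (by rw [length_encodeImages]; omega)]
        rfl
  · intro i
    refine (toNat_arrayOf ?_ i).trans ?_
    · rw [List.length_map]
      exact hu.trans (by omega)
    · rw [List.map_map]
      congr 1
      refine List.map_congr_left fun c _ => ?_
      have := (num c).isLt
      simp only [Function.comp_apply, BitVec.toNat_ofNat]
      exact Nat.mod_eq_of_lt (by omega)
  · intro j i hj
    match j, hj with
    | j + 3, _ => simp [State.mem, inputState]
  · rfl

end Input

/-- On a fixed tape there is only one run, by `Exec.unique`, so the run provided by `Runs` is the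
one that the definitions speak of. Monotonicity of the lower integral requires no measurability of
the running time. -/
theorem answersCorrectly_and_expectedTime_le {w : ℕ} (hw : 0 < w) {P : Program} {s : State w}
    {p : Prop} {F : (ℕ → BitVec w) → ℕ} (h : ∀ ω, Runs ω P s.mem fun t m =>
      t ≤ F ω ∧ (p → m.reg 0 = 1) ∧ (¬ p → m.reg 0 = 0)) :
    AnswersCorrectly P s p ∧ expectedTime P s ≤ ∫⁻ ω, (F ω : ℝ≥0∞) ∂(tapeLaw w) := by
  constructor
  · intro ω t s' hs
    obtain ⟨t', s'', hs', -, h1, h0⟩ := h ω s rfl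
    obtain ⟨-, rfl⟩ := hs.unique hs'
    refine ⟨fun hp => BitVec.eq_of_toNat_eq ?_, fun hp => BitVec.eq_of_toNat_eq ?_⟩
    · refine (h1 hp).trans ?_
      simp [hw]
    · refine (h0 hp).trans ?_
      simp
  · refine lintegral_mono fun ω => ?_
    obtain ⟨t, s', hs, ht, -⟩ := h ω s rfl
    exact (iInf_le_of_le t (iInf_le_of_le s' (iInf_le _ hs))).trans (Nat.cast_le.2 ht)

end WordRAM

theorem mainTheorem5 :
    ∃ (P : WordRAM.Program) (C K : ℕ),
      ∀ (w σ : ℕ) (A : Type*) (B : Type*) (num : A ≃ Fin σ) (code : B ↪ BitVec w)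
        (φ : FreeMonoid A →* FreeMonoid B) (u : FreeMonoid A),
        Function.Injective φ →
        K * (WordMorphism.totalLength φ + (φ u).length + 1) ≤ 2 ^ w →
          WordRAM.AnswersCorrectly P (WordRAM.inputState num code φ u)
              (WordMorphism.InterferenceFreeOn φ {u}) ∧
            WordRAM.expectedTime P (WordRAM.inputState num code φ u) ≤
              ((C * (WordMorphism.totalLength φ + (φ u).length
                + WordMorphism.totalOcc φ (φ u) + 1) : ℕ) : ℝ≥0∞) := by
  open WordRAM WordMorphism WordTrie MeasureTheory in
  -- The layout has `z = m + σ + n ≤ 2 * m + n` positions. The expected time is at most `300 + (900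
  -- + 156) * z + 60 * occ`, in which `m` has the coefficient `2112`, and `2 * z + 2 < 4 * (m + n +
  -- 1)` rules out overflow.
  refine ⟨decideInterferenceFree, 2200, 4, fun w σ A B num code φ u hφ hW => ?_⟩
  have hw : 0 < w := by
    rcases Nat.eq_zero_or_pos w with rfl | h
    · omega
    · exact h
  have hm := input_inputState (num := num) (code := code) (u := u) hφ (by omega)
  set e : B → ℕ := fun b => (code b).toNat with he
  have hei : Function.Injective e := fun _ _ h => code.injective (BitVec.eq_of_toNat_eq h)
  set vs := encodeImages num e φ with hvs
  set us := u.toList.map fun c => (num c : ℕ) with hus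
  set T := encode e (φ u) with hT
  -- For the empty word the answer is positive by definition, and the flags at the root, which
  -- presuppose a nonempty text, are never needed.
  by_cases hu : u = 1
  · have hp : InterferenceFreeOn φ {u} := fun v hv hv1 =>
      absurd ((Set.mem_singleton_iff.1 hv).trans hu) hv1
    have hrun : ∀ ω : ℕ → BitVec w, Runs ω decideInterferenceFree (inputState num code φ u).mem
        fun t m => t ≤ 10 ∧ (InterferenceFreeOn φ {u} → m.reg 0 = 1) ∧
          (¬ InterferenceFreeOn φ {u} → m.reg 0 = 0) := by
      refine fun ω => Runs.cond hw trivial (fun h => absurd ?_ h) fun _ => Runs.of_wp hw ?_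
      · exact hm.length.trans (by rw [hus, hu]; rfl)
      · simp [hw.ne', hp]
    obtain ⟨h1, h2⟩ := answersCorrectly_and_expectedTime_le hw hrun
    refine ⟨h1, h2.trans ?_⟩
    rw [lintegral_const, measure_univ, mul_one]
    exact Nat.cast_le.2 (by omega)
  · have hp : InterferenceFreeOn φ {u} ↔
        ¬ Interfered vs T ∧ ¬ ∃ v ∈ vs, IsInner T v := by
      rw [interfered_encode_iff hei isImageList_encodeImages,
        exists_isInner_encode_iff hei isImageList_encodeImages]
      exact ⟨fun h => h u rfl hu, by rintro h _ rfl -; exact h⟩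
    have hTlen : T.length = (φ u).length := length_encode
    have hz := length_layout (vs := vs) (T := T)
    rw [length_flatten_encodeImages hφ, length_encodeImages] at hz
    have hσ := le_totalLength hφ num
    obtain ⟨z, hz'⟩ : ∃ z, z = (layout vs T).length := ⟨_, rfl⟩
    have hus0 : us ≠ [] := fun h => hu (FreeMonoid.toList.injective (List.map_eq_nil_iff.1 h))
    have husσ : ∀ c ∈ us, c < vs.length := by
      simp only [hus, List.mem_map, hvs, length_encodeImages]
      rintro _ ⟨c, -, rfl⟩
      exact (num c).isLt
    obtain ⟨h1, h2⟩ := answersCorrectly_and_expectedTime_le hw fun ω =>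
      runs_decideInterferenceFree_of_ne_nil (ω := ω) (T := T) hw hm hus0
        (nil_notMem_encodeImages hφ) husσ (encode_map_eq_flatMap u) hz' (by omega) rfl rfl
    rw [← hp] at h1
    refine ⟨h1, h2.trans ?_⟩
    have hocc : ∑ j ∈ Finset.Ico 1 (T.length + 1), suffixCount {v | v ∈ vs} (T.take j) ≤
        totalOcc φ (φ u) := by
      rw [hTlen]
      exact sum_suffixCount_le hei hφ (φ u)
    simp only [Nat.cast_add _ (60 * _), Nat.cast_add (300 + 900 * z)]
    rw [lintegral_add_right _ measurable_const, lintegral_add_left measurable_const,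
      lintegral_const, lintegral_const, measure_univ, mul_one, mul_one]
    refine (add_le_add_left (add_le_add_right (lintegral_cost_le (by omega) _) _) _).trans ?_
    rw [← Nat.cast_add, ← Nat.cast_add, Nat.cast_le]
    omega
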